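/- **Setting.** Let $n\ge 2$, $p\ge 1$. Agents $i\in[n]$ have local costs $f_i:\mathbb R^p\to\mathbb R$; put $f=\frac1n\sum_i f_i$. Assume: 1. each $f_i$ is continuously differentiable and $\nabla f_i$ is $L$-Lipschitz, $L>0$; 2. $\langle\nabla f(x)-\nabla f(y),x-y\rangle\ge\mu\|x-y\|^2$ for all $x,y$, with $\mu>0$; $x^*$ denotes the minimizer of $f$; 3. for each $k\ge0$, $\mathbb G_k$ is a strongly connected directed graph on $[n]$ with a self-loop at every node; 4. the random vectors $\xi_k^i\in\mathbb R^m$ ($k\ge 0$, $i\in[n]$) are mutually independent and, for all $i,k,x$, $\mathbb E[g_i(x,\xi_k^i)]=\nabla f_i(x)$ and $\mathbb E\|g_i(x,\xi_k^i)-\nabla f_i(x)\|^2\le\sigma^2$, with $\sigma>0$; 5. each $A_k$ is row-stochastic, each $B_k$ is column-stochastic; $[A_k]_{ij}>0$ if $j=i$ or $(j,i)$ is an edge of $\mathbb G_k$, and $[A_k]_{ij}=0$ otherwise, and likewise for $[B_k]_{ij}$; all positive entries of the $A_k$ are at least $a>0$, and those of the $B_k$ at least $b>0$. **Algorithm.**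 With arbitrary $x_0^i\in\mathbb R^p$, $y_0^i=g_i(x_0^i,\xi_0^i)$ and step-size $\alpha>0$, $$x_{k+1}^i=\sum_j[A_k]_{ij}x_k^j-\alpha y_k^i,\qquad y_{k+1}^i=\sum_j[B_k]_{ij}y_k^j+g_i(x_{k+1}^i,\xi_{k+1}^i)-g_i(x_k^i,\xi_k^i).$$ **Errors.** Let $\pi_0=\frac1n\mathbf 1$, $\pi_{k+1}=B_k\pi_k$, and let $\phi_k$ ($k\ge 0$) be stochastic vectors with $\phi_{k+1}^{\mathsf T}A_k=\phi_k^{\mathsf T}$. Put $\hat x_k=\sum_i[\phi_k]_ix_k^i$ and $$V_k=\Big(\mathbb E\|\hat x_k-x^*\|^2,\ \mathbb E\sum_i[\phi_k]_i\|x_k^i-\hat x_k\|^2,\ \mathbb E\sum_i[\pi_k]_i\Big\|\frac{y_k^i}{[\pi_k]_i}-\sum_jy_k^j\Big\|^2\Big)^{\mathsf T}.$$ **Constants.** Let $\mathsf D(\mathbb G)$ be the diameter of $\mathbb G$, and $\mathsf K(\mathbb G)$ its maximal edge-utility: the maximum, over all choices of one shortest path for each ordered pair of distinct nodes and over all edges,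 of the number of chosen paths that traverse the edge. Put $\kappa_k=\min(\pi_k)^{-1/2}$, $\varphi_k=\min(\phi_k)^{-1/2}$, $\psi_k=n(\kappa_{k+1}^2-1)$, $$\tau_k=\sqrt{1-\tfrac{\min^2(\pi_k)\,b^2}{\max^2(\pi_k)\max(\pi_{k+1})\mathsf D(\mathbb G_k)\mathsf K(\mathbb G_k)}},\qquad c_k=\sqrt{1-\tfrac{\min(\phi_{k+1})\,a^2}{\max^2(\phi_k)\mathsf D(\mathbb G_k)\mathsf K(\mathbb G_k)}}.$$ Let $c,\tau\in(0,1)$, $\kappa>1$, $\varphi>1$, $\psi>0$ be upper bounds, over all $k\ge 0$, of $c_k,\tau_k,\kappa_k,\varphi_k,\psi_k$, with $\psi\le n(\kappa^2-1)$, and let $\eta>0$ be a lower bound of $\phi_{k+1}^{\mathsf T}\pi_k$ over all $k\ge 0$. Put $\nu=\frac{4L^2\kappa^2\tau^2}{1-\tau^2}+2\psi L^2$, $$m_1=\tfrac{n\mu}2,\ m_2=\tfrac{3L^2\varphi^2}\mu,\ m_3=\tfrac3{n\mu\eta},\ m_4=\tfrac{2nL^2\varphi^2(1+c^2)}{1-c^2},\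 m_5=\tfrac{1+c^2}{1-c^2},\ m_6=2nL^2\varphi^2\nu,\ m_7=4\varphi^2\nu,\ m_8=\nu,$$ $$b_1=\tfrac{3n\sigma^2}2,\ b_2=\tfrac{2(1+c^2)}{1-c^2},\ b_3=4n\psi\sigma^2,\ b_4=2Ln\psi\sigma^2,\ b_5=2\nu\sigma^2,$$ $$M(\alpha)=\begin{bmatrix}1-m_1\alpha&m_2\alpha&m_3\alpha\\ m_4\alpha^2&\frac{1+c^2}2+m_4\alpha^2&m_5\alpha^2\\ m_6\alpha^2&m_7+m_6\alpha^2&\frac{1+\tau^2}2+m_8\alpha^2\end{bmatrix},\qquad \mathbf b(\alpha)=\begin{bmatrix}b_1\alpha^2\\ b_2\alpha^2\\ b_3+b_4\alpha+b_5\alpha^2\end{bmatrix}.$$ **Theorem.** If $$0<\alpha\le\min\Big\{\tfrac2{n\eta(L+\mu)},\ \tfrac{\mu\eta(1-c^2)(1-\tau^2)}{4L\varphi\sqrt{(n\mu^2\eta^2+24L^2\varphi^2)(\eta+16\kappa^2)}},\ \tfrac{\mu\eta(1-\tau^2)}{\kappa L\sqrt{2n\mu^2\eta^2(n+4)+6L^2\varphi^2(n\eta+32)}}\Big\},$$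 then the spectral radius $\rho_M$ of $M(\alpha)$ satisfies $\rho_M<1$, the vector $(\mathbb I-M(\alpha))^{-1}\mathbf b(\alpha)$ has non-negative components, all $V_k$ are finite, and, componentwise, $$\limsup_{k\to\infty}V_k\le(\mathbb I-M(\alpha))^{-1}\mathbf b(\alpha),$$ with a linear rate of order $\mathcal O(\rho_M^k)$: there is a constant $K$ (which may depend on the problem instance, including the initial point and $\alpha$) such that every component of $V_k-(\mathbb I-M(\alpha))^{-1}\mathbf b(\alpha)$ is at most $K\rho_M^k$ for all $k\ge 0$. -/

import Mathlib

open MeasureTheory ProbabilityTheory Filter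

noncomputable section

namespace SABTV

/-! ### Directed graphs: strong connectivity, diameter, maximal edge-utility -/

/-- Every node can be reached from every other node along directed edges. -/
def StronglyConnected {V : Type*} (G : Digraph V) : Prop :=
  ∀ u v : V, Relation.ReflTransGen G.Adj u v

/-- `l` is the list of the nodes visited by a directed walk of `G` from `u` to `v`
(its number of edges is `l.length - 1`). -/
def IsWalk {V : Type*} (G : Digraph V) (u v : V) (l : List V) : Prop :=
  l.IsChain G.Adj ∧ l.head? = some u ∧ l.getLast? = some v

/-- A shortest directed path from `u` to `v`. -/
def IsShortestPath {V : Type*} (G : Digraph V) (u v : V) (l : List V) : Prop :=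
  IsWalk G u v l ∧ ∀ l' : List V, IsWalk G u v l' → l.length ≤ l'.length

/-- The directed distance: the least number of edges of a walk from `u` to `v`. -/
def dist {V : Type*} (G : Digraph V) (u v : V) : ℕ :=
  sInf {m | ∃ l : List V, IsWalk G u v l ∧ l.length = m + 1}

/-- The diameter `D(G)`: the largest directed distance between two nodes. -/
def diam {V : Type*} [Fintype V] (G : Digraph V) : ℕ :=
  Finset.univ.sup fun q : V × V => dist G q.1 q.2

/-- A shortest-path covering of `G`: the choice of one shortest path for each ordered pair
of distinct nodes. -/
def IsCovering {V : Type*} (G : Digraph V) (P : V → V → List V) : Prop :=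
  ∀ u v : V, u ≠ v → IsShortestPath G u v (P u v)

/-- The utility of the edge `(j, l)` with respect to the covering `P`: the number of paths of
the covering that traverse this edge. -/
def edgeUtility {V : Type*} (P : V → V → List V) (j l : V) : ℕ :=
  {q : V × V | q.1 ≠ q.2 ∧ [j, l] <:+: P q.1 q.2}.ncard

/-- The maximal edge-utility `K(G)`: the maximum of the utility over all shortest-path coverings
and all edges. -/
def maxEdgeUtility {V : Type*} (G : Digraph V) : ℕ :=
  sSup {m | ∃ P : V → V → List V, IsCovering G P ∧
    ∃ j l : V, G.Adj j l ∧ m = edgeUtility P j l}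

/-! ### The assumptions -/

/-- The average cost `f = (1/n) ∑ i, f i`. -/
def avgCost {n p : ℕ} (f : Fin n → EuclideanSpace ℝ (Fin p) → ℝ)
    (x : EuclideanSpace ℝ (Fin p)) : ℝ :=
  (1 / (n : ℝ)) * ∑ i, f i x

/-- Every `f i` is continuously differentiable with `L`-Lipschitz gradient. -/
def SmoothCosts {n p : ℕ} (f : Fin n → EuclideanSpace ℝ (Fin p) → ℝ) (L : ℝ) : Prop :=
  ∀ i, ContDiff ℝ 1 (f i) ∧
    ∀ x y, ‖gradient (f i) x - gradient (f i) y‖ ≤ L * ‖x - y‖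

/-- The average cost is `μ`-strongly convex. -/
def StronglyConvexAvg {n p : ℕ} (f : Fin n → EuclideanSpace ℝ (Fin p) → ℝ) (mu : ℝ) : Prop :=
  ∀ x y, mu * ‖x - y‖ ^ 2 ≤
    inner ℝ (gradient (avgCost f) x - gradient (avgCost f) y) (x - y)

/-- `W i j > 0` exactly when `j = i` or `(j, i)` is an edge, that is, when agent `i` may use
what agent `j` sends, and `W i j = 0` otherwise. -/
def Compatible {n : ℕ} (G : Digraph (Fin n)) (W : Matrix (Fin n) (Fin n) ℝ) : Prop :=
  ∀ i j, ((G.Adj j i ∨ j = i) → 0 < W i j) ∧ (¬ (G.Adj j i ∨ j = i) → W i j = 0)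

/-- All positive entries of `W` are at least `w`. -/
def PosEntriesGe {n : ℕ} (W : Matrix (Fin n) (Fin n) ℝ) (w : ℝ) : Prop :=
  ∀ i j, 0 < W i j → w ≤ W i j

/-- The stochastic first-order oracle. The random vectors `ξ k i` (the sample of agent `i` at
time `k`) are mutually independent and, at every point, the sampled gradient has finite second
moment, is unbiased, and has variance at most `sigma ^ 2`. -/
structure IsOracle {n p m : ℕ} {Ω : Type*} [MeasurableSpace Ω] (P : Measure Ω)
    (f : Fin n → EuclideanSpace ℝ (Fin p) → ℝ)
    (g : Fin n → EuclideanSpace ℝ (Fin p) → EuclideanSpace ℝ (Fin m) → EuclideanSpace ℝ (Fin p))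
    (ξ : ℕ → Fin n → Ω → EuclideanSpace ℝ (Fin m)) (sigma : ℝ) : Prop where
  measurable_oracle : ∀ i, Measurable (Function.uncurry (g i))
  measurable_sample : ∀ k i, Measurable (ξ k i)
  indep : iIndepFun (fun q : ℕ × Fin n => ξ q.1 q.2) P
  memLp : ∀ k i x, MemLp (fun ω => g i x (ξ k i ω)) 2 P
  unbiased : ∀ k i x, ∫ ω, g i x (ξ k i ω) ∂P = gradient (f i) x
  variance_le : ∀ k i x, ∫ ω, ‖g i x (ξ k i ω) - gradient (f i) x‖ ^ 2 ∂P ≤ sigma ^ 2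

/-! ### The algorithm -/

/-- The pair `(x_k, y_k)` of the agents' decisions and directions along the sample
sequence `z`, started at `x0`. -/
def iterates {n p m : ℕ} (A B : ℕ → Matrix (Fin n) (Fin n) ℝ)
    (g : Fin n → EuclideanSpace ℝ (Fin p) → EuclideanSpace ℝ (Fin m) → EuclideanSpace ℝ (Fin p))
    (α : ℝ) (x0 : Fin n → EuclideanSpace ℝ (Fin p)) (z : ℕ → Fin n → EuclideanSpace ℝ (Fin m)) :
    ℕ → (Fin n → EuclideanSpace ℝ (Fin p)) × (Fin n → EuclideanSpace ℝ (Fin p))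
  | 0 => (x0, fun i => g i (x0 i) (z 0 i))
  | k + 1 =>
    let x := (iterates A B g α x0 z k).1
    let y := (iterates A B g α x0 z k).2
    let x' : Fin n → EuclideanSpace ℝ (Fin p) := fun i => ∑ j, A k i j • x j - α • y i
    (x', fun i => ∑ j, B k i j • y j + g i (x' i) (z (k + 1) i) - g i (x i) (z k i))

/-- The sequence `π_{k+1} = B_k π_k`, `π_0 = (1/n) 𝟏`. -/
def piSeq {n : ℕ} (B : ℕ → Matrix (Fin n) (Fin n) ℝ) : ℕ → Fin n → ℝ
  | 0 => fun _ => 1 / (n : ℝ)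
  | k + 1 => (B k).mulVec (piSeq B k)

/-- The weighted average `∑ i, w i • x i`. -/
def wavg {n p : ℕ} (w : Fin n → ℝ) (x : Fin n → EuclideanSpace ℝ (Fin p)) :
    EuclideanSpace ℝ (Fin p) :=
  ∑ i, w i • x i

/-- The squared weighted norm `∑ i, w i * ‖u i‖ ^ 2`. -/
def wnormSq {n p : ℕ} (w : Fin n → ℝ) (u : Fin n → EuclideanSpace ℝ (Fin p)) : ℝ :=
  ∑ i, w i * ‖u i‖ ^ 2

/-- The gradient tracking error
`S(y, π) = √(∑ i, π i * ‖y i / π i - ∑ j, y j‖ ^ 2)`. -/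
def trackErr {n p : ℕ} (y : Fin n → EuclideanSpace ℝ (Fin p)) (w : Fin n → ℝ) : ℝ :=
  Real.sqrt (wnormSq w fun i => (w i)⁻¹ • y i - ∑ j, y j)

/-- The three squared errors of a pair `(x, y)`: optimality gap of the weighted average,
weighted consensus error, gradient tracking error. -/
def sqErr {n p : ℕ} (phi pie : Fin n → ℝ) (xstar : EuclideanSpace ℝ (Fin p))
    (s : (Fin n → EuclideanSpace ℝ (Fin p)) × (Fin n → EuclideanSpace ℝ (Fin p))) : Fin 3 → ℝ :=
  ![‖wavg phi s.1 - xstar‖ ^ 2,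
    wnormSq phi (fun i => s.1 i - wavg phi s.1),
    trackErr s.2 pie ^ 2]

/-! ### The constants -/

/-- `κ_k = √(1 / min π_k)`. -/
def kappaSeq {n : ℕ} (pie : ℕ → Fin n → ℝ) (k : ℕ) : ℝ :=
  Real.sqrt (1 / ⨅ i, pie k i)

/-- `φ_k = √(1 / min φ_k)`. -/
def vphiSeq {n : ℕ} (phi : ℕ → Fin n → ℝ) (k : ℕ) : ℝ :=
  Real.sqrt (1 / ⨅ i, phi k i)

/-- `ψ_k = n (κ_{k+1}² - 1)`. -/
def psiSeq {n : ℕ} (pie : ℕ → Fin n → ℝ) (k : ℕ) : ℝ :=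
  n * (kappaSeq pie (k + 1) ^ 2 - 1)

/-- `τ_k`, with `b` the lower bound on the positive entries of the matrices `B_k`. -/
def tauSeq {n : ℕ} (G : ℕ → Digraph (Fin n)) (pie : ℕ → Fin n → ℝ) (b : ℝ) (k : ℕ) : ℝ :=
  Real.sqrt (1 - (⨅ i, pie k i) ^ 2 * b ^ 2 /
    ((⨆ i, pie k i) ^ 2 * (⨆ i, pie (k + 1) i) * diam (G k) * maxEdgeUtility (G k)))

/-- `c_k`, with `a` the lower bound on the positive entries of the matrices `A_k`. -/
def cSeq {n : ℕ} (G : ℕ → Digraph (Fin n)) (phi : ℕ → Fin n → ℝ) (a : ℝ) (k : ℕ) : ℝ :=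
  Real.sqrt (1 - (⨅ i, phi (k + 1) i) * a ^ 2 /
    ((⨆ i, phi k i) ^ 2 * diam (G k) * maxEdgeUtility (G k)))

/-- The scalars that enter the error bound. -/
structure Consts where
  (L mu sigma eta c tau kappa vphi psi : ℝ)

namespace Consts

variable (C : Consts)

/-- `ν = 4L²κ²τ²/(1-τ²) + 2ψL²`. -/
def nu : ℝ :=
  4 * C.L ^ 2 * C.kappa ^ 2 * C.tau ^ 2 / (1 - C.tau ^ 2) + 2 * C.psi * C.L ^ 2

/-- `ζ = 4φ²ν`. -/
def zeta : ℝ := 4 * C.vphi ^ 2 * C.nu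

def m1 (n : ℕ) : ℝ := n * C.mu / 2

def m2 : ℝ := 3 * C.L ^ 2 * C.vphi ^ 2 / C.mu

def m3 (n : ℕ) : ℝ := 3 / (n * C.mu * C.eta)

def m4 (n : ℕ) : ℝ := 2 * n * C.L ^ 2 * C.vphi ^ 2 * (1 + C.c ^ 2) / (1 - C.c ^ 2)

def m5 : ℝ := (1 + C.c ^ 2) / (1 - C.c ^ 2)

def m6 (n : ℕ) : ℝ := 2 * n * C.L ^ 2 * C.vphi ^ 2 * C.nu

def m7 : ℝ := C.zeta

def m8 : ℝ := C.nu

def b1 (n : ℕ) : ℝ := 3 * n * C.sigma ^ 2 / 2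

def b2 : ℝ := 2 * (1 + C.c ^ 2) / (1 - C.c ^ 2)

def b3 (n : ℕ) : ℝ := 4 * n * C.psi * C.sigma ^ 2

def b4 (n : ℕ) : ℝ := 2 * C.L * n * C.psi * C.sigma ^ 2

def b5 : ℝ := 2 * C.nu * C.sigma ^ 2

/-- The matrix `M(α)`. -/
def M (n : ℕ) (α : ℝ) : Matrix (Fin 3) (Fin 3) ℝ :=
  !![1 - C.m1 n * α, C.m2 * α, C.m3 n * α;
     C.m4 n * α ^ 2, (1 + C.c ^ 2) / 2 + C.m4 n * α ^ 2, C.m5 * α ^ 2;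
     C.m6 n * α ^ 2, C.m7 + C.m6 n * α ^ 2, (1 + C.tau ^ 2) / 2 + C.m8 * α ^ 2]

/-- The vector `b(α)`. -/
def b (n : ℕ) (α : ℝ) : Fin 3 → ℝ :=
  ![C.b1 n * α ^ 2, C.b2 * α ^ 2, C.b3 n + C.b4 n * α + C.b5 * α ^ 2]

/-- The upper bound on the step-size. -/
def stepBound (n : ℕ) : ℝ :=
  min (2 / (n * C.eta * (C.L + C.mu)))
    (min
      (C.mu * C.eta * (1 - C.c ^ 2) * (1 - C.tau ^ 2) /
        (4 * C.L * C.vphi *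
          Real.sqrt ((n * C.mu ^ 2 * C.eta ^ 2 + 24 * C.L ^ 2 * C.vphi ^ 2) *
            (C.eta + 16 * C.kappa ^ 2))))
      (C.mu * C.eta * (1 - C.tau ^ 2) /
        (C.kappa * C.L *
          Real.sqrt (2 * n * C.mu ^ 2 * C.eta ^ 2 * (n + 4) +
            6 * C.L ^ 2 * C.vphi ^ 2 * (n * C.eta + 32)))))

/-- The spectral radius of `M(α)`: the largest modulus of its complex eigenvalues. -/
def rho (n : ℕ) (α : ℝ) : ENNReal :=
  spectralRadius ℂ ((C.M n α).map (algebraMap ℝ ℂ))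

/-- The vector `(I - M(α))⁻¹ b(α)`. -/
def errBound (n : ℕ) (α : ℝ) : Fin 3 → ℝ :=
  (1 - C.M n α)⁻¹.mulVec (C.b n α)

end Consts

/-- The scalars `c, τ ∈ (0,1)`, `κ, φ > 1`, `ψ > 0` are upper bounds of the sequences `c_k`, `τ_k`,
`κ_k`, `φ_k`, `ψ_k`, where `ψ` is no larger than the bound `n (κ² - 1)` that `κ` gives for `ψ_k`,
and `η > 0` is a lower bound of `φ_{k+1}ᵀ π_k`. -/
structure IsBounds {n : ℕ} (G : ℕ → Digraph (Fin n)) (phi pie : ℕ → Fin n → ℝ) (a b : ℝ)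
    (C : Consts) : Prop where
  c_pos : 0 < C.c
  c_lt_one : C.c < 1
  c_ge : ∀ k, cSeq G phi a k ≤ C.c
  tau_pos : 0 < C.tau
  tau_lt_one : C.tau < 1
  tau_ge : ∀ k, tauSeq G pie b k ≤ C.tau
  kappa_gt_one : 1 < C.kappa
  kappa_ge : ∀ k, kappaSeq pie k ≤ C.kappa
  vphi_gt_one : 1 < C.vphi
  vphi_ge : ∀ k, vphiSeq phi k ≤ C.vphi
  psi_pos : 0 < C.psi
  psi_ge : ∀ k, psiSeq pie k ≤ C.psi
  psi_le : C.psi ≤ n * (C.kappa ^ 2 - 1)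
  eta_pos : 0 < C.eta
  eta_le : ∀ k, C.eta ≤ dotProduct (phi (k + 1)) (pie k)

end SABTV

end

/-!
The expected squared errors `V_k` obey a linear recursion, and the theorem follows by comparing them
with the fixed point `e = (I - M(α))⁻¹ b(α)`.

*Mixing.* One step `z ↦ R z` with a row-stochastic `R` lowers the weighted variance by the sum, over
the agents `i`, of the variance of `z` under row `i` of `R`. Keeping only the pairs formed by an
agent and an in-neighbour, and comparing the sum over the edges with the sum over all pairs through
a shortest-path covering (`sum_norm_sub_sq_le_sum_adj`), gives the factors `c_k` and `τ_k`
(`sum_weight_norm_mulVec_sub_sq_le`). For the directions `y` the rescaled vectors `y_i / π_i` are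
mixed by the row-stochastic matrix `[B]_ij π_j / π'_i`.

*One step in mean.* The noise of agent `i` at time `k` is orthogonal in `L²` to everything that does
not depend on its sample at time `k` (`Run.integral_inner_noise`). Pathwise inequalities therefore
need to control only the products of correlated quantities: the noise with itself, with the mixed
direction of the same agent, and with the gradient at the next decision, which depends on it through
`-α y`. Integration gives `Run.Setting.integral_gap_succ_le`, `integral_cons_succ_le` and
`integral_track_succ_le`.

*Two features of the constants.* The first row of `M(α)` carries `m₁ = n μ / 2` without the factor
`θ_k = φ_{k+1}ᵀ π_k` of the true step along the total direction. What holds is the first row damped: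
`V_{k+1} ≤ (1 - θ_k) V_k + θ_k (M V_k + b)`, which has the same fixed point. Moreover `b₂` and `b₅`
do not contain all the noise of the total direction; the sequence `V_k + (0, 0, n σ²)` does satisfy
the recursion, because `b₃` is large enough to pay for the shift, and it satisfies it with a strict
slack in every component (`Run.Setting.shifted_recursion`).

*Conclusion.* The step-size condition yields a positive vector `v` with `M(α) v < v`
(`Consts.Admissible.exists_mulVec_lt`), whence `ρ_M < 1`, the invertibility of `I - M(α)` and the
non-negativity of `e`. By the slack, the shifted errors are at most `e - δ v + K ρ^k v` for some
`δ > 0` and `ρ < 1` (`exists_le_sub_add_pow`). Thus `V_k ≤ e` for all large `k`, which gives the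
limit superior; and since `ρ_M > 0`, the finitely many remaining times are covered by a multiple of
`ρ_M ^ k`, whatever the rate `ρ` is.
-/

namespace SABTV

/-! ### Non-negative matrices with a strictly contracted positive vector -/

section Perron

variable {ι : Type*} [Fintype ι]

/-- Comparison principle: look at a component where `u i / v i` is maximal. It serves for the
spectral radius, the invertibility of `1 - M` and the positivity of its inverse. -/
theorem nonpos_of_smul_le_mulVec {M : Matrix ι ι ℝ} (hM : ∀ i j, 0 ≤ M i j) {v : ι → ℝ}
    (hv : ∀ i, 0 < v i) {ρ s : ℝ} (hMv : ∀ i, M.mulVec v i ≤ ρ * v i) (hs : ρ < s)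
    {u : ι → ℝ} (hu : ∀ i, s * u i ≤ M.mulVec u i) : ∀ i, u i ≤ 0 := by
  intro i₁
  obtain ⟨i₀, -, hmax⟩ := Finset.exists_max_image Finset.univ (fun i => u i / v i)
    ⟨i₁, Finset.mem_univ _⟩
  by_contra! hpos
  set q := u i₀ / v i₀ with hq
  have hq0 : 0 < q := (div_pos hpos (hv i₁)).trans_le (hmax i₁ (Finset.mem_univ _))
  have hle : ∀ j, u j ≤ q * v j := fun j =>
    (div_le_iff₀ (hv j)).1 (hmax j (Finset.mem_univ _))
  have h1 : M.mulVec u i₀ ≤ q * M.mulVec v i₀ := by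
    simp only [Matrix.mulVec, dotProduct, Finset.mul_sum]
    refine Finset.sum_le_sum fun j _ => ?_
    calc M i₀ j * u j ≤ M i₀ j * (q * v j) := mul_le_mul_of_nonneg_left (hle j) (hM _ _)
      _ = _ := by ring
  have h2 : u i₀ = q * v i₀ := by rw [hq, div_mul_cancel₀ _ (hv i₀).ne']
  have h3 := hu i₀
  have h4 := mul_le_mul_of_nonneg_left (hMv i₀) hq0.le
  have h5 : 0 < (s - ρ) * (q * v i₀) := mul_pos (sub_pos.2 hs) (mul_pos hq0 (hv i₀))
  rw [h2] at h3
  linarith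

theorem exists_contraction_factor [Nonempty ι] {M : Matrix ι ι ℝ} {v : ι → ℝ}
    (hv : ∀ i, 0 < v i) (hMv : ∀ i, M.mulVec v i < v i) :
    ∃ ρ : ℝ, 0 ≤ ρ ∧ ρ < 1 ∧ ∀ i, M.mulVec v i ≤ ρ * v i := by
  obtain ⟨i₀, -, hmax⟩ := Finset.exists_max_image Finset.univ (fun i => M.mulVec v i / v i)
    Finset.univ_nonempty
  refine ⟨max 0 (M.mulVec v i₀ / v i₀), le_max_left _ _,
    max_lt one_pos ((div_lt_one (hv _)).2 (hMv _)), fun i => ?_⟩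
  rw [← div_le_iff₀ (hv i)]
  exact (hmax i (Finset.mem_univ _)).trans (le_max_right _ _)

theorem nonneg_of_eq_mulVec_add {M : Matrix ι ι ℝ} (hM : ∀ i j, 0 ≤ M i j) {v : ι → ℝ}
    (hv : ∀ i, 0 < v i) {ρ : ℝ} (hρ : ρ < 1) (hMv : ∀ i, M.mulVec v i ≤ ρ * v i)
    {e b : ι → ℝ} (hb : ∀ i, 0 ≤ b i) (he : ∀ i, e i = M.mulVec e i + b i) : ∀ i, 0 ≤ e i := by
  have h := nonpos_of_smul_le_mulVec hM hv hMv hρ (u := -e)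
    (fun i => by
      rw [one_mul, Matrix.mulVec_neg, Pi.neg_apply, Pi.neg_apply]
      linarith [he i, hb i])
  exact fun i => by simpa using h i

variable [DecidableEq ι]

theorem isUnit_det_one_sub {M : Matrix ι ι ℝ} (hM : ∀ i j, 0 ≤ M i j) {v : ι → ℝ}
    (hv : ∀ i, 0 < v i) {ρ : ℝ} (hρ : ρ < 1) (hMv : ∀ i, M.mulVec v i ≤ ρ * v i) :
    IsUnit (1 - M).det := by
  rw [isUnit_iff_ne_zero]
  intro h0
  obtain ⟨u, hu0, hu⟩ := Matrix.exists_mulVec_eq_zero_iff.2 h0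
  rw [Matrix.sub_mulVec, Matrix.one_mulVec, sub_eq_zero] at hu
  apply hu0
  have h1 := nonpos_of_smul_le_mulVec hM hv hMv hρ (u := u)
    (fun i => by rw [one_mul]; exact (congrFun hu i).le)
  have h2 := nonpos_of_smul_le_mulVec hM hv hMv hρ (u := -u)
    (fun i => by rw [one_mul, Matrix.mulVec_neg, ← hu])
  funext i
  exact le_antisymm (h1 i) (by simpa using h2 i)

theorem spectralRadius_map_le {M : Matrix ι ι ℝ} (hM : ∀ i j, 0 ≤ M i j) {v : ι → ℝ}
    (hv : ∀ i, 0 < v i) {ρ : ℝ} (hMv : ∀ i, M.mulVec v i ≤ ρ * v i) :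
    spectralRadius ℂ (M.map (algebraMap ℝ ℂ)) ≤ ENNReal.ofReal ρ := by
  refine iSup₂_le fun z hz => ?_
  rw [spectrum.mem_iff, Matrix.isUnit_iff_isUnit_det, isUnit_iff_ne_zero, not_not] at hz
  obtain ⟨u, hu0, hu⟩ := Matrix.exists_mulVec_eq_zero_iff.2 hz
  rw [Matrix.sub_mulVec, sub_eq_zero] at hu
  have hle : ‖z‖ ≤ ρ := by
    by_contra! hlt
    have h := nonpos_of_smul_le_mulVec hM hv hMv hlt (u := fun i => ‖u i‖) (fun i => by
      have hi := congrFun hu i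
      rw [Matrix.algebraMap_eq_diagonal, Pi.algebraMap_def] at hi
      simp only [Matrix.mulVec_diagonal, Algebra.algebraMap_self, RingHom.id_apply] at hi
      rw [← norm_mul, hi]
      refine (norm_sum_le _ _).trans (Finset.sum_le_sum fun j _ => ?_)
      simp [abs_of_nonneg (hM i j)])
    exact hu0 (funext fun i => norm_le_zero_iff.1 (h i))
  calc (‖z‖₊ : ENNReal) = ENNReal.ofReal ‖z‖ := (ofReal_norm z).symm
    _ ≤ ENNReal.ofReal ρ := ENNReal.ofReal_le_ofReal hle

/-- A matrix with positive trace has a non-zero complex eigenvalue. -/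
theorem spectralRadius_map_pos [Nonempty ι] {M : Matrix ι ι ℝ} (hM : 0 < M.trace) :
    0 < spectralRadius ℂ (M.map (algebraMap ℝ ℂ)) := by
  by_contra! h0
  have hz : ∀ z ∈ (M.map (algebraMap ℝ ℂ)).charpoly.roots, z = 0 := by
    intro z hz
    have hz' : z ∈ spectrum ℂ (M.map (algebraMap ℝ ℂ)) := by
      rw [Matrix.mem_spectrum_iff_isRoot_charpoly]
      exact Polynomial.isRoot_of_mem_roots hz
    have : (‖z‖₊ : ENNReal) ≤ 0 := (le_iSup₂ (f := fun z (_ : z ∈ spectrum ℂ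
      (M.map (algebraMap ℝ ℂ))) => (‖z‖₊ : ENNReal)) z hz').trans h0
    simpa using this
  have ht := Matrix.trace_eq_sum_roots_charpoly (M.map (algebraMap ℝ ℂ))
  rw [Multiset.sum_eq_zero hz] at ht
  have ht' : (M.map (algebraMap ℝ ℂ)).trace = ((M.trace : ℝ) : ℂ) := by
    simp [Matrix.trace]
  rw [ht'] at ht
  exact hM.ne' (by exact_mod_cast ht)

end Perron

/-! ### The step-size condition -/

namespace Consts

/-- What the argument uses of the relations between the scalars. -/
structure Admissible (C : Consts) (n : ℕ) : Prop where
  two_le : (2 : ℝ) ≤ n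
  L_pos : 0 < C.L
  mu_pos : 0 < C.mu
  mu_le : C.mu ≤ C.L
  sigma_pos : 0 < C.sigma
  eta_pos : 0 < C.eta
  eta_le_one : C.eta ≤ 1
  c_pos : 0 < C.c
  c_lt_one : C.c < 1
  tau_pos : 0 < C.tau
  tau_lt_one : C.tau < 1
  kappa_pos : 0 < C.kappa
  le_kappa_sq : (n : ℝ) ≤ C.kappa ^ 2
  vphi_pos : 0 < C.vphi
  le_vphi_sq : (n : ℝ) ≤ C.vphi ^ 2
  le_psi : (n : ℝ) ≤ C.psi
  psi_le : C.psi ≤ n * C.kappa ^ 2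

namespace Admissible

variable {C : Consts} {n : ℕ} (h : C.Admissible n)
include h

theorem n_pos : (0 : ℝ) < n := by linarith [h.two_le]

theorem c_sq_lt_one : C.c ^ 2 < 1 := by nlinarith [h.c_pos, h.c_lt_one]

theorem tau_sq_lt_one : C.tau ^ 2 < 1 := by nlinarith [h.tau_pos, h.tau_lt_one]

theorem le_nu : 2 * n * C.L ^ 2 ≤ C.nu := by
  have h1 : 0 < 1 - C.tau ^ 2 := by linarith [h.tau_sq_lt_one]
  have h2 : 0 ≤ 4 * C.L ^ 2 * C.kappa ^ 2 * C.tau ^ 2 / (1 - C.tau ^ 2) := by positivity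
  have h3 := mul_le_mul_of_nonneg_right h.le_psi (sq_nonneg C.L)
  unfold nu
  linarith

theorem nu_pos : 0 < C.nu := by
  have := h.L_pos
  have := h.n_pos
  exact lt_of_lt_of_le (by positivity) h.le_nu

theorem nu_mul_le : C.nu * ((1 - C.tau ^ 2) / 2) ≤ n * C.L ^ 2 * C.kappa ^ 2 := by
  have h1 : 0 < 1 - C.tau ^ 2 := by linarith [h.tau_sq_lt_one]
  have h2 : C.nu * ((1 - C.tau ^ 2) / 2)
      = 2 * C.L ^ 2 * C.kappa ^ 2 * C.tau ^ 2 + C.psi * C.L ^ 2 * (1 - C.tau ^ 2) := by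
    unfold nu
    field_simp
    ring
  have h3 : C.psi * (C.L ^ 2 * (1 - C.tau ^ 2))
      ≤ n * C.kappa ^ 2 * (C.L ^ 2 * (1 - C.tau ^ 2)) :=
    mul_le_mul_of_nonneg_right h.psi_le (by positivity)
  have h4 : 2 * (C.L ^ 2 * C.kappa ^ 2 * C.tau ^ 2) ≤ n * (C.L ^ 2 * C.kappa ^ 2 * C.tau ^ 2) :=
    mul_le_mul_of_nonneg_right h.two_le (by positivity)
  rw [h2]
  linarith

/-- The only consequence of the step-size condition that is needed; it comes from the second term
of the minimum. -/
theorem alpha_sq_le {α : ℝ} (hα : 0 < α) (hα' : α ≤ C.stepBound n) :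
    α ^ 2 * (384 * C.L ^ 4 * C.vphi ^ 4 * C.kappa ^ 2)
      ≤ C.mu ^ 2 * C.eta ^ 2 * ((1 - C.c ^ 2) / 2) ^ 2 * ((1 - C.tau ^ 2) / 2) ^ 2 := by
  have := h.L_pos
  have := h.mu_pos
  have := h.eta_pos
  have := h.vphi_pos
  have := h.kappa_pos
  have := h.n_pos
  have hγ : 0 < 1 - C.c ^ 2 := by linarith [h.c_sq_lt_one]
  have hδ : 0 < 1 - C.tau ^ 2 := by linarith [h.tau_sq_lt_one]
  have h1 : α ≤ C.mu * C.eta * (1 - C.c ^ 2) * (1 - C.tau ^ 2) /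
        (4 * C.L * C.vphi *
          Real.sqrt ((n * C.mu ^ 2 * C.eta ^ 2 + 24 * C.L ^ 2 * C.vphi ^ 2) *
            (C.eta + 16 * C.kappa ^ 2))) :=
    hα'.trans ((min_le_right _ _).trans (min_le_left _ _))
  set Z := (n * C.mu ^ 2 * C.eta ^ 2 + 24 * C.L ^ 2 * C.vphi ^ 2) * (C.eta + 16 * C.kappa ^ 2)
    with hZ
  have hZle : (24 * C.L ^ 2 * C.vphi ^ 2) * (16 * C.kappa ^ 2) ≤ Z :=
    mul_le_mul (by linarith [show 0 ≤ n * C.mu ^ 2 * C.eta ^ 2 by positivity]) (by linarith)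
      (by positivity) (by positivity)
  have hZ0 : 0 < Z := lt_of_lt_of_le (by positivity) hZle
  have hs : 0 < Real.sqrt Z := Real.sqrt_pos.2 hZ0
  rw [le_div_iff₀ (by positivity)] at h1
  have h2 := pow_le_pow_left₀ (by positivity) h1 2
  have h3 : (α * (4 * C.L * C.vphi * Real.sqrt Z)) ^ 2
      = 16 * (α ^ 2 * C.L ^ 2 * C.vphi ^ 2 * Z) := by
    rw [show (α * (4 * C.L * C.vphi * Real.sqrt Z)) ^ 2
      = 16 * (α ^ 2 * C.L ^ 2 * C.vphi ^ 2 * Real.sqrt Z ^ 2) by ring, Real.sq_sqrt hZ0.le]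
  rw [h3] at h2
  have h4 : α ^ 2 * C.L ^ 2 * C.vphi ^ 2 * ((24 * C.L ^ 2 * C.vphi ^ 2) * (16 * C.kappa ^ 2))
      ≤ α ^ 2 * C.L ^ 2 * C.vphi ^ 2 * Z := mul_le_mul_of_nonneg_left hZle (by positivity)
  nlinarith [h4, h2]

/-- The step-size is small enough for a gradient step along `n f` to contract: here the factor
`n ≤ φ²` comes for free, since the weights sum to one. -/
theorem alpha_le {α : ℝ} (hα : 0 < α) (hα' : α ≤ C.stepBound n) :
    20 * (α * n * C.L ^ 2) ≤ C.mu := by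
  have hL := h.L_pos
  have hmu := h.mu_pos
  have hn := h.n_pos
  have hγ : 0 < 1 - C.c ^ 2 := by linarith [h.c_sq_lt_one]
  have hδ : 0 < 1 - C.tau ^ 2 := by linarith [h.tau_sq_lt_one]
  have h1 := h.alpha_sq_le hα hα'
  have h2 : C.eta ^ 2 * ((1 - C.c ^ 2) / 2) ^ 2 * ((1 - C.tau ^ 2) / 2) ^ 2 ≤ 1 := by
    refine mul_le_one₀ (mul_le_one₀ (pow_le_one₀ h.eta_pos.le h.eta_le_one) (by positivity)
      (pow_le_one₀ (by positivity) ?_)) (by positivity) (pow_le_one₀ (by positivity) ?_)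
    · linarith [sq_nonneg C.c]
    · linarith [sq_nonneg C.tau]
  have h3 : C.mu ^ 2 * (C.eta ^ 2 * ((1 - C.c ^ 2) / 2) ^ 2 * ((1 - C.tau ^ 2) / 2) ^ 2)
      ≤ C.mu ^ 2 * 1 := mul_le_mul_of_nonneg_left h2 (sq_nonneg _)
  have h4 : (n : ℝ) ^ 2 * 2 ≤ C.vphi ^ 4 * C.kappa ^ 2 := by
    have h5 : (n : ℝ) ^ 2 ≤ (C.vphi ^ 2) ^ 2 := pow_le_pow_left₀ hn.le h.le_vphi_sq 2
    calc (n : ℝ) ^ 2 * 2 ≤ (C.vphi ^ 2) ^ 2 * C.kappa ^ 2 :=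
          mul_le_mul h5 (h.two_le.trans h.le_kappa_sq) (by norm_num) (by positivity)
      _ = _ := by ring
  have h6 : α ^ 2 * C.L ^ 4 * ((n : ℝ) ^ 2 * 2) ≤ α ^ 2 * C.L ^ 4 * (C.vphi ^ 4 * C.kappa ^ 2) :=
    mul_le_mul_of_nonneg_left h4 (by positivity)
  refine (pow_le_pow_iff_left₀ (by positivity) hmu.le two_ne_zero).1 ?_
  have h7 : 0 ≤ α ^ 2 * C.L ^ 4 * ((n : ℝ) ^ 2 * 2) := by positivity
  linarith

theorem M_pos {α : ℝ} (hα : 0 < α) (hα' : α ≤ C.stepBound n) (i j : Fin 3) :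
    0 < C.M n α i j := by
  have hL := h.L_pos
  have hmu := h.mu_pos
  have hn := h.n_pos
  have := h.eta_pos
  have := h.vphi_pos
  have := h.kappa_pos
  have := h.nu_pos
  have hγ : 0 < 1 - C.c ^ 2 := by linarith [h.c_sq_lt_one]
  have hδ : 0 < 1 - C.tau ^ 2 := by linarith [h.tau_sq_lt_one]
  have h00 : 0 < 1 - C.m1 n * α := by
    have h1 := h.alpha_le hα hα'
    have h2 : C.mu * C.mu ≤ C.L ^ 2 := by nlinarith [h.mu_le]
    have h3 : α * n * (C.mu * C.mu) ≤ α * n * C.L ^ 2 :=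
      mul_le_mul_of_nonneg_left h2 (by positivity)
    have h4 : (20 * (α * n * C.mu)) * C.mu ≤ 1 * C.mu := by linarith
    have h5 := le_of_mul_le_mul_right h4 hmu
    unfold m1
    linarith
  fin_cases i <;> fin_cases j <;>
    simp only [M, Matrix.of_apply, Matrix.cons_val', Matrix.cons_val_zero, Matrix.cons_val_one,
      Matrix.cons_val, Fin.zero_eta, Fin.mk_one, Fin.reduceFinMk, Matrix.cons_val_fin_one,
      m2, m3, m4, m5, m6, m7, m8,
      zeta] <;> first | exact h00 | positivity

/-- A positive vector that `M(α)` contracts strictly. Its third entry makes the contribution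
`m₃ v₃` half of the gain `m₁ v₁`; the ratio of the other two balances the term `m₇ v₂`,
which does not vanish with `α`, against `(1 - τ²) v₃ / 2`. -/
theorem exists_mulVec_lt {α : ℝ} (hα : 0 < α) (hα' : α ≤ C.stepBound n) :
    ∃ v : Fin 3 → ℝ, (∀ i, 0 < v i) ∧ ∀ i, (C.M n α).mulVec v i < v i := by
  have hL := h.L_pos
  have hmu := h.mu_pos
  have hn := h.n_pos
  have heta := h.eta_pos
  have hvphi := h.vphi_pos
  have hkappa := h.kappa_pos
  have hnu := h.nu_pos
  have hA := h.alpha_sq_le hα hα'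
  have hnu1 := h.le_nu
  have hnu2 := h.nu_mul_le
  obtain ⟨γ, hγ⟩ : ∃ γ, γ = (1 - C.c ^ 2) / 2 := ⟨_, rfl⟩
  obtain ⟨δ, hδ⟩ : ∃ δ, δ = (1 - C.tau ^ 2) / 2 := ⟨_, rfl⟩
  have hγ0 : 0 < γ := by rw [hγ]; linarith [h.c_sq_lt_one]
  have hγ1 : γ < 1 / 2 := by rw [hγ]; nlinarith [h.c_pos]
  have hδ0 : 0 < δ := by rw [hδ]; linarith [h.tau_sq_lt_one]
  have hδ1 : δ < 1 / 2 := by rw [hδ]; nlinarith [h.tau_pos]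
  rw [← hδ] at hnu2
  rw [← hδ, ← hγ] at hA
  have hc : C.c ^ 2 = 1 - 2 * γ := by rw [hγ]; ring
  have ht : C.tau ^ 2 = 1 - 2 * δ := by rw [hδ]; ring
  obtain ⟨v₃, hv₃⟩ : ∃ v₃, v₃ = (n : ℝ) ^ 2 * C.mu ^ 2 * C.eta / 12 := ⟨_, rfl⟩
  obtain ⟨v₂, hv₂⟩ : ∃ v₂, v₂ = δ * v₃ / (5 * C.vphi ^ 2 * C.nu) := ⟨_, rfl⟩
  have hv₃0 : 0 < v₃ := by rw [hv₃]; positivity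
  have hv₂0 : 0 < v₂ := by rw [hv₂]; positivity
  have hv₂' : v₂ * (5 * C.vphi ^ 2 * C.nu) = δ * v₃ := by
    rw [hv₂]; field_simp
  have hmuL : C.mu ^ 2 ≤ C.L ^ 2 := pow_le_pow_left₀ hmu.le h.mu_le 2
  have hvn := h.le_vphi_sq
  -- size of `v₃` and `v₂`
  have hv₃le : v₃ ≤ n * C.L ^ 2 * C.vphi ^ 2 / 12 := by
    have h1 : (n : ℝ) ^ 2 * C.mu ^ 2 * C.eta ≤ n * C.L ^ 2 * C.vphi ^ 2 * 1 := by
      refine mul_le_mul ?_ h.eta_le_one heta.le (by positivity)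
      calc (n : ℝ) ^ 2 * C.mu ^ 2 = n * (C.mu ^ 2 * n) := by ring
        _ ≤ n * (C.L ^ 2 * C.vphi ^ 2) := by
            gcongr
        _ = _ := by ring
    rw [hv₃]; linarith
  have hv₂le : v₂ ≤ 1 / 100 := by
    have h1 : v₂ * (5 * C.vphi ^ 2 * (2 * n * C.L ^ 2)) ≤ δ * v₃ := by
      rw [← hv₂']; gcongr
    have h2 : δ * v₃ ≤ 1 / 2 * (n * C.L ^ 2 * C.vphi ^ 2 / 12) := by gcongr
    have h3 : 0 < C.vphi ^ 2 * n * C.L ^ 2 := by positivity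
    by_contra! hlt
    have h4 := mul_lt_mul_of_pos_right hlt h3
    linarith
  -- the size of the terms of order `α²`
  obtain ⟨Q, hQ⟩ : ∃ Q, Q = α ^ 2 * (2 * n * C.L ^ 2 * C.vphi ^ 2 * (1 + v₂) + v₃) := ⟨_, rfl⟩
  have hQ0 : 0 < Q := by rw [hQ]; positivity
  have hQlt : Q < γ ^ 2 * v₂ := by
    have h1 : Q ≤ α ^ 2 * (n * C.L ^ 2 * C.vphi ^ 2) * (22 / 10) := by
      rw [hQ, mul_assoc (α ^ 2)]
      refine mul_le_mul_of_nonneg_left ?_ (sq_nonneg α)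
      have h2 : 2 * n * C.L ^ 2 * C.vphi ^ 2 * v₂ ≤ 2 * n * C.L ^ 2 * C.vphi ^ 2 * (1 / 100) := by
        gcongr
      have h3 : 0 < n * C.L ^ 2 * C.vphi ^ 2 := by positivity
      linarith
    have h5 : 0 < 5 * C.vphi ^ 2 * C.nu * δ := by positivity
    refine lt_of_mul_lt_mul_right ?_ h5.le
    have h6 : γ ^ 2 * v₂ * (5 * C.vphi ^ 2 * C.nu * δ) = γ ^ 2 * δ * (δ * v₃) := by
      rw [← hv₂']; ring
    rw [h6]
    calc Q * (5 * C.vphi ^ 2 * C.nu * δ)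
        ≤ α ^ 2 * (n * C.L ^ 2 * C.vphi ^ 2) * (22 / 10) * (5 * C.vphi ^ 2 * C.nu * δ) := by
          gcongr
      _ = 11 * (α ^ 2 * n * C.L ^ 2 * C.vphi ^ 4) * (C.nu * δ) := by ring
      _ ≤ 11 * (α ^ 2 * n * C.L ^ 2 * C.vphi ^ 4) * (n * C.L ^ 2 * C.kappa ^ 2) := by gcongr
      _ = 11 / 384 * n ^ 2 * (α ^ 2 * (384 * C.L ^ 4 * C.vphi ^ 4 * C.kappa ^ 2)) := by ring
      _ ≤ 11 / 384 * n ^ 2 * (C.mu ^ 2 * C.eta ^ 2 * γ ^ 2 * δ ^ 2) := by gcongr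
      _ = 11 / 384 * (n ^ 2 * C.mu ^ 2 * C.eta * γ ^ 2 * δ ^ 2) * C.eta := by ring
      _ ≤ 11 / 384 * (n ^ 2 * C.mu ^ 2 * C.eta * γ ^ 2 * δ ^ 2) * 1 := by
          gcongr; exact h.eta_le_one
      _ < 1 / 12 * (n ^ 2 * C.mu ^ 2 * C.eta * γ ^ 2 * δ ^ 2) := by
          have : 0 < (n : ℝ) ^ 2 * C.mu ^ 2 * C.eta * γ ^ 2 * δ ^ 2 := by positivity
          linarith
      _ = γ ^ 2 * δ * (δ * v₃) := by rw [hv₃]; ring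
  refine ⟨![1, v₂, v₃], fun i => by fin_cases i <;> simp [hv₂0, hv₃0], fun i => ?_⟩
  fin_cases i <;>
    simp only [M, Matrix.mulVec, dotProduct, Fin.sum_univ_three, Matrix.of_apply, Matrix.cons_val',
      Matrix.cons_val_zero, Matrix.cons_val_one, Matrix.cons_val, Fin.zero_eta, Fin.mk_one,
      Fin.reduceFinMk, Matrix.cons_val_fin_one]
  · have h1 : C.m3 n * v₃ = C.m1 n / 2 := by
      rw [m3, m1, hv₃]; field_simp; norm_num
    have h2 : C.m2 * v₂ < C.m1 n / 2 := by
      have h3 : C.m2 * v₂ = C.m1 n / 2 * (C.L ^ 2 * (n * C.eta * δ) / (5 * C.nu)) := by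
        rw [m2, m1, hv₂, hv₃]; field_simp; norm_num
      have h4 : C.L ^ 2 * (n * C.eta * δ) / (5 * C.nu) < 1 := by
        rw [div_lt_one (by positivity)]
        have h5 : C.L ^ 2 * (n * C.eta * δ) ≤ C.L ^ 2 * (n * 1 * (1 / 2)) := by
          gcongr; exact h.eta_le_one
        have : 0 < n * C.L ^ 2 := by positivity
        linarith
      have h6 : 0 < C.m1 n / 2 := by rw [m1]; positivity
      rw [h3]
      exact mul_lt_of_lt_one_right h6 h4
    have h7 : 0 < α * (C.m1 n - C.m2 * v₂ - C.m3 n * v₃) :=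
      mul_pos hα (by rw [h1]; linarith)
    linarith
  · have h1 : C.m4 n * α ^ 2 * 1 + ((1 + C.c ^ 2) / 2 + C.m4 n * α ^ 2) * v₂ + C.m5 * α ^ 2 * v₃
        = (1 - γ) * v₂ + (1 - γ) / γ * Q := by
      rw [m4, m5, hQ, hc]; field_simp; ring
    have h2 : (1 - γ) / γ * Q ≤ 1 / γ * Q := by gcongr; linarith
    have h3 : 1 / γ * Q < 1 / γ * (γ ^ 2 * v₂) := by gcongr
    have h4 : 1 / γ * (γ ^ 2 * v₂) = γ * v₂ := by field_simp
    rw [h1]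
    linarith
  · have h1 : C.m6 n * α ^ 2 * 1 + (C.m7 + C.m6 n * α ^ 2) * v₂
          + ((1 + C.tau ^ 2) / 2 + C.m8 * α ^ 2) * v₃
        = (1 - δ) * v₃ + C.nu * (Q + 4 * C.vphi ^ 2 * v₂) := by
      rw [m6, m7, m8, zeta, hQ, ht]; ring
    have h2 : Q < C.vphi ^ 2 * v₂ := by
      refine hQlt.trans_le (mul_le_mul_of_nonneg_right ?_ hv₂0.le)
      exact (pow_le_one₀ hγ0.le (by linarith)).trans (by linarith [h.two_le])
    have h3 : C.nu * (Q + 4 * C.vphi ^ 2 * v₂) < C.nu * (5 * C.vphi ^ 2 * v₂) := by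
      gcongr; linarith
    rw [h1]
    linarith
end Admissible

end Consts

/-! ### Shortest paths and edge-utility -/

section Graph

variable {V : Type*}

theorem exists_isWalk {G : Digraph V} (hG : StronglyConnected G) (u v : V) :
    ∃ l, IsWalk G u v l := by
  obtain ⟨l, hl, hlast⟩ := List.exists_isChain_cons_of_relationReflTransGen (hG u v)
  exact ⟨u :: l, hl, rfl, by rw [List.getLast?_eq_getLast_of_ne_nil (List.cons_ne_nil _ _), hlast]⟩

theorem exists_isCovering {G : Digraph V} (hG : StronglyConnected G) :
    ∃ P : V → V → List V, IsCovering G P := by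
  have h : ∀ u v, ∃ l, IsShortestPath G u v l := by
    intro u v
    have hne : {l | IsWalk G u v l}.Nonempty := exists_isWalk hG u v
    exact ⟨Function.argminOn List.length _ hne, Function.argminOn_mem List.length _ hne,
      fun l' hl' => Function.argminOn_le List.length _ hl'⟩
  choose P hP using h
  exact ⟨P, fun u v _ => hP u v⟩

theorem exists_eq_append_of_not_nodup {l : List V} (h : ¬ l.Nodup) :
    ∃ a l₁ l₂ l₃, l = l₁ ++ a :: (l₂ ++ a :: l₃) := by
  induction l with
  | nil => exact absurd List.nodup_nil h
  | cons a t ih =>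
    by_cases ha : a ∈ t
    · obtain ⟨l₂, l₃, rfl⟩ := List.append_of_mem ha
      exact ⟨a, [], l₂, l₃, rfl⟩
    · obtain ⟨b, l₁, l₂, l₃, rfl⟩ := ih fun ht => h (List.nodup_cons.2 ⟨ha, ht⟩)
      exact ⟨b, a :: l₁, l₂, l₃, rfl⟩

theorem IsShortestPath.nodup {G : Digraph V} {u v : V} {l : List V}
    (h : IsShortestPath G u v l) : l.Nodup := by
  by_contra hn
  obtain ⟨a, l₁, l₂, l₃, rfl⟩ := exists_eq_append_of_not_nodup hn
  obtain ⟨⟨hc, hh, hl⟩, hmin⟩ := h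
  -- cutting out the closed walk at the repeated node `a` leaves a shorter walk
  have hw : IsWalk G u v (l₁ ++ a :: l₃) := by
    refine ⟨?_, ?_, ?_⟩
    · rw [List.isChain_split] at hc ⊢
      refine ⟨hc.1, ?_⟩
      have := hc.2
      rw [← List.cons_append] at this
      exact this.right_of_append
    · cases l₁ <;> simpa using hh
    · rw [← hl]
      simp [List.getLast?_append, List.getLast?_cons]
  have := hmin _ hw
  simp at this
  omega

theorem IsShortestPath.length_le {G : Digraph V} [Fintype V] {u v : V} {l : List V}
    (h : IsShortestPath G u v l) : l.length ≤ diam G + 1 := by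
  have hpos : 1 ≤ l.length := by
    have := h.1.2.1
    cases l <;> simp_all
  have hne : {m | ∃ l : List V, IsWalk G u v l ∧ l.length = m + 1}.Nonempty :=
    ⟨l.length - 1, l, h.1, by omega⟩
  obtain ⟨l', hl', hlen⟩ := Nat.sInf_mem hne
  have h1 : dist G u v ≤ diam G :=
    Finset.le_sup (f := fun q : V × V => dist G q.1 q.2) (Finset.mem_univ (u, v))
  have h2 := h.2 l' hl'
  have h3 : l'.length = dist G u v + 1 := hlen
  omega

theorem edgeUtility_le [Fintype V] {G : Digraph V} {P : V → V → List V} (hP : IsCovering G P)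
    {j l : V} (hjl : G.Adj j l) : edgeUtility P j l ≤ maxEdgeUtility G := by
  refine le_csSup ⟨Nat.card (V × V), ?_⟩ ⟨P, hP, j, l, hjl, rfl⟩
  rintro m ⟨P', -, j', l', -, rfl⟩
  exact Set.ncard_le_card _

/-- The edges of a walk, with their multiplicity. -/
def edgeList (l : List V) : List (V × V) := l.zip l.tail

theorem infix_of_mem_edgeList {l : List V} {e : V × V} (he : e ∈ edgeList l) :
    [e.1, e.2] <:+: l := by
  induction l with
  | nil => simp [edgeList] at he
  | cons a t ih =>
    cases t with
    | nil => simp [edgeList] at he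
    | cons b s =>
      simp only [edgeList, List.tail_cons, List.zip_cons_cons, List.mem_cons] at he
      rcases he with rfl | he
      · exact ⟨[], s, rfl⟩
      · exact (ih he).trans (List.suffix_cons a _).isInfix

theorem adj_of_mem_edgeList {G : Digraph V} {l : List V} (hl : l.IsChain G.Adj) {e : V × V}
    (he : e ∈ edgeList l) : G.Adj e.1 e.2 := by
  have := hl.infix (infix_of_mem_edgeList he)
  simpa using this

theorem nodup_edgeList {l : List V} (hl : l.Nodup) : (edgeList l).Nodup := by
  refine List.Nodup.of_map Prod.snd ?_
  rw [edgeList, List.map_snd_zip (by simp)]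
  exact hl.tail

theorem norm_sub_le_sum_edgeList {E : Type*} [SeminormedAddCommGroup E] (z : V → E) {u v : V}
    {l : List V} (hu : l.head? = some u) (hv : l.getLast? = some v) :
    ‖z u - z v‖ ≤ ((edgeList l).map fun e => ‖z e.1 - z e.2‖).sum := by
  induction l generalizing u with
  | nil => simp at hu
  | cons a t ih =>
    obtain rfl : a = u := by simpa using hu
    cases t with
    | nil =>
      obtain rfl : a = v := by simpa using hv
      simp [edgeList]
    | cons b s =>
      have h := ih (u := b) rfl (by simpa using hv)
      have h2 := norm_sub_le_norm_sub_add_norm_sub (z a) (z b) (z v)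
      simp only [edgeList, List.tail_cons, List.zip_cons_cons, List.map_cons,
        List.sum_cons] at h ⊢
      linarith

variable [Fintype V]

/-- The Poincaré-type inequality of a strongly connected graph: along a chosen shortest path the
Cauchy–Schwarz inequality costs a factor `D(G)`, and summing over all ordered pairs of nodes,
every edge is used at most `K(G)` times. -/
theorem sum_norm_sub_sq_le_sum_adj {E : Type*} [SeminormedAddCommGroup E] {G : Digraph V}
    [DecidableRel G.Adj] (hG : StronglyConnected G) (z : V → E) :
    ∑ u, ∑ v, ‖z u - z v‖ ^ 2
      ≤ diam G * maxEdgeUtility G *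
        ∑ j, ∑ i, if G.Adj j i then ‖z j - z i‖ ^ 2 else 0 := by
  classical
  obtain ⟨P, hP⟩ := exists_isCovering hG
  let q : V × V → ℝ := fun e => ‖z e.1 - z e.2‖ ^ 2
  let S : V × V → Finset (V × V) := fun r => (edgeList (P r.1 r.2)).toFinset
  let R : Finset (V × V) := Finset.univ.filter fun r => r.1 ≠ r.2
  have hpath : ∀ r ∈ R, q r ≤ diam G * ∑ e ∈ S r, q e := by
    intro r hr
    have hne : r.1 ≠ r.2 := by simpa [R] using hr
    have hs := hP _ _ hne
    have hnd := nodup_edgeList hs.nodup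
    have h1 := norm_sub_le_sum_edgeList z hs.1.2.1 hs.1.2.2
    rw [← List.sum_toFinset _ hnd] at h1
    have h2 : ((S r).card : ℝ) ≤ diam G := by
      rw [List.toFinset_card_of_nodup hnd]
      have := hs.length_le
      have h3 : (edgeList (P r.1 r.2)).length ≤ diam G := by
        simp only [edgeList, List.length_zip, List.length_tail]
        omega
      exact_mod_cast h3
    calc q r ≤ (∑ e ∈ S r, ‖z e.1 - z e.2‖) ^ 2 := pow_le_pow_left₀ (norm_nonneg _) h1 2
      _ ≤ (S r).card * ∑ e ∈ S r, q e := sq_sum_le_card_mul_sum_sq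
      _ ≤ diam G * ∑ e ∈ S r, q e :=
        mul_le_mul_of_nonneg_right h2 (Finset.sum_nonneg fun e _ => sq_nonneg _)
  have hcount : ∀ e, (if (∃ r ∈ R, e ∈ S r) then q e * (R.filter fun r => e ∈ S r).card else 0)
      ≤ maxEdgeUtility G * (if G.Adj e.1 e.2 then q e else 0) := by
    intro e
    split_ifs with h1 h2 h2
    · rw [mul_comm]
      refine mul_le_mul_of_nonneg_right ?_ (sq_nonneg _)
      have h3 : (R.filter fun r => e ∈ S r).card ≤ edgeUtility P e.1 e.2 := by
        rw [← Set.ncard_coe_finset]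
        refine Set.ncard_le_ncard (fun r hr => ?_) (Set.toFinite _)
        simp only [Finset.coe_filter, Set.mem_ofPred_eq, R, Finset.mem_filter, S,
          List.mem_toFinset] at hr
        exact ⟨hr.1.2, infix_of_mem_edgeList hr.2⟩
      exact_mod_cast h3.trans (edgeUtility_le hP h2)
    · obtain ⟨r, hr, her⟩ := h1
      exact absurd (adj_of_mem_edgeList (hP _ _ (by simpa [R] using hr)).1.1
        (by simpa [S] using her)) h2
    · positivity
    · simp
  have hsum : ∑ u, ∑ v, ‖z u - z v‖ ^ 2 = ∑ r ∈ R, q r := by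
    rw [← Fintype.sum_prod_type (f := q)]
    refine (Finset.sum_subset (Finset.subset_univ _) fun r _ hr => ?_).symm
    have : r.1 = r.2 := by simpa [R] using hr
    simp [q, this]
  have hswap : ∑ r ∈ R, ∑ e ∈ S r, q e = ∑ e, (if (∃ r ∈ R, e ∈ S r) then
      q e * (R.filter fun r => e ∈ S r).card else 0) := by
    have h1 : ∀ r ∈ R, ∑ e ∈ S r, q e = ∑ e, if e ∈ S r then q e else 0 := fun r _ => by
      rw [Finset.sum_ite_mem, Finset.univ_inter]
    rw [Finset.sum_congr rfl h1, Finset.sum_comm]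
    refine Finset.sum_congr rfl fun e _ => ?_
    rw [← Finset.sum_filter, Finset.sum_const, nsmul_eq_mul, mul_comm]
    split_ifs with h
    · rfl
    · have : (R.filter fun r => e ∈ S r) = ∅ :=
        Finset.filter_eq_empty_iff.2 fun r hr her => h ⟨r, hr, her⟩
      rw [this, Finset.card_empty, Nat.cast_zero, mul_zero]
  have hadj : ∑ e : V × V, (if G.Adj e.1 e.2 then q e else 0)
      = ∑ j, ∑ i, if G.Adj j i then ‖z j - z i‖ ^ 2 else 0 :=
    Fintype.sum_prod_type (f := fun e : V × V => if G.Adj e.1 e.2 then q e else 0)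
  rw [hsum, ← hadj, mul_assoc, Finset.mul_sum]
  refine (Finset.sum_le_sum hpath).trans ?_
  rw [← Finset.mul_sum, hswap]
  exact mul_le_mul_of_nonneg_left (Finset.sum_le_sum fun e _ => hcount e) (Nat.cast_nonneg _)

end Graph

/-! ### Contraction of the weighted variance -/

section Contraction

variable {ι : Type*} [Fintype ι] {E : Type*} [NormedAddCommGroup E] [InnerProductSpace ℝ E]

theorem sum_weight_norm_sub_sq {p : ι → ℝ} (hp : ∑ i, p i = 1) (z : ι → E) (u : E) :
    ∑ i, p i * ‖z i - u‖ ^ 2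
      = ∑ i, p i * ‖z i - ∑ j, p j • z j‖ ^ 2 + ‖(∑ j, p j • z j) - u‖ ^ 2 := by
  have key : ∀ w : E, ∑ i, p i * ‖z i - w‖ ^ 2
      = ∑ i, p i * ‖z i‖ ^ 2 - 2 * inner ℝ (∑ j, p j • z j) w + ‖w‖ ^ 2 := by
    intro w
    have : ∀ i, p i * ‖z i - w‖ ^ 2
        = p i * ‖z i‖ ^ 2 - 2 * inner ℝ (p i • z i) w + p i * ‖w‖ ^ 2 := by
      intro i
      rw [norm_sub_sq_real, real_inner_smul_left]
      ring
    rw [Finset.sum_congr rfl fun i _ => this i, Finset.sum_add_distrib, Finset.sum_sub_distrib,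
      ← Finset.mul_sum, ← sum_inner, ← Finset.sum_mul, hp, one_mul]
  rw [key, key, norm_sub_sq_real, real_inner_self_eq_norm_sq]
  ring

theorem sum_sum_weight_norm_sub_sq {p : ι → ℝ} (hp : ∑ i, p i = 1) (z : ι → E) :
    ∑ l, ∑ j, p l * p j * ‖z j - z l‖ ^ 2
      = 2 * ∑ i, p i * ‖z i - ∑ j, p j • z j‖ ^ 2 := by
  have h1 : ∀ l, ∑ j, p l * p j * ‖z j - z l‖ ^ 2
      = p l * ∑ i, p i * ‖z i - ∑ j, p j • z j‖ ^ 2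
        + p l * ‖z l - ∑ j, p j • z j‖ ^ 2 := by
    intro l
    simp only [mul_assoc]
    rw [← Finset.mul_sum, sum_weight_norm_sub_sq hp, norm_sub_rev (∑ j, p j • z j), mul_add]
  rw [Finset.sum_congr rfl fun l _ => h1 l, Finset.sum_add_distrib, ← Finset.sum_mul, hp]
  ring

/-- One mixing step with a row-stochastic matrix `R` contracts the weighted variance. The weights
`p = Rᵀ p'` before and `p'` after the step are adjoint under `R`, so that the loss is the sum over
`i` of `p' i` times the variance of `z` under the `i`-th row of `R`, of which only the pairs of an
in-neighbour `j` with `i` itself are kept. -/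
theorem sum_weight_norm_mulVec_sub_sq_le {G : Digraph ι} (hG : StronglyConnected G)
    {R : Matrix ι ι ℝ} (hR : ∀ i j, 0 ≤ R i j) (hRsum : ∀ i, ∑ j, R i j = 1)
    {p p' : ι → ℝ} (hp : ∀ i, 0 ≤ p i) (hpsum : ∑ i, p i = 1) (hp' : ∀ i, 0 ≤ p' i)
    (hpR : ∀ j, ∑ i, p' i * R i j = p j) {w q : ℝ} (hw : 0 ≤ w)
    (hedge : ∀ i j, G.Adj j i → w ≤ p' i * (R i i * R i j)) (hpq : ∀ i, p i ≤ q) (z : ι → E) :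
    ∑ i, p' i * ‖(∑ j, R i j • z j) - ∑ j, p j • z j‖ ^ 2
      ≤ (1 - w / (q ^ 2 * diam G * maxEdgeUtility G))
        * ∑ i, p i * ‖z i - ∑ j, p j • z j‖ ^ 2 := by
  classical
  set m : E := ∑ j, p j • z j with hm
  set S := ∑ i, p i * ‖z i - m‖ ^ 2 with hS
  have hS0 : 0 ≤ S := Finset.sum_nonneg fun i _ => mul_nonneg (hp i) (sq_nonneg _)
  set T := ∑ j, ∑ i, if G.Adj j i then ‖z j - z i‖ ^ 2 else 0 with hT
  have hT0 : 0 ≤ T := Finset.sum_nonneg fun j _ => Finset.sum_nonneg fun i _ => by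
    split_ifs <;> positivity
  have h1 : ∑ i, p' i * ‖(∑ j, R i j • z j) - m‖ ^ 2
      = S - ∑ i, p' i * ∑ j, R i j * ‖z j - ∑ l, R i l • z l‖ ^ 2 := by
    have h2 : S = ∑ i, p' i * ∑ j, R i j * ‖z j - m‖ ^ 2 := by
      simp only [hS, Finset.mul_sum, ← hpR, Finset.sum_mul]
      rw [Finset.sum_comm]
      simp only [mul_assoc]
    rw [h2, ← Finset.sum_sub_distrib]
    refine Finset.sum_congr rfl fun i _ => ?_
    rw [sum_weight_norm_sub_sq (hRsum i) z m]
    ring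
  have h2 : w / 2 * T ≤ ∑ i, p' i * ∑ j, R i j * ‖z j - ∑ l, R i l • z l‖ ^ 2 := by
    rw [hT, Finset.sum_comm, Finset.mul_sum]
    refine Finset.sum_le_sum fun i _ => ?_
    have h3 := sum_sum_weight_norm_sub_sq (hRsum i) z
    have h4 : ∑ j, R i i * R i j * ‖z j - z i‖ ^ 2
        ≤ ∑ l, ∑ j, R i l * R i j * ‖z j - z l‖ ^ 2 :=
      Finset.single_le_sum (f := fun l => ∑ j, R i l * R i j * ‖z j - z l‖ ^ 2)
        (fun l _ => Finset.sum_nonneg fun j _ =>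
          mul_nonneg (mul_nonneg (hR _ _) (hR _ _)) (sq_nonneg _)) (Finset.mem_univ i)
    have h5 : w * ∑ j, (if G.Adj j i then ‖z j - z i‖ ^ 2 else 0)
        ≤ p' i * ∑ j, R i i * R i j * ‖z j - z i‖ ^ 2 := by
      rw [Finset.mul_sum, Finset.mul_sum]
      refine Finset.sum_le_sum fun j _ => ?_
      split_ifs with hj
      · rw [← mul_assoc]
        exact mul_le_mul_of_nonneg_right (hedge i j hj) (sq_nonneg _)
      · rw [mul_zero]
        exact mul_nonneg (hp' i) (mul_nonneg (mul_nonneg (hR _ _) (hR _ _)) (sq_nonneg _))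
    have h6 := mul_le_mul_of_nonneg_left h4 (hp' i)
    rw [h3] at h6
    linarith
  have h3 : 2 * S ≤ q ^ 2 * (diam G * maxEdgeUtility G * T) := by
    rw [hS, ← sum_sum_weight_norm_sub_sq hpsum z]
    refine le_trans ?_ (mul_le_mul_of_nonneg_left (sum_norm_sub_sq_le_sum_adj hG z) (sq_nonneg q))
    rw [Finset.mul_sum]
    refine Finset.sum_le_sum fun l _ => ?_
    rw [Finset.mul_sum]
    refine Finset.sum_le_sum fun j _ => ?_
    rw [norm_sub_rev]
    refine mul_le_mul_of_nonneg_right ?_ (sq_nonneg _)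
    rw [sq]
    exact mul_le_mul (hpq _) (hpq _) (hp _) ((hp l).trans (hpq l))
  have h4 : w / (q ^ 2 * diam G * maxEdgeUtility G) * S ≤ w / 2 * T := by
    rcases eq_or_lt_of_le (show 0 ≤ q ^ 2 * diam G * maxEdgeUtility G by positivity) with h0 | h0
    · rw [← h0, div_zero, zero_mul]; positivity
    · rw [div_mul_eq_mul_div, div_le_iff₀ h0]
      have := mul_le_mul_of_nonneg_left h3 hw
      linarith
  rw [h1, sub_mul, one_mul]
  linarith

end Contraction

/-! ### One step of the algorithm, along a fixed sample path -/

section Norm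

variable {ι : Type*} [Fintype ι] {E : Type*} [SeminormedAddCommGroup E]

theorem norm_sum_sq_le (u : ι → E) : ‖∑ i, u i‖ ^ 2 ≤ Fintype.card ι * ∑ i, ‖u i‖ ^ 2 :=
  (pow_le_pow_left₀ (norm_nonneg _) (norm_sum_le _ _) 2).trans sq_sum_le_card_mul_sum_sq

theorem sum_norm_sq_le_weight {w : ι → ℝ} {Φ : ℝ} (hw : ∀ i, 1 ≤ Φ * w i) (u : ι → E) :
    ∑ i, ‖u i‖ ^ 2 ≤ Φ * ∑ i, w i * ‖u i‖ ^ 2 := by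
  rw [Finset.mul_sum]
  refine Finset.sum_le_sum fun i _ => ?_
  rw [← mul_assoc]
  exact le_mul_of_one_le_left (sq_nonneg _) (hw i)

theorem norm_sum_sub_sq_le {F : ι → E → E} {L : ℝ}
    (hF : ∀ i x y, ‖F i x - F i y‖ ≤ L * ‖x - y‖) {w : ι → ℝ} {Φ : ℝ} (hw : ∀ i, 1 ≤ Φ * w i)
    (x : ι → E) (u : E) :
    ‖∑ i, F i (x i) - ∑ i, F i u‖ ^ 2
      ≤ Fintype.card ι * L ^ 2 * Φ * ∑ i, w i * ‖x i - u‖ ^ 2 := by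
  rw [← Finset.sum_sub_distrib]
  have h1 : ∑ i, ‖F i (x i) - F i u‖ ^ 2 ≤ L ^ 2 * ∑ i, ‖x i - u‖ ^ 2 := by
    rw [Finset.mul_sum]
    refine Finset.sum_le_sum fun i _ => ?_
    rw [← mul_pow]
    exact pow_le_pow_left₀ (norm_nonneg _) (hF _ _ _) 2
  calc _ ≤ Fintype.card ι * ∑ i, ‖F i (x i) - F i u‖ ^ 2 := norm_sum_sq_le _
    _ ≤ Fintype.card ι * (L ^ 2 * (Φ * ∑ i, w i * ‖x i - u‖ ^ 2)) := by
      refine mul_le_mul_of_nonneg_left (h1.trans ?_) (Nat.cast_nonneg _)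
      exact mul_le_mul_of_nonneg_left (sum_norm_sq_le_weight hw _) (sq_nonneg _)
    _ = _ := by ring

end Norm

section Pathwise

variable {ι : Type*} [Fintype ι] {E : Type*} [NormedAddCommGroup E] [InnerProductSpace ℝ E]

theorem sum_sum_smul_of_colSum {B : Matrix ι ι ℝ} (hB : ∀ j, ∑ i, B i j = 1) (r : ι → E) :
    ∑ i, ∑ j, B i j • r j = ∑ j, r j := by
  rw [Finset.sum_comm]
  refine Finset.sum_congr rfl fun j _ => ?_
  rw [← Finset.sum_smul, hB, one_smul]

theorem norm_add_sq_le_of_pos {β : ℝ} (hβ : 0 < β) (u v : E) :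
    ‖u + v‖ ^ 2 ≤ (1 + β) * ‖u‖ ^ 2 + (1 + β⁻¹) * ‖v‖ ^ 2 := by
  have h1 := norm_add_sq_real u v
  have h2 := real_inner_le_norm u v
  have h3 : 0 ≤ β⁻¹ * (β * ‖u‖ - ‖v‖) ^ 2 := by positivity
  have h4 : β⁻¹ * (β * ‖u‖ - ‖v‖) ^ 2
      = β * ‖u‖ ^ 2 - 2 * (‖u‖ * ‖v‖) + β⁻¹ * ‖v‖ ^ 2 := by
    field_simp
    ring
  nlinarith

theorem norm_add_sq_le_two_mul (u v : E) : ‖u + v‖ ^ 2 ≤ 2 * ‖u‖ ^ 2 + 2 * ‖v‖ ^ 2 := by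
  have := norm_add_sq_le_of_pos one_pos u v
  norm_num at this
  exact this

/-- The directions are controlled by the tracking error and the total direction: the vectors
`(w i)⁻¹ • y i` have the weighted mean `∑ j, y j`. -/
theorem sum_norm_sq_le_trackErr {w : ι → ℝ} (hw : ∀ i, 0 < w i) (hsum : ∑ i, w i = 1) (y : ι → E) :
    ∑ i, ‖y i‖ ^ 2 ≤ ∑ i, w i * ‖(w i)⁻¹ • y i - ∑ j, y j‖ ^ 2 + ‖∑ j, y j‖ ^ 2 := by
  have h := sum_weight_norm_sub_sq hsum (fun i => (w i)⁻¹ • y i) 0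
  have hm : ∑ i, w i • (w i)⁻¹ • y i = ∑ i, y i :=
    Finset.sum_congr rfl fun i _ => smul_inv_smul₀ (hw i).ne' _
  simp only [hm, sub_zero] at h
  rw [← h]
  refine Finset.sum_le_sum fun i _ => ?_
  have h1 : w i ≤ 1 := hsum ▸ Finset.single_le_sum (fun j _ => (hw j).le) (Finset.mem_univ i)
  rw [norm_smul, mul_pow, Real.norm_eq_abs, sq_abs, ← mul_assoc]
  have h2 : w i * (w i)⁻¹ ^ 2 = (w i)⁻¹ := by have := (hw i).ne'; field_simp
  rw [h2]
  exact le_mul_of_one_le_left (sq_nonneg _) ((one_le_inv₀ (hw i)).2 h1)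

theorem norm_sum_smul_sub_sq_le {w p : ι → ℝ} (hw : ∀ i, 0 < w i) (hp : ∀ i, 0 ≤ p i)
    (hp1 : ∀ i, p i ≤ 1) (y : ι → E) (u : E) :
    ‖∑ i, p i • (y i - w i • u)‖ ^ 2
      ≤ (∑ i, p i * w i) * ∑ i, w i * ‖(w i)⁻¹ • y i - u‖ ^ 2 := by
  have h1 : ∀ i, ‖p i • (y i - w i • u)‖ = p i * w i * ‖(w i)⁻¹ • y i - u‖ := by
    intro i
    have h2 : y i - w i • u = w i • ((w i)⁻¹ • y i - u) := by
      rw [smul_sub, smul_inv_smul₀ (hw i).ne']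
    rw [h2, norm_smul, norm_smul, Real.norm_of_nonneg (hp i), Real.norm_of_nonneg (hw i).le,
      mul_assoc]
  have hpw : ∀ i, 0 ≤ p i * w i := fun i => mul_nonneg (hp i) (hw i).le
  calc ‖∑ i, p i • (y i - w i • u)‖ ^ 2
      ≤ (∑ i, p i * w i * ‖(w i)⁻¹ • y i - u‖) ^ 2 := by
        refine pow_le_pow_left₀ (norm_nonneg _) ((norm_sum_le _ _).trans_eq ?_) 2
        exact Finset.sum_congr rfl fun i _ => h1 i
    _ ≤ (∑ i, p i * w i) * ∑ i, p i * w i * ‖(w i)⁻¹ • y i - u‖ ^ 2 :=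
        Finset.sum_sq_le_sum_mul_sum_of_sq_le_mul _ (fun i _ => hpw i)
          (fun i _ => mul_nonneg (hpw i) (sq_nonneg _)) (fun i _ => (by ring : _ = _).le)
    _ ≤ _ := by
        refine mul_le_mul_of_nonneg_left (Finset.sum_le_sum fun i _ => ?_)
          (Finset.sum_nonneg fun i _ => hpw i)
        refine mul_le_mul_of_nonneg_right ?_ (sq_nonneg _)
        exact mul_le_of_le_one_left (hw i).le (hp1 i)

/-- The optimality gap after a step of length `s = α θ` along the total direction `F + N`, where
`F` approximates the gradient `u` of `n f` at the weighted average, `N` is noise and `d` measures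
the deviation of the single directions from their mean. The last term has mean zero; the product of
`d` and `N`, which are correlated, costs the factor `3 / 2` on the noise. -/
theorem norm_sub_smul_sq_le {e u F N d : E} {n L mu α θ D S Φ : ℝ} (hn : 0 < n) (hmu : 0 < mu)
    (hmuL : mu ≤ L) (hα : 0 < α) (hθ : 0 < θ) (hθ1 : θ ≤ 1) (hαL : 20 * (α * n * L ^ 2) ≤ mu)
    (hD : 0 ≤ D) (hS : 0 ≤ S) (hΦ : 0 ≤ Φ)
    (hu : ‖u‖ ≤ n * L * ‖e‖) (hmono : n * mu * ‖e‖ ^ 2 ≤ inner ℝ u e)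
    (huF : ‖F - u‖ ^ 2 ≤ n * L ^ 2 * Φ * D) (hd : ‖d‖ ^ 2 ≤ θ * S) :
    ‖e - α • (d + θ • (F + N))‖ ^ 2
      ≤ (1 - θ * (n * mu / 2 * α)) * ‖e‖ ^ 2 + θ * (3 * L ^ 2 * Φ / mu * α) * D
        + 3 / (n * mu) * α * S + 3 / 2 * (α * θ) ^ 2 * ‖N‖ ^ 2
        - 2 * (α * θ) * inner ℝ (e - (α * θ) • F) N := by
  set s := α * θ with hs
  have hs0 : 0 < s := mul_pos hα hθ
  have hL0 : 0 ≤ L := hmu.le.trans hmuL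
  have hsα : s ≤ α := mul_le_of_le_one_right hα.le hθ1
  have hsL : 20 * (s * n * L ^ 2) ≤ mu := by
    refine le_trans ?_ hαL
    gcongr
  have hsmu : 20 * (s * n * mu) ≤ 1 := by
    have h1 : s * n * (mu * mu) ≤ s * n * L ^ 2 := by
      rw [sq]; gcongr
    have h2 : 20 * (s * n * mu) * mu ≤ 1 * mu := by linarith
    exact le_of_mul_le_mul_right h2 hmu
  have ha : ‖e - s • u‖ ^ 2 ≤ (1 - 3 / 2 * (s * n * mu)) * ‖e‖ ^ 2 := by
    have h1 : ‖u‖ ^ 2 ≤ (n * L * ‖e‖) ^ 2 := pow_le_pow_left₀ (norm_nonneg _) hu 2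
    have h2 : s ^ 2 * ‖u‖ ^ 2 ≤ s ^ 2 * (n * L * ‖e‖) ^ 2 := by gcongr
    have h3 : s ^ 2 * (n * L * ‖e‖) ^ 2 ≤ 1 / 20 * (s * n * mu) * ‖e‖ ^ 2 := by
      have h4 : s * n * (20 * (s * n * L ^ 2)) ≤ s * n * mu := by gcongr
      have h5 := mul_le_mul_of_nonneg_right h4 (sq_nonneg ‖e‖)
      linarith
    have h6 := mul_le_mul_of_nonneg_left hmono hs0.le
    have h7 : 0 ≤ s * n * mu * ‖e‖ ^ 2 := by positivity
    rw [norm_sub_sq_real, real_inner_smul_right, norm_smul, Real.norm_of_nonneg hs0.le, mul_pow,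
      real_inner_comm]
    linarith
  have hb : ‖s • (u - F) - α • d‖ ^ 2
      ≤ 2 * (s ^ 2 * (n * L ^ 2 * Φ * D)) + 2 * (α ^ 2 * ‖d‖ ^ 2) := by
    have h1 := norm_add_sq_le_two_mul (s • (u - F)) (-(α • d))
    rw [← sub_eq_add_neg, norm_neg, norm_smul, norm_smul, Real.norm_of_nonneg hs0.le,
      Real.norm_of_nonneg hα.le, mul_pow, mul_pow, norm_sub_rev u F] at h1
    have h2 : s ^ 2 * ‖F - u‖ ^ 2 ≤ s ^ 2 * (n * L ^ 2 * Φ * D) := by gcongr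
    linarith
  obtain ⟨t, ht⟩ : ∃ t, t = s * n * mu := ⟨_, rfl⟩
  have ht0 : 0 < t := by rw [ht]; positivity
  have hab : ‖e - s • F - α • d‖ ^ 2
      ≤ (1 - 1 / 2 * t) * ‖e‖ ^ 2
        + (1 + t⁻¹) * (2 * (s ^ 2 * (n * L ^ 2 * Φ * D)) + 2 * (α ^ 2 * ‖d‖ ^ 2)) := by
    have h1 := norm_add_sq_le_of_pos ht0 (e - s • u) (s • (u - F) - α • d)
    have h2 : e - s • u + (s • (u - F) - α • d) = e - s • F - α • d := by
      rw [smul_sub]; abel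
    rw [h2] at h1
    have h3 : (1 + t) * ‖e - s • u‖ ^ 2 ≤ (1 - 1 / 2 * t) * ‖e‖ ^ 2 := by
      rw [← ht] at ha
      have h4 := mul_le_mul_of_nonneg_left ha (by positivity : 0 ≤ 1 + t)
      have h5 : 0 ≤ t ^ 2 * ‖e‖ ^ 2 := by positivity
      linarith
    have h6 := mul_le_mul_of_nonneg_left hb (by positivity : 0 ≤ 1 + t⁻¹)
    linarith
  have hsplit : e - α • (d + θ • (F + N)) = (e - s • F - α • d) + -(s • N) := by
    rw [hs]; module
  have hcross : -2 * inner ℝ (α • d) (-(s • N))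
      ≤ 2 * (α ^ 2 * ‖d‖ ^ 2) + 1 / 2 * (s ^ 2 * ‖N‖ ^ 2) := by
    have h1 := abs_real_inner_le_norm (α • d) (-(s • N))
    rw [norm_neg, norm_smul, norm_smul, Real.norm_of_nonneg hs0.le, Real.norm_of_nonneg hα.le] at h1
    have h2 := neg_abs_le (inner ℝ (α • d) (-(s • N)))
    nlinarith [sq_nonneg (2 * (α * ‖d‖) - s * ‖N‖)]
  have hexp := norm_add_sq_real (e - s • F - α • d) (-(s • N))
  rw [norm_neg, norm_smul, Real.norm_of_nonneg hs0.le, mul_pow,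
    inner_sub_left (e - s • F) (α • d), inner_neg_right (e - s • F), real_inner_smul_right] at hexp
  have hDterm : (1 + t⁻¹) * (2 * (s ^ 2 * (n * L ^ 2 * Φ * D)))
      ≤ θ * (3 * L ^ 2 * Φ / mu * α) * D := by
    have h1 : (1 + t⁻¹) * (2 * (s ^ 2 * (n * L ^ 2 * Φ * D)))
        = (2 + 2 * t) * (s * L ^ 2 * Φ / mu * D) := by
      rw [ht]; field_simp; ring
    have h2 : θ * (3 * L ^ 2 * Φ / mu * α) * D = 3 * (s * L ^ 2 * Φ / mu * D) := by
      rw [hs]; ring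
    rw [h1, h2]
    gcongr
    linarith
  have hSterm : (1 + t⁻¹) * (2 * (α ^ 2 * ‖d‖ ^ 2)) + 2 * (α ^ 2 * ‖d‖ ^ 2)
      ≤ 3 / (n * mu) * α * S := by
    have h1 : (1 + t⁻¹) * (2 * (α ^ 2 * ‖d‖ ^ 2)) + 2 * (α ^ 2 * ‖d‖ ^ 2)
        ≤ (1 + t⁻¹) * (2 * (α ^ 2 * (θ * S))) + 2 * (α ^ 2 * (θ * S)) := by gcongr
    refine h1.trans ?_
    have h2 : (1 + t⁻¹) * (2 * (α ^ 2 * (θ * S))) + 2 * (α ^ 2 * (θ * S))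
        = (2 + 4 * t) * (1 / (n * mu) * α * S) := by
      rw [ht, hs]; field_simp; ring
    have h3 : 3 / (n * mu) * α * S = 3 * (1 / (n * mu) * α * S) := by ring
    rw [h2, h3]
    gcongr
    linarith
  rw [hsplit, hexp]
  rw [ht] at hab
  have h9 : θ * (n * mu / 2 * α) = 1 / 2 * (s * n * mu) := by rw [hs]; ring
  rw [h9]
  rw [← ht] at hab ⊢
  linarith

/-- The consensus error after a step from the mixed points `x i`. -/
theorem sum_weight_norm_sub_smul_sq_le {c α D : ℝ} (hc : 0 < c) (hc1 : c < 1) {w : ι → ℝ}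
    (hw : ∀ i, 0 ≤ w i) (hsum : ∑ i, w i = 1) (x y : ι → E) (u : E)
    (hD : ∑ i, w i * ‖x i - u‖ ^ 2 ≤ c ^ 2 * D) :
    ∑ i, w i * ‖x i - α • y i - (u - α • ∑ j, w j • y j)‖ ^ 2
      ≤ (1 + c ^ 2) / 2 * D + (1 + c ^ 2) / (1 - c ^ 2) * α ^ 2 * ∑ i, ‖y i‖ ^ 2 := by
  have hc2 : 0 < 1 - c ^ 2 := by nlinarith
  set ym := ∑ j, w j • y j with hy
  set β := (1 - c ^ 2) / (2 * c ^ 2) with hβ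
  have hβ0 : 0 < β := by positivity
  have hw1 : ∀ i, w i ≤ 1 := fun i =>
    hsum ▸ Finset.single_le_sum (fun j _ => hw j) (Finset.mem_univ i)
  have hy1 : ∑ i, w i * ‖y i - ym‖ ^ 2 ≤ ∑ i, ‖y i‖ ^ 2 := by
    have h := sum_weight_norm_sub_sq hsum y 0
    simp only [sub_zero] at h
    have h2 : ∑ i, w i * ‖y i‖ ^ 2 ≤ ∑ i, ‖y i‖ ^ 2 :=
      Finset.sum_le_sum fun i _ => mul_le_of_le_one_left (sq_nonneg _) (hw1 i)
    linarith [sq_nonneg ‖ym‖]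
  have h1 : ∀ i, w i * ‖x i - α • y i - (u - α • ym)‖ ^ 2
      ≤ (1 + β) * (w i * ‖x i - u‖ ^ 2) + (1 + β⁻¹) * α ^ 2 * (w i * ‖y i - ym‖ ^ 2) := by
    intro i
    have h2 := norm_add_sq_le_of_pos hβ0 (x i - u) (-(α • (y i - ym)))
    have h3 : x i - u + -(α • (y i - ym)) = x i - α • y i - (u - α • ym) := by
      rw [smul_sub]; abel
    rw [h3, norm_neg, norm_smul, mul_pow, Real.norm_eq_abs, sq_abs] at h2
    have h4 := mul_le_mul_of_nonneg_left h2 (hw i)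
    linarith
  have h2 := Finset.sum_le_sum fun i (_ : i ∈ Finset.univ) => h1 i
  rw [Finset.sum_add_distrib, ← Finset.mul_sum, ← Finset.mul_sum] at h2
  have h3 : (1 + β) * (c ^ 2 * D) = (1 + c ^ 2) / 2 * D := by
    rw [hβ]; field_simp; ring
  have h4 : 1 + β⁻¹ = (1 + c ^ 2) / (1 - c ^ 2) := by
    rw [hβ, inv_div]; field_simp; ring
  have h5 := mul_le_mul_of_nonneg_left hD (by positivity : 0 ≤ 1 + β)
  have h6 := mul_le_mul_of_nonneg_left hy1 (by positivity : 0 ≤ (1 + β⁻¹) * α ^ 2)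
  rw [h3] at h5
  rw [h4] at h6 h2
  linarith

/-- The tracking error after the step `y' = r + Δ`, where `r` is the mixed direction. As the
weighted sum of the deviations `W` vanishes, the mean of `Δ` drops out of the mixed term. -/
theorem sum_weight_norm_add_sq_le {q : ι → ℝ} (hq : ∀ i, 0 < q i) (hsum : ∑ i, q i = 1) {ψ : ℝ}
    (hψ : ∀ i, (q i)⁻¹ ≤ ψ) (r Δ : ι → E) :
    ∑ i, q i * ‖(q i)⁻¹ • (r i + Δ i) - ∑ j, (r j + Δ j)‖ ^ 2
      ≤ ∑ i, q i * ‖(q i)⁻¹ • r i - ∑ j, r j‖ ^ 2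
        + 2 * ∑ i, inner ℝ ((q i)⁻¹ • r i - ∑ j, r j) (Δ i) + ψ * ∑ i, ‖Δ i‖ ^ 2 := by
  set W : ι → E := fun i => (q i)⁻¹ • r i - ∑ j, r j with hW
  set U : ι → E := fun i => (q i)⁻¹ • Δ i - ∑ j, Δ j with hU
  have hsumW : ∑ i, q i • W i = 0 := by
    simp only [hW, smul_sub, Finset.sum_sub_distrib, ← Finset.sum_smul, hsum, one_smul]
    rw [Finset.sum_congr rfl fun i _ => smul_inv_smul₀ (hq i).ne' (r i), sub_self]
  have h1 : ∀ i, q i * ‖(q i)⁻¹ • (r i + Δ i) - ∑ j, (r j + Δ j)‖ ^ 2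
      = q i * ‖W i‖ ^ 2 + 2 * inner ℝ (W i) (Δ i) - 2 * inner ℝ (q i • W i) (∑ j, Δ j)
        + q i * ‖U i‖ ^ 2 := by
    intro i
    have h2 : (q i)⁻¹ • (r i + Δ i) - ∑ j, (r j + Δ j) = W i + U i := by
      rw [Finset.sum_add_distrib, smul_add]; simp only [hW, hU]; abel
    have h3 : inner ℝ (W i) (U i)
        = (q i)⁻¹ * inner ℝ (W i) (Δ i) - inner ℝ (W i) (∑ j, Δ j) := by
      simp only [hU, inner_sub_right, real_inner_smul_right]
    rw [h2, norm_add_sq_real, h3, real_inner_smul_left]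
    have := (hq i).ne'
    field_simp
    ring
  have h4 : ∑ i, q i * ‖U i‖ ^ 2 ≤ ψ * ∑ i, ‖Δ i‖ ^ 2 := by
    have h5 := sum_weight_norm_sub_sq hsum (fun i => (q i)⁻¹ • Δ i) 0
    have hm : ∑ i, q i • (q i)⁻¹ • Δ i = ∑ i, Δ i :=
      Finset.sum_congr rfl fun i _ => smul_inv_smul₀ (hq i).ne' _
    simp only [hm, sub_zero] at h5
    have h6 : ∑ i, q i * ‖(q i)⁻¹ • Δ i‖ ^ 2 ≤ ψ * ∑ i, ‖Δ i‖ ^ 2 := by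
      rw [Finset.mul_sum]
      refine Finset.sum_le_sum fun i _ => ?_
      rw [norm_smul, mul_pow, Real.norm_eq_abs, sq_abs, ← mul_assoc]
      have h2 : q i * (q i)⁻¹ ^ 2 = (q i)⁻¹ := by have := (hq i).ne'; field_simp
      rw [h2]
      exact mul_le_mul_of_nonneg_right (hψ i) (sq_nonneg _)
    linarith [sq_nonneg ‖∑ i, Δ i‖]
  rw [Finset.sum_congr rfl fun i _ => h1 i, Finset.sum_add_distrib, Finset.sum_sub_distrib,
    Finset.sum_add_distrib, ← Finset.mul_sum, ← Finset.mul_sum, ← sum_inner, hsumW, inner_zero_left]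
  linarith

/-- The tracking error after a step whose increment `h i + n' i - n i` consists of a gradient
difference `h i`, fresh noise `n' i` and old noise `n i`. -/
theorem sum_weight_norm_add_noise_sq_le {τ K ψ S : ℝ} (hτ : 0 < τ) (hτ1 : τ < 1) {q : ι → ℝ}
    (hq : ∀ i, 0 < q i) (hsum : ∑ i, q i = 1) (hψ : ∀ i, (q i)⁻¹ ≤ ψ) (hK : ∀ i, (q i)⁻¹ ≤ K)
    (r h n n' : ι → E)
    (hr : ∑ i, q i * ‖(q i)⁻¹ • r i - ∑ j, r j‖ ^ 2 ≤ τ ^ 2 * S) :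
    ∑ i, q i * ‖(q i)⁻¹ • (r i + (n' i + h i - n i)) - ∑ j, (r j + (n' j + h j - n j))‖ ^ 2
      ≤ (1 + τ ^ 2) / 2 * S + (2 * K * τ ^ 2 / (1 - τ ^ 2) + ψ) * ∑ i, ‖h i‖ ^ 2
        + ψ * ∑ i, ‖n' i‖ ^ 2 + ψ * ∑ i, ‖n i‖ ^ 2 + ψ * ∑ i, (-2 * inner ℝ (h i) (n i))
        + ∑ i, 2 * inner ℝ ((q i)⁻¹ • r i - ∑ j, r j + ψ • (h i - n i)) (n' i)
        + ∑ i, -2 * inner ℝ ((q i)⁻¹ • r i - ∑ j, r j) (n i) := by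
  have hτ2 : 0 < 1 - τ ^ 2 := by nlinarith
  refine (sum_weight_norm_add_sq_le hq hsum hψ r fun i => n' i + h i - n i).trans ?_
  set W : ι → E := fun i => (q i)⁻¹ • r i - ∑ j, r j with hW
  set β := (1 - τ ^ 2) / (2 * τ ^ 2) with hβ
  have hβ0 : 0 < β := by positivity
  have hWh : 2 * ∑ i, inner ℝ (W i) (h i)
      ≤ β * ∑ i, q i * ‖W i‖ ^ 2 + 2 * K * τ ^ 2 / (1 - τ ^ 2) * ∑ i, ‖h i‖ ^ 2 := by
    have h0 : 2 * K * τ ^ 2 / (1 - τ ^ 2) = β⁻¹ * K := by rw [hβ, inv_div]; ring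
    rw [h0, Finset.mul_sum, Finset.mul_sum, Finset.mul_sum, ← Finset.sum_add_distrib]
    refine Finset.sum_le_sum fun i _ => ?_
    have h1 := real_inner_le_norm (W i) (h i)
    have h2 : 0 ≤ β * q i * (‖W i‖ - β⁻¹ * (q i)⁻¹ * ‖h i‖) ^ 2 := by
      have := (hq i).le; positivity
    have h3 : β * q i * (‖W i‖ - β⁻¹ * (q i)⁻¹ * ‖h i‖) ^ 2
        = β * (q i * ‖W i‖ ^ 2) - 2 * (‖W i‖ * ‖h i‖) + β⁻¹ * (q i)⁻¹ * ‖h i‖ ^ 2 := by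
      have := (hq i).ne'
      field_simp
      ring
    have h4 : β⁻¹ * (q i)⁻¹ * ‖h i‖ ^ 2 ≤ β⁻¹ * K * ‖h i‖ ^ 2 := by
      have := hK i
      gcongr
    linarith
  have hexp : ∀ i, ‖n' i + h i - n i‖ ^ 2
      = ‖n' i‖ ^ 2 + ‖h i‖ ^ 2 + ‖n i‖ ^ 2 + -2 * inner ℝ (h i) (n i)
        + 2 * inner ℝ (h i - n i) (n' i) := by
    intro i
    rw [add_sub_assoc, norm_add_sq_real, norm_sub_sq_real, real_inner_comm]
    ring
  have hin : ∀ i, inner ℝ (W i) (n' i + h i - n i)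
      = inner ℝ (W i) (n' i) + inner ℝ (W i) (h i) - inner ℝ (W i) (n i) := by
    intro i
    rw [inner_sub_right, inner_add_right]
  have hin' : ∀ i, 2 * inner ℝ (W i + ψ • (h i - n i)) (n' i)
      = 2 * inner ℝ (W i) (n' i) + ψ * (2 * inner ℝ (h i - n i) (n' i)) := by
    intro i
    rw [inner_add_left, real_inner_smul_left]
    ring
  have h5 : (1 + β) * (τ ^ 2 * S) = (1 + τ ^ 2) / 2 * S := by
    rw [hβ]; field_simp; ring
  have h6 := mul_le_mul_of_nonneg_left hr (by positivity : 0 ≤ 1 + β)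
  rw [h5] at h6
  rw [Finset.sum_congr rfl fun i _ => hexp i, Finset.sum_congr rfl fun i _ => hin i,
    Finset.sum_congr rfl fun i _ => hin' i]
  simp only [Finset.sum_add_distrib, Finset.sum_sub_distrib, ← Finset.mul_sum] at hWh ⊢
  linarith

theorem neg_two_mul_inner_le {F : E → E} {L α : ℝ} (hα : 0 ≤ α)
    (hF : ∀ x y, ‖F x - F y‖ ≤ L * ‖x - y‖) (x u n : E) :
    -2 * inner ℝ (F (u - α • n) - F x) n
      ≤ -2 * inner ℝ (F u - F x) n + 2 * (L * α) * ‖n‖ ^ 2 := by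
  have h1 : F (u - α • n) - F x = (F u - F x) + (F (u - α • n) - F u) := by abel
  have h2 := abs_real_inner_le_norm (F (u - α • n) - F u) n
  have h3 := hF (u - α • n) u
  rw [sub_sub_cancel_left, norm_neg, norm_smul, Real.norm_of_nonneg hα] at h3
  have h4 := neg_abs_le (inner ℝ (F (u - α • n) - F u) n)
  have h5 := mul_le_mul_of_nonneg_right h3 (norm_nonneg n)
  rw [h1, inner_add_left]
  linarith

theorem neg_two_mul_inner_le_add_smul {s : ℝ} (hs : 0 ≤ s) (u n : E) :
    -2 * inner ℝ u n ≤ -2 * inner ℝ (u - (s - 1) • n) n + 2 * ‖n‖ ^ 2 := by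
  rw [inner_sub_left, real_inner_smul_left, real_inner_self_eq_norm_sq]
  have := mul_nonneg hs (sq_nonneg ‖n‖)
  linarith

/-- The displacement of the decisions in one step. -/
theorem sum_norm_step_sq_le {c α Φ D : ℝ} (hc : c ^ 2 ≤ 1) (hD : 0 ≤ D) (hΦ : 0 ≤ Φ) {w w' : ι → ℝ}
    (hw : ∀ i, 1 ≤ Φ * w i) (hw' : ∀ i, 1 ≤ Φ * w' i) (x x' y : ι → E) (u : E)
    (hx : ∑ i, w i * ‖x i - u‖ ^ 2 = D) (hx' : ∑ i, w' i * ‖x' i - u‖ ^ 2 ≤ c ^ 2 * D) :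
    ∑ i, ‖x' i - α • y i - x i‖ ^ 2 ≤ 8 * Φ * D + 2 * α ^ 2 * ∑ i, ‖y i‖ ^ 2 := by
  have h1 : ∀ i, ‖x' i - α • y i - x i‖ ^ 2
      ≤ 4 * ‖x' i - u‖ ^ 2 + 4 * ‖x i - u‖ ^ 2 + 2 * α ^ 2 * ‖y i‖ ^ 2 := by
    intro i
    have h2 := norm_add_sq_le_two_mul (x' i - x i) (-(α • y i))
    have h3 := norm_add_sq_le_two_mul (x' i - u) (-(x i - u))
    have h4 : x' i - x i + -(α • y i) = x' i - α • y i - x i := by abel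
    have h5 : x' i - u + -(x i - u) = x' i - x i := by abel
    rw [h4, norm_neg, norm_smul, mul_pow, Real.norm_eq_abs, sq_abs] at h2
    rw [h5, norm_neg] at h3
    linarith
  have h2 := Finset.sum_le_sum fun i (_ : i ∈ Finset.univ) => h1 i
  rw [Finset.sum_add_distrib, Finset.sum_add_distrib, ← Finset.mul_sum, ← Finset.mul_sum,
    ← Finset.mul_sum] at h2
  have h3 := sum_norm_sq_le_weight hw fun i => x i - u
  have h4 := sum_norm_sq_le_weight hw' fun i => x' i - u
  have h5 : c ^ 2 * D ≤ D := mul_le_of_le_one_left hD hc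
  have h6 := mul_le_mul_of_nonneg_left (hx'.trans h5) hΦ
  rw [hx] at h3
  linarith

end Pathwise

/-! ### Gradients of the costs -/

section Gradient

variable {n p : ℕ} {f : Fin n → EuclideanSpace ℝ (Fin p) → ℝ} {L : ℝ}

theorem smul_gradient_avgCost (hn : 0 < n) (hf : SmoothCosts f L) (x : EuclideanSpace ℝ (Fin p)) :
    (n : ℝ) • gradient (avgCost f) x = ∑ i, gradient (f i) x := by
  have h : HasFDerivAt (avgCost f) ((1 / (n : ℝ)) • ∑ i, fderiv ℝ (f i) x) x :=
    (HasFDerivAt.fun_sum fun i _ =>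
      (((hf i).1.differentiable one_ne_zero) x).hasFDerivAt).const_mul (1 / (n : ℝ))
  have hn' : (n : ℝ) ≠ 0 := Nat.cast_ne_zero.2 hn.ne'
  rw [gradient, h.fderiv, ← map_smul, smul_smul, mul_one_div_cancel hn', one_smul, map_sum]
  rfl

theorem sum_gradient_eq_zero (hn : 0 < n) (hf : SmoothCosts f L) {xstar : EuclideanSpace ℝ (Fin p)}
    (hx : ∀ x, avgCost f xstar ≤ avgCost f x) : ∑ i, gradient (f i) xstar = 0 := by
  have h : IsLocalMin (avgCost f) xstar := Filter.Eventually.of_forall hx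
  rw [← smul_gradient_avgCost hn hf, gradient, h.fderiv_eq_zero, map_zero, smul_zero]

theorem StronglyConvexAvg.mul_norm_sq_le {mu : ℝ} (hconv : StronglyConvexAvg f mu) (hn : 0 < n)
    (hf : SmoothCosts f L) (x y : EuclideanSpace ℝ (Fin p)) :
    n * mu * ‖x - y‖ ^ 2
      ≤ inner ℝ (∑ i, gradient (f i) x - ∑ i, gradient (f i) y) (x - y) := by
  rw [← smul_gradient_avgCost hn hf, ← smul_gradient_avgCost hn hf, ← smul_sub,
    real_inner_smul_left, mul_assoc]
  exact mul_le_mul_of_nonneg_left (hconv x y) (Nat.cast_nonneg n)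

theorem norm_sum_gradient_sub_le (hf : SmoothCosts f L) (x y : EuclideanSpace ℝ (Fin p)) :
    ‖∑ i, gradient (f i) x - ∑ i, gradient (f i) y‖ ≤ n * L * ‖x - y‖ := by
  rw [← Finset.sum_sub_distrib]
  refine (norm_sum_le _ _).trans ((Finset.sum_le_sum fun i _ => (hf i).2 x y).trans_eq ?_)
  rw [Finset.sum_const, Finset.card_univ, Fintype.card_fin, nsmul_eq_mul, mul_assoc]

theorem mu_le_L {mu : ℝ} (hp : 1 ≤ p) (hn : 0 < n) (hf : SmoothCosts f L)
    (hconv : StronglyConvexAvg f mu) : mu ≤ L := by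
  have hn' : (0 : ℝ) < n := Nat.cast_pos.2 hn
  set e : EuclideanSpace ℝ (Fin p) := EuclideanSpace.single ⟨0, hp⟩ (1 : ℝ) with he
  have he1 : ‖e - 0‖ = 1 := by simp [he]
  have h1 := hconv.mul_norm_sq_le hn hf e 0
  have h2 := real_inner_le_norm (∑ i, gradient (f i) e - ∑ i, gradient (f i) 0) (e - 0)
  have h3 := norm_sum_gradient_sub_le hf e 0
  rw [he1] at h1 h2 h3
  have h4 : n * mu ≤ n * L := by linarith
  exact le_of_mul_le_mul_left h4 hn'

end Gradient

/-! ### Integration against independent samples -/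

section Independence

variable {Ω : Type*} [MeasurableSpace Ω] {P : Measure Ω}

theorem integrable_inner_of_memLp {E : Type*} [NormedAddCommGroup E] [InnerProductSpace ℝ E]
    {u v : Ω → E} (hu : MemLp u 2 P) (hv : MemLp v 2 P) :
    Integrable (fun ω => inner ℝ (u ω) (v ω)) P := by
  have h1 := hu.integrable_norm_pow two_ne_zero
  have h2 := hv.integrable_norm_pow two_ne_zero
  refine (h1.add h2).mono' (hu.1.inner hv.1) (Filter.Eventually.of_forall fun ω => ?_)
  have h3 := abs_real_inner_le_norm (u ω) (v ω)
  rw [Real.norm_eq_abs, Pi.add_apply]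
  nlinarith [sq_nonneg (‖u ω‖ - ‖v ω‖), sq_nonneg (‖u ω‖), sq_nonneg (‖v ω‖)]

theorem memLp_comp_of_lipschitz {E F : Type*} [NormedAddCommGroup E] [NormedAddCommGroup F]
    [IsFiniteMeasure P] {T : E → F} {L : ℝ} (hT : ∀ x y, ‖T x - T y‖ ≤ L * ‖x - y‖) {u : Ω → E}
    (hu : MemLp u 2 P) : MemLp (fun ω => T (u ω)) 2 P := by
  have hlip : LipschitzWith L.toNNReal T := LipschitzWith.of_dist_le' fun x y => by
    rw [dist_eq_norm, dist_eq_norm]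
    exact hT x y
  have h1 : MemLp ((fun x => T x - T 0) ∘ u) 2 P :=
    LipschitzWith.comp_memLp (K := L.toNNReal)
      (LipschitzWith.of_dist_le_mul fun x y => by
        rw [dist_sub_right]; exact hlip.dist_le_mul x y) (sub_self _) hu
  have h2 := h1.add (memLp_const (T 0))
  refine h2.ae_eq (Filter.Eventually.of_forall fun ω => ?_)
  simp

variable [IsProbabilityMeasure P] {𝒳 S : Type*} [MeasurableSpace 𝒳] [MeasurableSpace S]
  {E : Type*} [NormedAddCommGroup E] [MeasurableSpace E] [BorelSpace E]
  [SecondCountableTopology E]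

theorem lintegral_comp_le_of_indepFun {X : Ω → 𝒳} {ζ : Ω → S} (hX : Measurable X)
    (hζ : Measurable ζ) (hind : IndepFun X ζ P) {T : 𝒳 × S → ENNReal} (hT : Measurable T)
    {C : ENNReal} (hC : ∀ x, ∫⁻ ω, T (x, ζ ω) ∂P ≤ C) : ∫⁻ ω, T (X ω, ζ ω) ∂P ≤ C := by
  have h1 := (indepFun_iff_map_prod_eq_prod_map_map hX.aemeasurable hζ.aemeasurable).1 hind
  have : IsProbabilityMeasure (P.map X) := Measure.isProbabilityMeasure_map hX.aemeasurable
  have : IsProbabilityMeasure (P.map ζ) := Measure.isProbabilityMeasure_map hζ.aemeasurable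
  calc ∫⁻ ω, T (X ω, ζ ω) ∂P = ∫⁻ z, T z ∂(P.map fun ω => (X ω, ζ ω)) :=
        (lintegral_map hT (hX.prodMk hζ)).symm
    _ = ∫⁻ x, ∫⁻ s, T (x, s) ∂(P.map ζ) ∂(P.map X) := by
        rw [h1, lintegral_prod _ hT.aemeasurable]
    _ ≤ ∫⁻ _, C ∂(P.map X) := by
        refine lintegral_mono fun x => ?_
        exact (lintegral_map (hT.comp measurable_prodMk_left) hζ).trans_le (hC x)
    _ = C := by simp

theorem memLp_comp_of_indepFun {X : Ω → 𝒳} {ζ : Ω → S} (hX : Measurable X)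
    (hζ : Measurable ζ) (hind : IndepFun X ζ P) {T : 𝒳 × S → E} (hT : Measurable T) {σ : ℝ}
    (hL2 : ∀ x, MemLp (fun ω => T (x, ζ ω)) 2 P) (hσ : ∀ x, ∫ ω, ‖T (x, ζ ω)‖ ^ 2 ∂P ≤ σ ^ 2) :
    MemLp (fun ω => T (X ω, ζ ω)) 2 P ∧ ∫ ω, ‖T (X ω, ζ ω)‖ ^ 2 ∂P ≤ σ ^ 2 := by
  have hm : Measurable fun ω => T (X ω, ζ ω) := hT.comp (hX.prodMk hζ)
  have hle : ∫⁻ ω, ENNReal.ofReal (‖T (X ω, ζ ω)‖ ^ 2) ∂P ≤ ENNReal.ofReal (σ ^ 2) := by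
    refine lintegral_comp_le_of_indepFun (T := fun z => ENNReal.ofReal (‖T z‖ ^ 2)) hX hζ hind
      (hT.norm.pow_const 2).ennreal_ofReal fun x => ?_
    rw [← ofReal_integral_eq_lintegral_ofReal ((hL2 x).integrable_norm_pow two_ne_zero)
      (Filter.Eventually.of_forall fun ω => sq_nonneg _)]
    exact ENNReal.ofReal_le_ofReal (hσ x)
  have hint : Integrable (fun ω => ‖T (X ω, ζ ω)‖ ^ 2) P := by
    refine ⟨(hm.norm.pow_const 2).aestronglyMeasurable, ?_⟩
    rw [hasFiniteIntegral_iff_ofReal (Filter.Eventually.of_forall fun ω => sq_nonneg _)]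
    exact hle.trans_lt ENNReal.ofReal_lt_top
  refine ⟨(memLp_two_iff_integrable_sq_norm hm.aestronglyMeasurable).2 hint, ?_⟩
  rw [← ENNReal.ofReal_le_ofReal_iff (sq_nonneg σ),
    ofReal_integral_eq_lintegral_ofReal hint (Filter.Eventually.of_forall fun ω => sq_nonneg _)]
  exact hle

theorem integral_inner_eq_zero_of_indepFun [InnerProductSpace ℝ E] [CompleteSpace E] {H : Ω → E}
    {X : Ω → 𝒳} {ζ : Ω → S}
    (hH : Measurable H) (hX : Measurable X) (hζ : Measurable ζ)
    (hind : IndepFun (fun ω => (H ω, X ω)) ζ P) {T : 𝒳 × S → E} (hT : Measurable T)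
    (hL1 : ∀ x, Integrable (fun ω => T (x, ζ ω)) P) (hzero : ∀ x, ∫ ω, T (x, ζ ω) ∂P = 0)
    (hint : Integrable (fun ω => inner ℝ (H ω) (T (X ω, ζ ω))) P) :
    ∫ ω, inner ℝ (H ω) (T (X ω, ζ ω)) ∂P = 0 := by
  have h1 := (indepFun_iff_map_prod_eq_prod_map_map (hH.prodMk hX).aemeasurable
    hζ.aemeasurable).1 hind
  have hΨ : Measurable fun z : (E × 𝒳) × S => (inner ℝ z.1.1 (T (z.1.2, z.2)) : ℝ) :=
    (measurable_fst.comp measurable_fst).inner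
      (hT.comp ((measurable_snd.comp measurable_fst).prodMk measurable_snd))
  have hm : Measurable fun ω => ((H ω, X ω), ζ ω) := (hH.prodMk hX).prodMk hζ
  have h2 : Integrable (fun z : (E × 𝒳) × S => (inner ℝ z.1.1 (T (z.1.2, z.2)) : ℝ))
      (P.map fun ω => ((H ω, X ω), ζ ω)) :=
    (integrable_map_measure hΨ.aestronglyMeasurable hm.aemeasurable).2 hint
  have : IsProbabilityMeasure (P.map fun ω => (H ω, X ω)) :=
    Measure.isProbabilityMeasure_map (hH.prodMk hX).aemeasurable
  have : IsProbabilityMeasure (P.map ζ) := Measure.isProbabilityMeasure_map hζ.aemeasurable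
  rw [← integral_map (f := fun z : (E × 𝒳) × S => (inner ℝ z.1.1 (T (z.1.2, z.2)) : ℝ))
    hm.aemeasurable hΨ.aestronglyMeasurable]
  rw [h1] at h2 ⊢
  rw [integral_prod _ h2]
  refine integral_eq_zero_of_ae (Filter.Eventually.of_forall fun z => ?_)
  have h3 : Measurable fun s => T (z.2, s) := hT.comp measurable_prodMk_left
  have h4 : ∫ s, T (z.2, s) ∂(P.map ζ) = 0 := by
    rw [integral_map hζ.aemeasurable h3.aestronglyMeasurable, hzero]
  have h5 : Integrable (fun s => T (z.2, s)) (P.map ζ) :=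
    (integrable_map_measure h3.aestronglyMeasurable hζ.aemeasurable).2 (hL1 _)
  simp only [Pi.zero_apply]
  rw [integral_inner h5, h4, inner_zero_right]

end Independence

/-! ### The iterates as random variables -/

/-- The data of one execution of the algorithm: weights, costs, oracle, step-size, initial
decisions and samples. -/
structure Run (n p m : ℕ) (Ω : Type*) where
  A : ℕ → Matrix (Fin n) (Fin n) ℝ
  B : ℕ → Matrix (Fin n) (Fin n) ℝ
  f : Fin n → EuclideanSpace ℝ (Fin p) → ℝ
  g : Fin n → EuclideanSpace ℝ (Fin p) → EuclideanSpace ℝ (Fin m) → EuclideanSpace ℝ (Fin p)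
  α : ℝ
  x0 : Fin n → EuclideanSpace ℝ (Fin p)
  ξ : ℕ → Fin n → Ω → EuclideanSpace ℝ (Fin m)

namespace Run

variable {n p m : ℕ} {Ω : Type*} (R : Run n p m Ω)

/-- The decision of agent `i` at time `k`. -/
def x (k : ℕ) (i : Fin n) (ω : Ω) : EuclideanSpace ℝ (Fin p) :=
  (iterates R.A R.B R.g R.α R.x0 (fun t i => R.ξ t i ω) k).1 i

/-- The direction of agent `i` at time `k`. -/
def y (k : ℕ) (i : Fin n) (ω : Ω) : EuclideanSpace ℝ (Fin p) :=
  (iterates R.A R.B R.g R.α R.x0 (fun t i => R.ξ t i ω) k).2 i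

/-- The error of the gradient sampled by agent `i` at time `k`. -/
noncomputable def noise (k : ℕ) (i : Fin n) (ω : Ω) : EuclideanSpace ℝ (Fin p) :=
  R.g i (R.x k i ω) (R.ξ k i ω) - gradient (R.f i) (R.x k i ω)

/-- The σ-algebra of all the samples up to time `k` but that of agent `i` at time `k`. -/
abbrev others (k : ℕ) (i : Fin n) : MeasurableSpace Ω :=
  ⨆ q ∈ {q : ℕ × Fin n | q ≠ (k, i) ∧ q.1 ≤ k}, MeasurableSpace.comap (R.ξ q.1 q.2) inferInstance

theorem x_succ (k : ℕ) (i : Fin n) (ω : Ω) :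
    R.x (k + 1) i ω = ∑ j, R.A k i j • R.x k j ω - R.α • R.y k i ω := rfl

theorem y_succ_eq (k : ℕ) (i : Fin n) (ω : Ω) :
    R.y (k + 1) i ω = ∑ j, R.B k i j • R.y k j ω
      + R.g i (R.x (k + 1) i ω) (R.ξ (k + 1) i ω) - R.g i (R.x k i ω) (R.ξ k i ω) := rfl

theorem y_succ (k : ℕ) (i : Fin n) (ω : Ω) :
    R.y (k + 1) i ω = ∑ j, R.B k i j • R.y k j ω + (R.noise (k + 1) i ω
      + (gradient (R.f i) (R.x (k + 1) i ω) - gradient (R.f i) (R.x k i ω)) - R.noise k i ω) := by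
  rw [y_succ_eq, noise, noise]
  abel

/-- The total direction is the sum of the sampled gradients. -/
theorem sum_y (hB : ∀ k j, ∑ i, R.B k i j = 1) (k : ℕ) (ω : Ω) :
    ∑ i, R.y k i ω = ∑ i, gradient (R.f i) (R.x k i ω) + ∑ i, R.noise k i ω := by
  have h : ∑ i, R.y k i ω = ∑ i, R.g i (R.x k i ω) (R.ξ k i ω) := by
    induction k with
    | zero => rfl
    | succ k ih =>
      simp only [y_succ_eq]
      rw [Finset.sum_sub_distrib, Finset.sum_add_distrib, sum_sum_smul_of_colSum (hB k), ih]
      abel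
  rw [h, ← Finset.sum_add_distrib]
  exact Finset.sum_congr rfl fun i _ => by rw [noise]; abel

/-- The decisions at time `k`, and the directions at time `k` up to the last sampled gradient,
are functions of the samples before `k`. The σ-algebra on `Ω` is arbitrary. -/
theorem measurable_of_lt [MeasurableSpace Ω] (hg : ∀ i, Measurable (Function.uncurry (R.g i)))
    (k : ℕ) (hξ : ∀ t < k, ∀ i, Measurable (R.ξ t i)) :
    (∀ i, Measurable (R.x k i)) ∧
      ∀ i, Measurable fun ω => R.y k i ω - R.g i (R.x k i ω) (R.ξ k i ω) := by
  induction k with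
  | zero =>
    refine ⟨fun i => measurable_const, fun i => ?_⟩
    have : (fun ω => R.y 0 i ω - R.g i (R.x 0 i ω) (R.ξ 0 i ω)) = fun _ => 0 :=
      funext fun ω => sub_self _
    rw [this]
    exact measurable_const
  | succ k ih =>
    obtain ⟨hx, hy⟩ := ih fun t ht => hξ t (ht.trans k.lt_succ_self)
    have hgk : ∀ i, Measurable fun ω => R.g i (R.x k i ω) (R.ξ k i ω) := fun i =>
      (hg i).comp ((hx i).prodMk (hξ k k.lt_succ_self i))
    have hyk : ∀ i, Measurable (R.y k i) := fun i => by
      have := (hy i).add (hgk i)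
      simpa only [Pi.add_def, sub_add_cancel] using this
    refine ⟨fun i => ?_, fun i => ?_⟩
    · exact (Finset.measurable_fun_sum _ fun j _ => (hx j).const_smul (R.A k i j)).sub
        ((hyk i).const_smul R.α)
    · have h : (fun ω => R.y (k + 1) i ω - R.g i (R.x (k + 1) i ω) (R.ξ (k + 1) i ω))
          = fun ω => ∑ j, R.B k i j • R.y k j ω - R.g i (R.x k i ω) (R.ξ k i ω) := by
        funext ω
        rw [y_succ_eq]
        abel
      rw [h]
      exact (Finset.measurable_fun_sum _ fun j _ => (hyk j).const_smul (R.B k i j)).sub (hgk i)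

variable {L σ : ℝ} (hf : SmoothCosts R.f L)
include hf

theorem measurable_gradient (i : Fin n) : Measurable (gradient (R.f i)) :=
  (LipschitzWith.of_dist_le' (K := L) fun x y => by
    rw [dist_eq_norm, dist_eq_norm]
    exact (hf i).2 x y).continuous.measurable

theorem measurable_noise [MeasurableSpace Ω] (hg : ∀ i, Measurable (Function.uncurry (R.g i)))
    (k : ℕ) (i : Fin n) (hξ : ∀ t < k, ∀ i, Measurable (R.ξ t i)) (hξi : Measurable (R.ξ k i)) :
    Measurable (R.noise k i) :=
  ((hg i).comp (((R.measurable_of_lt hg k hξ).1 i).prodMk hξi)).sub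
    ((R.measurable_gradient hf i).comp ((R.measurable_of_lt hg k hξ).1 i))

theorem measurable_y_sub_noise [MeasurableSpace Ω]
    (hg : ∀ i, Measurable (Function.uncurry (R.g i)))
    (k : ℕ) (i : Fin n) (hξ : ∀ t < k, ∀ i, Measurable (R.ξ t i)) :
    Measurable fun ω => R.y k i ω - R.noise k i ω := by
  have h : (fun ω => R.y k i ω - R.noise k i ω) = fun ω =>
      (R.y k i ω - R.g i (R.x k i ω) (R.ξ k i ω)) + gradient (R.f i) (R.x k i ω) := by
    funext ω
    rw [noise]
    abel
  rw [h]
  exact ((R.measurable_of_lt hg k hξ).2 i).add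
    ((R.measurable_gradient hf i).comp ((R.measurable_of_lt hg k hξ).1 i))

theorem measurable_y [MeasurableSpace Ω] (hg : ∀ i, Measurable (Function.uncurry (R.g i)))
    (k : ℕ) (i : Fin n) (hξ : ∀ t < k, ∀ i, Measurable (R.ξ t i)) (hξi : Measurable (R.ξ k i)) :
    Measurable (R.y k i) := by
  have := (R.measurable_y_sub_noise hf hg k i hξ).add (R.measurable_noise hf hg k i hξ hξi)
  simpa only [Pi.add_def, sub_add_cancel] using this

omit hf in
theorem measurable_others {k : ℕ} {i : Fin n} {t : ℕ} {j : Fin n} (hne : (t, j) ≠ (k, i))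
    (ht : t ≤ k) : Measurable[R.others k i] (R.ξ t j) := by
  rw [measurable_iff_comap_le]
  exact le_iSup₂_of_le (f := fun (q : ℕ × Fin n)
    (_ : q ∈ {q : ℕ × Fin n | q ≠ (k, i) ∧ q.1 ≤ k}) =>
      MeasurableSpace.comap (R.ξ q.1 q.2) inferInstance) (t, j) ⟨hne, ht⟩ le_rfl

omit hf in
theorem measurable_others_of_lt {k : ℕ} (i : Fin n) (t : ℕ) (ht : t < k) (j : Fin n) :
    Measurable[R.others k i] (R.ξ t j) :=
  R.measurable_others (fun h => ht.ne (congrArg Prod.fst h)) ht.le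

variable [MeasurableSpace Ω] {P : Measure Ω} [IsProbabilityMeasure P]
  (h : IsOracle P R.f R.g R.ξ σ)
include h

omit hf [IsProbabilityMeasure P] in
theorem others_le (k : ℕ) (i : Fin n) : R.others k i ≤ ‹MeasurableSpace Ω› :=
  iSup₂_le fun q _ => (h.measurable_sample q.1 q.2).comap_le

omit hf [IsProbabilityMeasure P] in
theorem indepFun_of_measurable_others {𝒳 : Type*} [MeasurableSpace 𝒳] {k : ℕ} {i : Fin n}
    {X : Ω → 𝒳} (hX : Measurable[R.others k i] X) : IndepFun X (R.ξ k i) P := by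
  have h1 := indep_iSup_of_disjoint (fun q : ℕ × Fin n => (h.measurable_sample q.1 q.2).comap_le)
    h.indep.iIndep (S := {q : ℕ × Fin n | q ≠ (k, i) ∧ q.1 ≤ k}) (T := {(k, i)})
    (Set.disjoint_singleton_right.2 fun hq => hq.1 rfl)
  rw [iSup_singleton] at h1
  rw [IndepFun_iff_Indep]
  exact indep_of_indep_of_le_left h1 (measurable_iff_comap_le.1 hX)

theorem memLp_noise (k : ℕ) (i : Fin n) :
    MemLp (R.noise k i) 2 P ∧ ∫ ω, ‖R.noise k i ω‖ ^ 2 ∂P ≤ σ ^ 2 := by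
  have hx : Measurable[R.others k i] (R.x k i) :=
    (@measurable_of_lt _ _ _ _ R (R.others k i) h.measurable_oracle k
      (R.measurable_others_of_lt i)).1 i
  exact memLp_comp_of_indepFun (T := fun z => R.g i z.1 z.2 - gradient (R.f i) z.1)
    (hx.mono (R.others_le h k i) le_rfl) (h.measurable_sample k i)
    (R.indepFun_of_measurable_others h hx)
    ((h.measurable_oracle i).sub ((R.measurable_gradient hf i).comp measurable_fst))
    (fun x => (h.memLp k i x).sub (memLp_const (gradient (R.f i) x))) (fun x => h.variance_le k i x)

/-- The noise of agent `i` at time `k` is orthogonal to every square-integrable random vector that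
does not depend on its sample at time `k`. -/
theorem integral_inner_noise {k : ℕ} {i : Fin n} {H : Ω → EuclideanSpace ℝ (Fin p)}
    (hH : Measurable[R.others k i] H) (hH2 : MemLp H 2 P) :
    ∫ ω, inner ℝ (H ω) (R.noise k i ω) ∂P = 0 := by
  have hx : Measurable[R.others k i] (R.x k i) :=
    (@measurable_of_lt _ _ _ _ R (R.others k i) h.measurable_oracle k
      (R.measurable_others_of_lt i)).1 i
  have hL2 : ∀ x, MemLp (fun ω => R.g i x (R.ξ k i ω) - gradient (R.f i) x) 2 P :=
    fun x => (h.memLp k i x).sub (memLp_const _)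
  have hzero : ∀ x, ∫ ω, R.g i x (R.ξ k i ω) - gradient (R.f i) x ∂P = 0 := fun x => by
    rw [integral_sub ((h.memLp k i x).integrable one_le_two) (integrable_const _), h.unbiased]
    simp
  have hHx : Measurable[R.others k i] fun ω => (H ω, R.x k i ω) := hH.prodMk hx
  exact integral_inner_eq_zero_of_indepFun
    (T := fun z => R.g i z.1 z.2 - gradient (R.f i) z.1)
    (hH.mono (R.others_le h k i) le_rfl) (hx.mono (R.others_le h k i) le_rfl)
    (h.measurable_sample k i)
    (R.indepFun_of_measurable_others h hHx)
    ((h.measurable_oracle i).sub ((R.measurable_gradient hf i).comp measurable_fst))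
    (fun x => (hL2 x).integrable one_le_two)
    hzero
    (integrable_inner_of_memLp hH2 (R.memLp_noise hf h k i).1)

theorem memLp_x_y (k : ℕ) : (∀ i, MemLp (R.x k i) 2 P) ∧ ∀ i, MemLp (R.y k i) 2 P := by
  have hgrad : ∀ {k}, (∀ i, MemLp (R.x k i) 2 P) → ∀ i,
      MemLp (fun ω => gradient (R.f i) (R.x k i ω)) 2 P := fun hx i =>
    memLp_comp_of_lipschitz (hf i).2 (hx i)
  induction k with
  | zero =>
    have hx : ∀ i, MemLp (R.x 0 i) 2 P := fun i => memLp_const (R.x0 i)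
    refine ⟨hx, fun i => ?_⟩
    have := (hgrad hx i).add (R.memLp_noise hf h 0 i).1
    refine this.ae_eq (Filter.Eventually.of_forall fun ω => ?_)
    exact add_sub_cancel _ _
  | succ k ih =>
    have hx : ∀ i, MemLp (R.x (k + 1) i) 2 P := fun i =>
      (memLp_finsetSum _ fun j _ => (ih.1 j).const_smul (R.A k i j)).sub
        ((ih.2 i).const_smul R.α)
    refine ⟨hx, fun i => ?_⟩
    have := (memLp_finsetSum (f := fun j ω => R.B k i j • R.y k j ω) Finset.univ fun j _ =>
      (ih.2 j).const_smul (R.B k i j)).add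
      (((R.memLp_noise hf h (k + 1) i).1.add ((hgrad hx i).sub (hgrad ih.1 i))).sub
        (R.memLp_noise hf h k i).1)
    refine this.ae_eq (Filter.Eventually.of_forall fun ω => ?_)
    simp [y_succ]

theorem memLp_gradient (k : ℕ) (i : Fin n) :
    MemLp (fun ω => gradient (R.f i) (R.x k i ω)) 2 P :=
  memLp_comp_of_lipschitz (hf i).2 ((R.memLp_x_y hf h k).1 i)

end Run

/-! ### Expected errors after one step -/

/-- `f` is integrable and its mean is at most `v`. -/
def MeanLe {Ω : Type*} [MeasurableSpace Ω] (P : Measure Ω) (f : Ω → ℝ) (v : ℝ) : Prop :=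
  Integrable f P ∧ ∫ ω, f ω ∂P ≤ v

namespace MeanLe

variable {Ω : Type*} [MeasurableSpace Ω] {P : Measure Ω} {f g : Ω → ℝ} {u v : ℝ}

theorem of_integrable (hf : Integrable f P) : MeanLe P f (∫ ω, f ω ∂P) := ⟨hf, le_rfl⟩

theorem add (hf : MeanLe P f u) (hg : MeanLe P g v) : MeanLe P (fun ω => f ω + g ω) (u + v) :=
  ⟨hf.1.add hg.1, by rw [integral_add hf.1 hg.1]; exact add_le_add hf.2 hg.2⟩

theorem const_mul (hf : MeanLe P f u) {c : ℝ} (hc : 0 ≤ c) :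
    MeanLe P (fun ω => c * f ω) (c * u) :=
  ⟨hf.1.const_mul c, by rw [integral_const_mul]; exact mul_le_mul_of_nonneg_left hf.2 hc⟩

theorem sum {ι : Type*} [Fintype ι] {f : ι → Ω → ℝ} {u : ι → ℝ} (hf : ∀ i, MeanLe P (f i) (u i)) :
    MeanLe P (fun ω => ∑ i, f i ω) (∑ i, u i) :=
  ⟨integrable_finsetSum _ fun i _ => (hf i).1, by
    rw [integral_finsetSum _ fun i _ => (hf i).1]
    exact Finset.sum_le_sum fun i _ => (hf i).2⟩

theorem integral_le (hg : MeanLe P g v) (hf : Integrable f P) (hfg : ∀ ω, f ω ≤ g ω) :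
    ∫ ω, f ω ∂P ≤ v :=
  (integral_mono hf hg.1 hfg).trans hg.2

end MeanLe

namespace Run

variable {n p m : ℕ} {Ω : Type*} (R : Run n p m Ω) (phi : ℕ → Fin n → ℝ)
  (xstar : EuclideanSpace ℝ (Fin p))

/-- The weighted average of the decisions. -/
noncomputable def xhat (k : ℕ) (ω : Ω) : EuclideanSpace ℝ (Fin p) := ∑ i, phi k i • R.x k i ω

/-- The optimality gap of the weighted average. -/
noncomputable def gap (k : ℕ) (ω : Ω) : ℝ := ‖R.xhat phi k ω - xstar‖ ^ 2

/-- The weighted consensus error. -/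
noncomputable def cons (k : ℕ) (ω : Ω) : ℝ := ∑ i, phi k i * ‖R.x k i ω - R.xhat phi k ω‖ ^ 2

/-- The squared gradient tracking error. -/
noncomputable def track (k : ℕ) (ω : Ω) : ℝ :=
  ∑ i, piSeq R.B k i * ‖(piSeq R.B k i)⁻¹ • R.y k i ω - ∑ j, R.y k j ω‖ ^ 2

/-- The mixed directions. -/
noncomputable def mixed (k : ℕ) (i : Fin n) (ω : Ω) : EuclideanSpace ℝ (Fin p) :=
  ∑ j, R.B k i j • R.y k j ω

/-- What the one-step estimates use of the problem: the properties of the costs and of the oracle,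
and the properties of the weights, among them the contraction by the mixing steps. -/
structure Setting [MeasurableSpace Ω] (P : Measure Ω) (C : Consts) : Prop where
  adm : C.Admissible n
  smooth : SmoothCosts R.f C.L
  oracle : IsOracle P R.f R.g R.ξ C.sigma
  α_pos : 0 < R.α
  α_le : R.α ≤ C.stepBound n
  sum_gradient : ∑ i, gradient (R.f i) xstar = 0
  mono : ∀ x y, n * C.mu * ‖x - y‖ ^ 2
    ≤ inner ℝ (∑ i, gradient (R.f i) x - ∑ i, gradient (R.f i) y) (x - y)
  phi_pos : ∀ k i, 0 < phi k i
  phi_sum : ∀ k, ∑ i, phi k i = 1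
  phi_ge : ∀ k i, 1 ≤ C.vphi ^ 2 * phi k i
  phi_adjoint : ∀ k j, ∑ i, phi (k + 1) i * R.A k i j = phi k j
  pi_pos : ∀ k i, 0 < piSeq R.B k i
  pi_sum : ∀ k, ∑ i, piSeq R.B k i = 1
  pi_inv_le_kappa : ∀ k i, (piSeq R.B k i)⁻¹ ≤ C.kappa ^ 2
  pi_inv_le_psi : ∀ k i, (piSeq R.B (k + 1) i)⁻¹ ≤ C.psi
  B_nonneg : ∀ k i j, 0 ≤ R.B k i j
  B_sum : ∀ k j, ∑ i, R.B k i j = 1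
  eta_le : ∀ k, C.eta ≤ ∑ i, phi (k + 1) i * piSeq R.B k i
  contract_A : ∀ k (x : Fin n → EuclideanSpace ℝ (Fin p)),
    ∑ i, phi (k + 1) i * ‖(∑ j, R.A k i j • x j) - ∑ j, phi k j • x j‖ ^ 2
      ≤ C.c ^ 2 * ∑ i, phi k i * ‖x i - ∑ j, phi k j • x j‖ ^ 2
  contract_B : ∀ k (y : Fin n → EuclideanSpace ℝ (Fin p)),
    ∑ i, piSeq R.B (k + 1) i * ‖(piSeq R.B (k + 1) i)⁻¹ • (∑ j, R.B k i j • y j)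
        - ∑ l, ∑ j, R.B k l j • y j‖ ^ 2
      ≤ C.tau ^ 2 * ∑ i, piSeq R.B k i * ‖(piSeq R.B k i)⁻¹ • y i - ∑ j, y j‖ ^ 2

namespace Setting

variable {R phi xstar} [MeasurableSpace Ω] {P : Measure Ω} [IsProbabilityMeasure P] {C : Consts}
  (h : R.Setting phi xstar P C)
include h

omit [IsProbabilityMeasure P] in
theorem xhat_succ (k : ℕ) (ω : Ω) :
    R.xhat phi (k + 1) ω
      = R.xhat phi k ω - R.α • ∑ i, phi (k + 1) i • R.y k i ω := by
  simp only [xhat, x_succ, smul_sub, Finset.sum_sub_distrib, Finset.smul_sum]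
  congr 1
  · rw [Finset.sum_comm]
    refine Finset.sum_congr rfl fun j _ => ?_
    rw [← h.phi_adjoint k j, Finset.sum_smul]
    exact Finset.sum_congr rfl fun i _ => smul_smul _ _ _
  · exact Finset.sum_congr rfl fun i _ => smul_comm _ _ _

theorem memLp_x (k : ℕ) (i : Fin n) : MemLp (R.x k i) 2 P :=
  (R.memLp_x_y h.smooth h.oracle k).1 i

theorem memLp_y (k : ℕ) (i : Fin n) : MemLp (R.y k i) 2 P :=
  (R.memLp_x_y h.smooth h.oracle k).2 i

theorem memLp_noise (k : ℕ) (i : Fin n) : MemLp (R.noise k i) 2 P :=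
  (R.memLp_noise h.smooth h.oracle k i).1

theorem memLp_gradient (k : ℕ) (i : Fin n) :
    MemLp (fun ω => gradient (R.f i) (R.x k i ω)) 2 P :=
  R.memLp_gradient h.smooth h.oracle k i

theorem memLp_xhat (k : ℕ) : MemLp (R.xhat phi k) 2 P :=
  memLp_finsetSum (f := fun i ω => phi k i • R.x k i ω) Finset.univ
    fun i _ => (h.memLp_x k i).const_smul (phi k i)

theorem memLp_sum_y (k : ℕ) : MemLp (fun ω => ∑ i, R.y k i ω) 2 P :=
  memLp_finsetSum Finset.univ fun i _ => h.memLp_y k i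

theorem memLp_mixed (k : ℕ) (i : Fin n) : MemLp (R.mixed k i) 2 P :=
  memLp_finsetSum (f := fun j ω => R.B k i j • R.y k j ω) Finset.univ
    fun j _ => (h.memLp_y k j).const_smul (R.B k i j)

theorem integrable_gap (k : ℕ) : Integrable (R.gap phi xstar k) P :=
  ((h.memLp_xhat k).sub (memLp_const xstar)).integrable_norm_pow two_ne_zero

theorem integrable_cons (k : ℕ) : Integrable (R.cons phi k) P :=
  integrable_finsetSum _ fun i _ =>
    (((h.memLp_x k i).sub (h.memLp_xhat k)).integrable_norm_pow two_ne_zero).const_mul _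

theorem integrable_track (k : ℕ) : Integrable (R.track k) P :=
  integrable_finsetSum (f := fun i ω => piSeq R.B k i *
      ‖(piSeq R.B k i)⁻¹ • R.y k i ω - ∑ j, R.y k j ω‖ ^ 2) Finset.univ fun i _ =>
    ((((h.memLp_y k i).const_smul (piSeq R.B k i)⁻¹).sub
      (h.memLp_sum_y k)).integrable_norm_pow two_ne_zero).const_mul (piSeq R.B k i)

theorem meanLe_norm_noise_sq (k : ℕ) (i : Fin n) :
    MeanLe P (fun ω => ‖R.noise k i ω‖ ^ 2) (C.sigma ^ 2) :=
  ⟨(h.memLp_noise k i).integrable_norm_pow two_ne_zero,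
    (R.memLp_noise h.smooth h.oracle k i).2⟩

theorem meanLe_sum_norm_noise_sq (k : ℕ) :
    MeanLe P (fun ω => ∑ i, ‖R.noise k i ω‖ ^ 2) (n * C.sigma ^ 2) := by
  have := MeanLe.sum fun i => h.meanLe_norm_noise_sq k i
  simpa using this

theorem meanLe_inner_noise {k : ℕ} {i : Fin n} {H : Ω → EuclideanSpace ℝ (Fin p)}
    (hH : Measurable[R.others k i] H) (hH2 : MemLp H 2 P) (s : ℝ) :
    MeanLe P (fun ω => s * inner ℝ (H ω) (R.noise k i ω)) 0 := by
  refine ⟨(integrable_inner_of_memLp hH2 (h.memLp_noise k i)).const_mul s, ?_⟩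
  rw [integral_const_mul, R.integral_inner_noise h.smooth h.oracle hH hH2, mul_zero]

omit [IsProbabilityMeasure P] in
theorem measurable_x (k : ℕ) (i j : Fin n) : Measurable[R.others k i] (R.x k j) :=
  (@measurable_of_lt _ _ _ _ R (R.others k i) h.oracle.measurable_oracle k
    (R.measurable_others_of_lt i)).1 j

omit [IsProbabilityMeasure P] in
theorem measurable_xhat (k : ℕ) (i : Fin n) : Measurable[R.others k i] (R.xhat phi k) :=
  Finset.measurable_fun_sum _ fun j _ => (h.measurable_x k i j).const_smul (phi k j)

omit [IsProbabilityMeasure P] in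
theorem measurable_gradient (k : ℕ) (i j : Fin n) :
    Measurable[R.others k i] fun ω => gradient (R.f j) (R.x k j ω) :=
  (R.measurable_gradient h.smooth j).comp (h.measurable_x k i j)

omit [IsProbabilityMeasure P] in
theorem measurable_noise_of_ne {k : ℕ} {i j : Fin n} (hji : j ≠ i) :
    Measurable[R.others k i] (R.noise k j) :=
  @measurable_noise _ _ _ _ R _ h.smooth (R.others k i) h.oracle.measurable_oracle k j
    (R.measurable_others_of_lt i)
    (R.measurable_others (fun he => hji (congrArg Prod.snd he)) le_rfl)

omit [IsProbabilityMeasure P] in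
theorem measurable_y_of_ne {k : ℕ} {i j : Fin n} (hji : j ≠ i) :
    Measurable[R.others k i] (R.y k j) :=
  @measurable_y _ _ _ _ R _ h.smooth (R.others k i) h.oracle.measurable_oracle k j
    (R.measurable_others_of_lt i)
    (R.measurable_others (fun he => hji (congrArg Prod.snd he)) le_rfl)

omit [IsProbabilityMeasure P] in
theorem measurable_y_sub_noise (k : ℕ) (i : Fin n) :
    Measurable[R.others k i] fun ω => R.y k i ω - R.noise k i ω :=
  @Run.measurable_y_sub_noise _ _ _ _ R _ h.smooth (R.others k i) h.oracle.measurable_oracle k i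
    (R.measurable_others_of_lt i)

omit [IsProbabilityMeasure P] in
theorem measurable_noise_succ (k : ℕ) (i j : Fin n) :
    Measurable[R.others (k + 1) i] (R.noise k j) :=
  @measurable_noise _ _ _ _ R _ h.smooth (R.others (k + 1) i) h.oracle.measurable_oracle k j
    (fun t ht => R.measurable_others_of_lt i t (ht.trans k.lt_succ_self))
    (R.measurable_others_of_lt i k k.lt_succ_self j)

omit [IsProbabilityMeasure P] in
theorem measurable_y_succ (k : ℕ) (i j : Fin n) :
    Measurable[R.others (k + 1) i] (R.y k j) :=
  @measurable_y _ _ _ _ R _ h.smooth (R.others (k + 1) i) h.oracle.measurable_oracle k j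
    (fun t ht => R.measurable_others_of_lt i t (ht.trans k.lt_succ_self))
    (R.measurable_others_of_lt i k k.lt_succ_self j)

omit [IsProbabilityMeasure P] in
theorem measurable_x_succ (k : ℕ) (i j : Fin n) :
    Measurable[R.others (k + 1) i] (R.x k j) :=
  (@measurable_of_lt _ _ _ _ R (R.others (k + 1) i) h.oracle.measurable_oracle k
    fun t ht => R.measurable_others_of_lt i t (ht.trans k.lt_succ_self)).1 j

/-- The noises of the agents at one time are uncorrelated. -/
theorem meanLe_norm_sum_noise_sq (k : ℕ) :
    MeanLe P (fun ω => ‖∑ i, R.noise k i ω‖ ^ 2) (n * C.sigma ^ 2) := by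
  classical
  have h0 : ∀ i, MeanLe P (fun ω => 1 * inner ℝ (∑ j ∈ Finset.univ.erase i, R.noise k j ω)
      (R.noise k i ω)) 0 := fun i =>
    h.meanLe_inner_noise (H := fun ω => ∑ j ∈ Finset.univ.erase i, R.noise k j ω)
      (Finset.measurable_fun_sum _ fun j hj => h.measurable_noise_of_ne (Finset.ne_of_mem_erase hj))
      (memLp_finsetSum _ fun j _ => h.memLp_noise k j) 1
  have h1 := (h.meanLe_sum_norm_noise_sq k).add (MeanLe.sum h0)
  have h2 : (fun ω => ‖∑ i, R.noise k i ω‖ ^ 2) = fun ω => ∑ i, ‖R.noise k i ω‖ ^ 2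
      + ∑ i, 1 * inner ℝ (∑ j ∈ Finset.univ.erase i, R.noise k j ω) (R.noise k i ω) := by
    funext ω
    rw [← real_inner_self_eq_norm_sq, inner_sum, ← Finset.sum_add_distrib]
    refine Finset.sum_congr rfl fun i _ => ?_
    rw [← Finset.add_sum_erase _ _ (Finset.mem_univ i), inner_add_left,
      real_inner_self_eq_norm_sq, one_mul]
  rw [h2]
  simpa using h1

omit [IsProbabilityMeasure P] in
theorem norm_sum_gradient_sq_le (k : ℕ) (ω : Ω) :
    ‖∑ i, gradient (R.f i) (R.x k i ω)‖ ^ 2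
      ≤ n * C.L ^ 2 * C.vphi ^ 2 * (R.gap phi xstar k ω + R.cons phi k ω) := by
  have h1 := norm_sum_sub_sq_le (F := fun i => gradient (R.f i)) (fun i => (h.smooth i).2)
    (h.phi_ge k) (fun i => R.x k i ω) xstar
  rw [h.sum_gradient, sub_zero, sum_weight_norm_sub_sq (h.phi_sum k), Fintype.card_fin] at h1
  rw [gap, cons, xhat, add_comm (‖_‖ ^ 2)]
  exact h1

theorem meanLe_norm_sum_y_sq (k : ℕ) :
    MeanLe P (fun ω => ‖∑ i, R.y k i ω‖ ^ 2)
      (n * C.L ^ 2 * C.vphi ^ 2 * (∫ ω, R.gap phi xstar k ω ∂P + ∫ ω, R.cons phi k ω ∂P)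
        + n * C.sigma ^ 2) := by
  have hF : MemLp (fun ω => ∑ j, gradient (R.f j) (R.x k j ω)) 2 P :=
    memLp_finsetSum _ fun j _ => h.memLp_gradient k j
  have h0 : ∀ i, MeanLe P (fun ω => 2 * inner ℝ (∑ j, gradient (R.f j) (R.x k j ω))
      (R.noise k i ω)) 0 := fun i =>
    h.meanLe_inner_noise (H := fun ω => ∑ j, gradient (R.f j) (R.x k j ω))
      (Finset.measurable_fun_sum _ fun j _ => h.measurable_gradient k i j) hF 2
  have hC : 0 ≤ n * C.L ^ 2 * C.vphi ^ 2 := by positivity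
  have h1 := ((((MeanLe.of_integrable (h.integrable_gap k)).add
    (MeanLe.of_integrable (h.integrable_cons k))).const_mul hC).add (MeanLe.sum h0)).add
      (h.meanLe_norm_sum_noise_sq k)
  rw [Finset.sum_const_zero, add_zero] at h1
  refine ⟨(h.memLp_sum_y k).integrable_norm_pow two_ne_zero,
    h1.integral_le ((h.memLp_sum_y k).integrable_norm_pow two_ne_zero) fun ω => ?_⟩
  rw [R.sum_y h.B_sum, norm_add_sq_real, inner_sum, Finset.mul_sum]
  have := h.norm_sum_gradient_sq_le k ω
  linarith

omit [IsProbabilityMeasure P] in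
theorem cons_nonneg (k : ℕ) (ω : Ω) : 0 ≤ R.cons phi k ω :=
  Finset.sum_nonneg fun i _ => mul_nonneg (h.phi_pos k i).le (sq_nonneg _)

omit [IsProbabilityMeasure P] in
theorem track_nonneg (k : ℕ) (ω : Ω) : 0 ≤ R.track k ω :=
  Finset.sum_nonneg fun i _ => mul_nonneg (h.pi_pos k i).le (sq_nonneg _)

theorem meanLe_sum_norm_y_sq (k : ℕ) :
    MeanLe P (fun ω => ∑ i, ‖R.y k i ω‖ ^ 2)
      (∫ ω, R.track k ω ∂P + (n * C.L ^ 2 * C.vphi ^ 2 *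
        (∫ ω, R.gap phi xstar k ω ∂P + ∫ ω, R.cons phi k ω ∂P) + n * C.sigma ^ 2)) := by
  have hint : Integrable (fun ω => ∑ i, ‖R.y k i ω‖ ^ 2) P :=
    integrable_finsetSum _ fun i _ => (h.memLp_y k i).integrable_norm_pow two_ne_zero
  exact ⟨hint, ((MeanLe.of_integrable (h.integrable_track k)).add
    (h.meanLe_norm_sum_y_sq k)).integral_le hint fun ω =>
      sum_norm_sq_le_trackErr (h.pi_pos k) (h.pi_sum k) _⟩

omit [IsProbabilityMeasure P] in
theorem phi_le_one (k : ℕ) (i : Fin n) : phi k i ≤ 1 :=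
  h.phi_sum k ▸ Finset.single_le_sum (fun j _ => (h.phi_pos k j).le) (Finset.mem_univ i)

omit [IsProbabilityMeasure P] in
theorem theta_le_one (k : ℕ) : ∑ i, phi (k + 1) i * piSeq R.B k i ≤ 1 := by
  rw [← h.pi_sum k]
  exact Finset.sum_le_sum fun i _ => mul_le_of_le_one_left (h.pi_pos k i).le (h.phi_le_one _ i)

/-- The first row: the system matrix, damped by the factor `θ = φ_{k+1}ᵀ π_k`. -/
theorem integral_gap_succ_le (k : ℕ) {θ : ℝ} (hθ : θ = ∑ i, phi (k + 1) i * piSeq R.B k i) :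
    ∫ ω, R.gap phi xstar (k + 1) ω ∂P
      ≤ (1 - θ * (C.m1 n * R.α)) * ∫ ω, R.gap phi xstar k ω ∂P
        + θ * (C.m2 * R.α) * ∫ ω, R.cons phi k ω ∂P
        + θ * (C.m3 n * R.α) * ∫ ω, R.track k ω ∂P + θ * (C.b1 n * R.α ^ 2) := by
  have hn := h.adm.n_pos
  have hmu := h.adm.mu_pos
  have heta := h.adm.eta_pos
  have hL := h.adm.L_pos
  have hα := h.α_pos
  have hθη : C.eta ≤ θ := hθ ▸ h.eta_le k
  have hθ0 : 0 < θ := heta.trans_le hθη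
  have hθ1 : θ ≤ 1 := hθ ▸ h.theta_le_one k
  have hαL := h.adm.alpha_le h.α_pos h.α_le
  have hm1 : 0 ≤ 1 - θ * (C.m1 n * R.α) := by
    have h1 := h.adm.M_pos h.α_pos h.α_le 0 0
    have h2 : 0 < 1 - C.m1 n * R.α := by simpa [Consts.M] using h1
    have h3 : 0 ≤ C.m1 n * R.α := by unfold Consts.m1; positivity
    have h4 := mul_le_of_le_one_left h3 hθ1
    linarith
  set s := R.α * θ with hs
  have hF : MemLp (fun ω => ∑ j, gradient (R.f j) (R.x k j ω)) 2 P :=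
    memLp_finsetSum _ fun j _ => h.memLp_gradient k j
  have h0 : ∀ i, MeanLe P (fun ω => -2 * s * inner ℝ (R.xhat phi k ω - xstar
      - s • ∑ j, gradient (R.f j) (R.x k j ω)) (R.noise k i ω)) 0 := fun i =>
    h.meanLe_inner_noise (H := fun ω => R.xhat phi k ω - xstar
      - s • ∑ j, gradient (R.f j) (R.x k j ω))
      (((h.measurable_xhat k i).sub measurable_const).sub
        ((Finset.measurable_fun_sum _ fun j _ => h.measurable_gradient k i j).const_smul s))
      (((h.memLp_xhat k).sub (memLp_const xstar)).sub (hF.const_smul s)) (-2 * s)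
  have hcoef2 : 0 ≤ θ * (C.m2 * R.α) := by unfold Consts.m2; positivity
  have hcoef3 : 0 ≤ 3 / (n * C.mu) * R.α := by positivity
  have h1 := (((((MeanLe.of_integrable (h.integrable_gap k)).const_mul hm1).add
    ((MeanLe.of_integrable (h.integrable_cons k)).const_mul hcoef2)).add
    ((MeanLe.of_integrable (h.integrable_track k)).const_mul hcoef3)).add
    ((h.meanLe_norm_sum_noise_sq k).const_mul (by positivity : 0 ≤ 3 / 2 * s ^ 2))).add
    (MeanLe.sum h0)
  have h2 := h1.integral_le (h.integrable_gap (k + 1)) fun ω => by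
    have hd := norm_sum_smul_sub_sq_le (h.pi_pos k) (fun i => (h.phi_pos (k + 1) i).le)
      (h.phi_le_one (k + 1)) (fun i => R.y k i ω) (∑ j, R.y k j ω)
    rw [← hθ] at hd
    have huF := norm_sum_sub_sq_le (F := fun i => gradient (R.f i)) (fun i => (h.smooth i).2)
      (h.phi_ge k) (fun i => R.x k i ω) (R.xhat phi k ω)
    rw [Fintype.card_fin] at huF
    have hu := norm_sum_gradient_sub_le h.smooth (R.xhat phi k ω) xstar
    have hmono := h.mono (R.xhat phi k ω) xstar
    rw [h.sum_gradient, sub_zero] at hu hmono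
    have hmain := norm_sub_smul_sq_le (N := ∑ i, R.noise k i ω) hn hmu h.adm.mu_le hα hθ0 hθ1 hαL
      (h.cons_nonneg k ω) (h.track_nonneg k ω) (sq_nonneg C.vphi) hu hmono huF hd
    have hstep : R.xhat phi (k + 1) ω - xstar = R.xhat phi k ω - xstar
        - R.α • (∑ i, phi (k + 1) i • (R.y k i ω - piSeq R.B k i • ∑ j, R.y k j ω)
          + θ • (∑ i, gradient (R.f i) (R.x k i ω) + ∑ i, R.noise k i ω)) := by
      rw [h.xhat_succ, ← R.sum_y h.B_sum]
      simp only [smul_sub, Finset.sum_sub_distrib, smul_smul, ← Finset.sum_smul, ← hθ]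
      rw [sub_add_cancel]
      abel
    rw [gap, hstep, ← Finset.mul_sum, ← inner_sum]
    refine hmain.trans (le_of_eq ?_)
    rw [gap, Consts.m1, Consts.m2]
    ring
  have hS0 : 0 ≤ ∫ ω, R.track k ω ∂P := integral_nonneg (h.track_nonneg k)
  -- the coefficient of the tracking error has no factor `θ`; it is recovered from `θ ≥ η`
  have h3 : 3 / (n * C.mu) * R.α * ∫ ω, R.track k ω ∂P
      ≤ θ * (C.m3 n * R.α) * ∫ ω, R.track k ω ∂P := by
    refine mul_le_mul_of_nonneg_right ?_ hS0
    have h4 : 3 / (n * C.mu) * R.α = C.eta * (C.m3 n * R.α) := by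
      rw [Consts.m3]; field_simp
    have h5 : 0 ≤ C.m3 n * R.α := by unfold Consts.m3; positivity
    rw [h4]
    exact mul_le_mul_of_nonneg_right hθη h5
  have h4 : 3 / 2 * s ^ 2 * (n * C.sigma ^ 2) ≤ θ * (C.b1 n * R.α ^ 2) := by
    have h5 : 3 / 2 * s ^ 2 * (n * C.sigma ^ 2) = θ * (θ * (C.b1 n * R.α ^ 2)) := by
      rw [hs, Consts.b1]; ring
    have h6 : 0 ≤ C.b1 n * R.α ^ 2 := by unfold Consts.b1; positivity
    rw [h5]
    exact mul_le_mul_of_nonneg_left (mul_le_of_le_one_left h6 hθ1) hθ0.le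
  rw [Finset.sum_const_zero] at h2
  linarith

/-- The second row. -/
theorem integral_cons_succ_le (k : ℕ) :
    ∫ ω, R.cons phi (k + 1) ω ∂P
      ≤ (1 + C.c ^ 2) / 2 * ∫ ω, R.cons phi k ω ∂P
        + C.m5 * R.α ^ 2 * (∫ ω, R.track k ω ∂P + (n * C.L ^ 2 * C.vphi ^ 2 *
          (∫ ω, R.gap phi xstar k ω ∂P + ∫ ω, R.cons phi k ω ∂P) + n * C.sigma ^ 2)) := by
  have hc : 0 < 1 - C.c ^ 2 := by linarith [h.adm.c_sq_lt_one]
  have h1 := ((MeanLe.of_integrable (h.integrable_cons k)).const_mul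
    (by positivity : 0 ≤ (1 + C.c ^ 2) / 2)).add ((h.meanLe_sum_norm_y_sq k).const_mul
      (by unfold Consts.m5; positivity : 0 ≤ C.m5 * R.α ^ 2))
  refine h1.integral_le (h.integrable_cons (k + 1)) fun ω => ?_
  have h2 := sum_weight_norm_sub_smul_sq_le (α := R.α) h.adm.c_pos h.adm.c_lt_one
    (fun i => (h.phi_pos (k + 1) i).le) (h.phi_sum (k + 1))
    (fun i => ∑ j, R.A k i j • R.x k j ω) (fun i => R.y k i ω) _
    (h.contract_A k fun i => R.x k i ω)
  rw [cons, h.xhat_succ]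
  exact h2

/-- The tracking error of the mixed directions, with the contribution of the noise of agent `i`
removed, does not depend on the sample of agent `i`. -/
theorem meanLe_inner_mixed_noise (k : ℕ) (i : Fin n) :
    MeanLe P (fun ω => -2 * inner ℝ ((piSeq R.B (k + 1) i)⁻¹ • R.mixed k i ω - ∑ j, R.mixed k j ω)
      (R.noise k i ω)) (2 * C.sigma ^ 2) := by
  classical
  set q := piSeq R.B (k + 1) i with hq
  have hq0 : 0 < q := h.pi_pos (k + 1) i
  let r : Fin n → ℝ := fun j => q⁻¹ * R.B k i j - 1
  let Z : Fin n → Ω → EuclideanSpace ℝ (Fin p) := fun j ω =>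
    if j = i then R.y k j ω - R.noise k j ω else R.y k j ω
  have hZm : ∀ j, Measurable[R.others k i] (Z j) := by
    intro j
    by_cases hj : j = i
    · subst hj
      simpa only [Z, if_true] using h.measurable_y_sub_noise k j
    · simpa only [Z, if_neg hj] using h.measurable_y_of_ne hj
  have hZ2 : ∀ j, MemLp (Z j) 2 P := by
    intro j
    by_cases hj : j = i
    · have hZ : Z j = R.y k j - R.noise k j := funext fun ω => if_pos hj
      rw [hZ]
      exact (h.memLp_y k j).sub (h.memLp_noise k j)
    · simpa only [Z, if_neg hj] using h.memLp_y k j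
  have hW : ∀ ω, q⁻¹ • R.mixed k i ω - ∑ j, R.mixed k j ω = ∑ j, r j • R.y k j ω := by
    intro ω
    simp only [mixed, sum_sum_smul_of_colSum (h.B_sum k), r, sub_smul, one_smul,
      Finset.sum_sub_distrib, Finset.smul_sum, smul_smul]
  have hWZ : ∀ ω, q⁻¹ • R.mixed k i ω - ∑ j, R.mixed k j ω - (q⁻¹ * R.B k i i - 1) • R.noise k i ω
      = ∑ j, r j • Z j ω := by
    intro ω
    have h1 : ∑ j, r j • Z j ω
        = ∑ j, (r j • R.y k j ω - if j = i then r j • R.noise k j ω else 0) := by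
      refine Finset.sum_congr rfl fun j _ => ?_
      by_cases hj : j = i
      · simp only [Z, if_pos hj, smul_sub]
      · simp only [Z, if_neg hj, sub_zero]
    rw [hW, h1, Finset.sum_sub_distrib, Finset.sum_ite_eq' Finset.univ i,
      if_pos (Finset.mem_univ i)]
  have h0 := h.meanLe_inner_noise (k := k) (i := i) (H := fun ω => ∑ j, r j • Z j ω)
    (Finset.measurable_fun_sum _ fun j _ => (hZm j).const_smul (r j))
    (memLp_finsetSum (f := fun j ω => r j • Z j ω) Finset.univ
      fun j _ => (hZ2 j).const_smul (r j)) (-2)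
  have h1 := h0.add ((h.meanLe_norm_noise_sq k i).const_mul (by norm_num : (0 : ℝ) ≤ 2))
  rw [zero_add] at h1
  have hint : Integrable (fun ω => -2 * inner ℝ (q⁻¹ • R.mixed k i ω - ∑ j, R.mixed k j ω)
      (R.noise k i ω)) P :=
    (integrable_inner_of_memLp (((h.memLp_mixed k i).const_smul q⁻¹).sub
      (memLp_finsetSum (f := fun j => R.mixed k j) Finset.univ fun j _ => h.memLp_mixed k j))
      (h.memLp_noise k i)).const_mul (-2)
  refine ⟨hint, h1.integral_le hint fun ω => ?_⟩
  have h2 := neg_two_mul_inner_le_add_smul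
    (mul_nonneg (inv_nonneg.2 hq0.le) (h.B_nonneg k i i))
    (q⁻¹ • R.mixed k i ω - ∑ j, R.mixed k j ω) (R.noise k i ω)
  rw [hWZ] at h2
  exact h2

/-- The new decision of agent `i` depends on its own noise only through the term `-α n`, and the
gradient is Lipschitz, so that their correlation is of order `α`. -/
theorem meanLe_inner_gradient_noise (k : ℕ) (i : Fin n) :
    MeanLe P (fun ω => -2 * inner ℝ (gradient (R.f i) (R.x (k + 1) i ω)
      - gradient (R.f i) (R.x k i ω)) (R.noise k i ω)) (2 * (C.L * R.α) * C.sigma ^ 2) := by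
  let u : Ω → EuclideanSpace ℝ (Fin p) := fun ω =>
    ∑ j, R.A k i j • R.x k j ω - R.α • (R.y k i ω - R.noise k i ω)
  have hum : Measurable[R.others k i] u :=
    (Finset.measurable_fun_sum _ fun j _ => (h.measurable_x k i j).const_smul (R.A k i j)).sub
      ((h.measurable_y_sub_noise k i).const_smul R.α)
  have hu2 : MemLp u 2 P :=
    (memLp_finsetSum (f := fun j ω => R.A k i j • R.x k j ω) Finset.univ
      fun j _ => (h.memLp_x k j).const_smul (R.A k i j)).sub
      (((h.memLp_y k i).sub (h.memLp_noise k i)).const_smul R.α)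
  have hux : ∀ ω, R.x (k + 1) i ω = u ω - R.α • R.noise k i ω := by
    intro ω
    simp only [u, x_succ, smul_sub]
    abel
  have h0 := h.meanLe_inner_noise (k := k) (i := i)
    (H := fun ω => gradient (R.f i) (u ω) - gradient (R.f i) (R.x k i ω))
    (((R.measurable_gradient h.smooth i).comp hum).sub (h.measurable_gradient k i i))
    ((memLp_comp_of_lipschitz (h.smooth i).2 hu2).sub (h.memLp_gradient k i)) (-2)
  have hLα : 0 ≤ 2 * (C.L * R.α) := by
    have := h.adm.L_pos
    have := h.α_pos
    positivity
  have h1 := h0.add ((h.meanLe_norm_noise_sq k i).const_mul hLα)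
  rw [zero_add] at h1
  have hint := (integrable_inner_of_memLp ((h.memLp_gradient (k + 1) i).sub (h.memLp_gradient k i))
    (h.memLp_noise k i)).const_mul (-2)
  refine ⟨hint, h1.integral_le hint fun ω => ?_⟩
  have h2 := neg_two_mul_inner_le h.α_pos.le (h.smooth i).2 (R.x k i ω) (u ω) (R.noise k i ω)
  rw [← hux] at h2
  exact h2

/-- The third row. -/
theorem integral_track_succ_le (k : ℕ) :
    ∫ ω, R.track (k + 1) ω ∂P
      ≤ (1 + C.tau ^ 2) / 2 * ∫ ω, R.track k ω ∂P
        + C.nu * (4 * C.vphi ^ 2 * ∫ ω, R.cons phi k ω ∂P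
          + R.α ^ 2 * (∫ ω, R.track k ω ∂P + (n * C.L ^ 2 * C.vphi ^ 2 *
            (∫ ω, R.gap phi xstar k ω ∂P + ∫ ω, R.cons phi k ω ∂P) + n * C.sigma ^ 2)))
        + 2 * n * C.psi * C.sigma ^ 2 * (1 + C.L * R.α) + 2 * n * C.sigma ^ 2 := by
  have hn := h.adm.n_pos
  have hτ : 0 < 1 - C.tau ^ 2 := by linarith [h.adm.tau_sq_lt_one]
  have hψ : 0 ≤ C.psi := hn.le.trans h.adm.le_psi
  have hL := h.adm.L_pos
  have hnu := h.adm.nu_pos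
  let q : Fin n → ℝ := piSeq R.B (k + 1)
  let H : Fin n → Ω → EuclideanSpace ℝ (Fin p) := fun i ω =>
    gradient (R.f i) (R.x (k + 1) i ω) - gradient (R.f i) (R.x k i ω)
  let W : Fin n → Ω → EuclideanSpace ℝ (Fin p) := fun i ω =>
    (q i)⁻¹ • R.mixed k i ω - ∑ j, R.mixed k j ω
  have hH2 : ∀ i, MemLp (H i) 2 P := fun i =>
    (h.memLp_gradient (k + 1) i).sub (h.memLp_gradient k i)
  have hW2 : ∀ i, MemLp (W i) 2 P := fun i => ((h.memLp_mixed k i).const_smul (q i)⁻¹).sub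
    (memLp_finsetSum (f := fun j => R.mixed k j) Finset.univ fun j _ => h.memLp_mixed k j)
  have hmixm : ∀ i j, Measurable[R.others (k + 1) i] (R.mixed k j) := fun i j =>
    Finset.measurable_fun_sum _ fun l _ => (h.measurable_y_succ k i l).const_smul (R.B k j l)
  -- `W`, the gradient difference and the old noise are all independent of the fresh samples
  have hfresh : ∀ i, MeanLe P (fun ω => 2 * inner ℝ (W i ω + C.psi • (H i ω - R.noise k i ω))
      (R.noise (k + 1) i ω)) 0 := fun i =>
    h.meanLe_inner_noise (H := fun ω => W i ω + C.psi • (H i ω - R.noise k i ω))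
      ((((hmixm i i).const_smul (q i)⁻¹).sub
        (Finset.measurable_fun_sum _ fun j _ => hmixm i j)).add
        ((((h.measurable_gradient (k + 1) i i).sub
          ((R.measurable_gradient h.smooth i).comp (h.measurable_x_succ k i i))).sub
          (h.measurable_noise_succ k i i)).const_smul C.psi))
      ((hW2 i).add (((hH2 i).sub (h.memLp_noise k i)).const_smul C.psi)) 2
  have hcoef : 2 * C.kappa ^ 2 * C.tau ^ 2 / (1 - C.tau ^ 2) + C.psi = C.nu / (2 * C.L ^ 2) := by
    rw [Consts.nu]; field_simp; ring
  have hHle : MeanLe P (fun ω => ∑ i, ‖H i ω‖ ^ 2) (C.L ^ 2 * (8 * C.vphi ^ 2 *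
      ∫ ω, R.cons phi k ω ∂P + 2 * R.α ^ 2 * (∫ ω, R.track k ω ∂P + (n * C.L ^ 2 * C.vphi ^ 2 *
            (∫ ω, R.gap phi xstar k ω ∂P + ∫ ω, R.cons phi k ω ∂P) + n * C.sigma ^ 2)))) := by
    have hint : Integrable (fun ω => ∑ i, ‖H i ω‖ ^ 2) P :=
      integrable_finsetSum _ fun i _ => (hH2 i).integrable_norm_pow two_ne_zero
    refine ⟨hint, ((((MeanLe.of_integrable (h.integrable_cons k)).const_mul
      (by positivity : 0 ≤ 8 * C.vphi ^ 2)).add ((h.meanLe_sum_norm_y_sq k).const_mul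
      (by positivity : 0 ≤ 2 * R.α ^ 2))).const_mul (sq_nonneg C.L)).integral_le hint fun ω => ?_⟩
    have h1 := sum_norm_step_sq_le (α := R.α) (h.adm.c_sq_lt_one.le) (h.cons_nonneg k ω)
      (sq_nonneg C.vphi) (h.phi_ge k) (h.phi_ge (k + 1)) (fun i => R.x k i ω)
      (fun i => ∑ j, R.A k i j • R.x k j ω) (fun i => R.y k i ω) (R.xhat phi k ω) rfl
      (h.contract_A k fun i => R.x k i ω)
    refine le_trans ?_ (mul_le_mul_of_nonneg_left h1 (sq_nonneg C.L))
    rw [Finset.mul_sum]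
    refine Finset.sum_le_sum fun i _ => ?_
    rw [← mul_pow]
    exact pow_le_pow_left₀ (norm_nonneg _) ((h.smooth i).2 _ _) 2
  have h1 := (((((((MeanLe.of_integrable (h.integrable_track k)).const_mul
    (by positivity : 0 ≤ (1 + C.tau ^ 2) / 2)).add (hHle.const_mul
    (by positivity : 0 ≤ C.nu / (2 * C.L ^ 2)))).add
    ((h.meanLe_sum_norm_noise_sq (k + 1)).const_mul hψ)).add
    ((h.meanLe_sum_norm_noise_sq k).const_mul hψ)).add
    ((MeanLe.sum fun i => h.meanLe_inner_gradient_noise k i).const_mul hψ)).add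
    (MeanLe.sum hfresh)).add (MeanLe.sum fun i => h.meanLe_inner_mixed_noise k i)
  have h2 := h1.integral_le (h.integrable_track (k + 1)) fun ω => by
    have h3 := sum_weight_norm_add_noise_sq_le h.adm.tau_pos h.adm.tau_lt_one (h.pi_pos (k + 1))
      (h.pi_sum (k + 1)) (h.pi_inv_le_psi k) (h.pi_inv_le_kappa (k + 1)) (fun i => R.mixed k i ω)
      (fun i => H i ω) (fun i => R.noise k i ω) (fun i => R.noise (k + 1) i ω)
      (h.contract_B k fun i => R.y k i ω)
    rw [hcoef] at h3
    simp only [track, y_succ]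
    exact h3
  refine h2.trans (le_of_eq ?_)
  simp only [Finset.sum_const, Finset.card_univ, Fintype.card_fin, nsmul_eq_mul, mul_zero]
  field_simp
  ring

end Setting

end Run

/-! ### The weights -/

section Weights

variable {n : ℕ} {w : Fin n → ℝ}

theorem iInf_pos_of_pos [Nonempty (Fin n)] (hw : ∀ i, 0 < w i) : 0 < ⨅ i, w i := by
  obtain ⟨i, hi⟩ := exists_eq_ciInf_of_finite (f := w)
  rw [← hi]
  exact hw i

theorem inv_le_sqrt_iInf_sq (hw : ∀ i, 0 < w i) (i : Fin n) :
    (w i)⁻¹ ≤ Real.sqrt (1 / ⨅ j, w j) ^ 2 := by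
  have : Nonempty (Fin n) := ⟨i⟩
  have h0 := iInf_pos_of_pos hw
  rw [Real.sq_sqrt (by positivity), one_div]
  exact inv_anti₀ h0 (ciInf_le (Set.finite_range w).bddBelow i)

theorem le_of_inv_le (hw : ∀ i, 0 < w i) (hsum : ∑ i, w i = 1) {K : ℝ} (hK : ∀ i, (w i)⁻¹ ≤ K) :
    (n : ℝ) ≤ K := by
  have h1 : ∀ i, 1 ≤ K * w i := fun i => (inv_le_iff_one_le_mul₀ (hw i)).1 (hK i)
  have h2 := Finset.sum_le_sum fun i (_ : i ∈ Finset.univ) => h1 i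
  rw [← Finset.mul_sum, hsum] at h2
  simpa using h2

theorem pos_of_sqrt_one_sub_lt_one {X c : ℝ} (h : Real.sqrt (1 - X) ≤ c) (hc : c < 1) : 0 < X := by
  by_contra! hX
  have : 1 ≤ Real.sqrt (1 - X) := Real.one_le_sqrt.2 (by linarith)
  linarith

theorem one_sub_le_sq_of_sqrt_le {X c : ℝ} (h : Real.sqrt (1 - X) ≤ c) : 1 - X ≤ c ^ 2 :=
  (Real.sqrt_le_iff.1 h).2

theorem piSeq_nonneg {B : ℕ → Matrix (Fin n) (Fin n) ℝ} (hB : ∀ k i j, 0 ≤ B k i j) (k : ℕ)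
    (i : Fin n) : 0 ≤ piSeq B k i := by
  induction k generalizing i with
  | zero => exact one_div_nonneg.2 (Nat.cast_nonneg n)
  | succ k ih =>
    exact Finset.sum_nonneg (s := Finset.univ) (f := fun j => B k i j * piSeq B k j) fun j _ =>
      mul_nonneg (hB k i j) (ih j)

theorem piSeq_sum (hn : 0 < n) {B : ℕ → Matrix (Fin n) (Fin n) ℝ} (hB : ∀ k j, ∑ i, B k i j = 1)
    (k : ℕ) : ∑ i, piSeq B k i = 1 := by
  induction k with
  | zero =>
    have : (n : ℝ) ≠ 0 := Nat.cast_ne_zero.2 hn.ne'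
    simp [piSeq, this]
  | succ k ih =>
    simp only [piSeq, Matrix.mulVec, dotProduct]
    rw [Finset.sum_comm, ← ih]
    refine Finset.sum_congr rfl fun j _ => ?_
    rw [← Finset.sum_mul, hB, one_mul]

variable {E : Type*} [NormedAddCommGroup E] [InnerProductSpace ℝ E] {G : ℕ → Digraph (Fin n)}

/-- Mixing the decisions contracts the consensus error by the factor `c`. -/
theorem consensus_contraction {phi : ℕ → Fin n → ℝ} {A : Matrix (Fin n) (Fin n) ℝ} {a c : ℝ} {k : ℕ}
    (hG : StronglyConnected (G k)) (hphi : ∀ k i, 0 < phi k i)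
    (hsum : ∑ i, phi k i = 1) (hA : ∀ i j, 0 ≤ A i j) (hAsum : ∀ i, ∑ j, A i j = 1)
    (hphiA : ∀ j, ∑ i, phi (k + 1) i * A i j = phi k j) (ha : 0 < a)
    (hAa : ∀ i j, (G k).Adj j i ∨ j = i → a ≤ A i j) (hc : cSeq G phi a k ≤ c) (x : Fin n → E) :
    ∑ i, phi (k + 1) i * ‖(∑ j, A i j • x j) - ∑ j, phi k j • x j‖ ^ 2
      ≤ c ^ 2 * ∑ i, phi k i * ‖x i - ∑ j, phi k j • x j‖ ^ 2 := by
  rcases isEmpty_or_nonempty (Fin n) with _ | _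
  · simp
  have h0 := iInf_pos_of_pos (hphi (k + 1))
  refine (sum_weight_norm_mulVec_sub_sq_le hG hA hAsum (fun i => (hphi k i).le) hsum
    (fun i => (hphi (k + 1) i).le) hphiA (w := (⨅ i, phi (k + 1) i) * a ^ 2)
    (by positivity) (fun i j hij => ?_)
    (fun i => le_ciSup (Set.finite_range (phi k)).bddAbove i) x).trans ?_
  · rw [sq]
    exact mul_le_mul (ciInf_le (Set.finite_range _).bddBelow i)
      (mul_le_mul (hAa i i (Or.inr rfl)) (hAa i j (Or.inl hij)) ha.le (hA i i))
      (mul_nonneg ha.le ha.le) (hphi _ i).le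
  · exact mul_le_mul_of_nonneg_right (one_sub_le_sq_of_sqrt_le hc)
      (Finset.sum_nonneg fun i _ => mul_nonneg (hphi k i).le (sq_nonneg _))

/-- Mixing the directions contracts the tracking error by the factor `τ`: in terms of the rescaled
directions `y j / π j` it is a mixing step with the row-stochastic matrix
`B i j * π j / π' i`. -/
theorem tracking_contraction {pie : ℕ → Fin n → ℝ} {B : Matrix (Fin n) (Fin n) ℝ} {b τ : ℝ} {k : ℕ}
    (hG : StronglyConnected (G k)) (hpie : ∀ k i, 0 < pie k i)
    (hsum : ∑ i, pie k i = 1) (hB : ∀ i j, 0 ≤ B i j) (hBsum : ∀ j, ∑ i, B i j = 1)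
    (hpieB : pie (k + 1) = B.mulVec (pie k)) (hb : 0 < b)
    (hBb : ∀ i j, (G k).Adj j i ∨ j = i → b ≤ B i j) (hτ : tauSeq G pie b k ≤ τ) (y : Fin n → E) :
    ∑ i, pie (k + 1) i * ‖(pie (k + 1) i)⁻¹ • (∑ j, B i j • y j) - ∑ l, ∑ j, B l j • y j‖ ^ 2
      ≤ τ ^ 2 * ∑ i, pie k i * ‖(pie k i)⁻¹ • y i - ∑ j, y j‖ ^ 2 := by
  rcases isEmpty_or_nonempty (Fin n) with _ | _
  · simp
  have h0 := iInf_pos_of_pos (hpie k)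
  have h0' : 0 < ⨆ i, pie (k + 1) i :=
    (hpie (k + 1) (Classical.arbitrary _)).trans_le
      (le_ciSup (Set.finite_range (pie (k + 1))).bddAbove _)
  let R : Matrix (Fin n) (Fin n) ℝ := fun i j => (pie (k + 1) i)⁻¹ * (B i j * pie k j)
  have hRsum : ∀ i, ∑ j, R i j = 1 := by
    intro i
    have h1 : ∑ j, B i j * pie k j = pie (k + 1) i := by rw [hpieB]; rfl
    simp only [R, ← Finset.mul_sum, h1]
    exact inv_mul_cancel₀ (hpie _ i).ne'
  have hpR : ∀ j, ∑ i, pie (k + 1) i * R i j = pie k j := by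
    intro j
    simp only [R, mul_inv_cancel_left₀ (hpie (k + 1) _).ne', ← Finset.sum_mul, hBsum, one_mul]
  have hy : ∀ j, pie k j • (pie k j)⁻¹ • y j = y j := fun j => smul_inv_smul₀ (hpie k j).ne' _
  have hRy : ∀ i, ∑ j, R i j • (pie k j)⁻¹ • y j = (pie (k + 1) i)⁻¹ • ∑ j, B i j • y j := by
    intro i
    simp only [R, mul_smul, hy, Finset.smul_sum]
  have hsumy : ∑ l, ∑ j, B l j • y j = ∑ j, y j := sum_sum_smul_of_colSum hBsum y
  have hmain := sum_weight_norm_mulVec_sub_sq_le (R := R) hG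
    (fun i j => mul_nonneg (inv_nonneg.2 (hpie _ i).le) (mul_nonneg (hB i j) (hpie k j).le))
    hRsum (fun i => (hpie k i).le) hsum (fun i => (hpie (k + 1) i).le) hpR
    (w := (⨅ i, pie k i) ^ 2 * b ^ 2 / ⨆ i, pie (k + 1) i) (by positivity) (fun i j hij => ?_)
    (fun i => le_ciSup (Set.finite_range (pie k)).bddAbove i) (fun j => (pie k j)⁻¹ • y j)
  · simp only [hRy, hy] at hmain
    rw [hsumy]
    refine hmain.trans (mul_le_mul_of_nonneg_right ?_
      (Finset.sum_nonneg fun i _ => mul_nonneg (hpie k i).le (sq_nonneg _)))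
    have h1 := one_sub_le_sq_of_sqrt_le hτ
    refine le_trans (le_of_eq ?_) h1
    rw [div_div]
    congr 2
    ring
  · have h1 : pie (k + 1) i * (R i i * R i j)
        = B i i * pie k i * (B i j * pie k j) / pie (k + 1) i := by
      have := (hpie (k + 1) i).ne'
      simp only [R]
      field_simp
    have hm : ∀ l, ⨅ i, pie k i ≤ pie k l := ciInf_le (Set.finite_range _).bddBelow
    rw [h1]
    refine div_le_div₀ (by have := hB i i; have := hB i j; have := (hpie k i).le
                           have := (hpie k j).le; positivity) ?_ (hpie _ i)
      (le_ciSup (Set.finite_range (pie (k + 1))).bddAbove i)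
    calc (⨅ i, pie k i) ^ 2 * b ^ 2 = (b * ⨅ i, pie k i) * (b * ⨅ i, pie k i) := by ring
      _ ≤ B i i * pie k i * (B i j * pie k j) := by
        have h2 := hBb i i (Or.inr rfl)
        have h3 := hBb i j (Or.inl hij)
        exact mul_le_mul (mul_le_mul h2 (hm i) h0.le (hB i i))
          (mul_le_mul h3 (hm j) h0.le (hB i j)) (by positivity)
          (mul_nonneg (hB i i) (hpie k i).le)

end Weights

/-- The hypotheses of the convergence theorem provide the setting of the one-step estimates.
The weights are positive because `c_k` and `τ_k`, being less than one, are not trivial. -/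
theorem Run.setting {n p m : ℕ} (hn : 2 ≤ n) (hp : 1 ≤ p) {Ω : Type*} [MeasurableSpace Ω]
    {P : Measure Ω} [IsProbabilityMeasure P] (R : Run n p m Ω) {xstar : EuclideanSpace ℝ (Fin p)}
    (hxstar : ∀ x, avgCost R.f xstar ≤ avgCost R.f x) {G : ℕ → Digraph (Fin n)} {a b : ℝ}
    {phi : ℕ → Fin n → ℝ} (hphi : ∀ k, phi k ∈ stdSimplex ℝ (Fin n))
    (hphiA : ∀ k, Matrix.vecMul (phi (k + 1)) (R.A k) = phi k)
    {C : Consts} (hL : 0 < C.L) (hmu : 0 < C.mu) (hsigma : 0 < C.sigma)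
    (hC : IsBounds G phi (piSeq R.B) a b C) (hf : SmoothCosts R.f C.L)
    (hconv : StronglyConvexAvg R.f C.mu) (hG : ∀ k, StronglyConnected (G k))
    (horacle : IsOracle P R.f R.g R.ξ C.sigma)
    (hA : ∀ k, R.A k ∈ Matrix.rowStochastic ℝ (Fin n) ∧ Compatible (G k) (R.A k))
    (ha : 0 < a) (hAa : ∀ k, PosEntriesGe (R.A k) a)
    (hB : ∀ k, R.B k ∈ Matrix.colStochastic ℝ (Fin n) ∧ Compatible (G k) (R.B k))
    (hb : 0 < b) (hBb : ∀ k, PosEntriesGe (R.B k) b)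
    (hα : 0 < R.α) (hα' : R.α ≤ C.stepBound n) : R.Setting phi xstar P C := by
  have hn0 : 0 < n := by omega
  have : Nonempty (Fin n) := ⟨⟨0, hn0⟩⟩
  have hn2 : (2 : ℝ) ≤ n := by exact_mod_cast hn
  have hA0 : ∀ k i j, 0 ≤ R.A k i j := fun k i j => (hA k).1.1 i j
  have hA1 : ∀ k i, ∑ j, R.A k i j = 1 := fun k i => by
    have := congrFun (hA k).1.2 i
    simpa [Matrix.mulVec, dotProduct] using this
  have hB0 : ∀ k i j, 0 ≤ R.B k i j := fun k i j => (hB k).1.1 i j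
  have hB1 : ∀ k j, ∑ i, R.B k i j = 1 := fun k j => by
    have := congrFun (hB k).1.2 j
    simpa [Matrix.vecMul, dotProduct] using this
  have hphiA' : ∀ k j, ∑ i, phi (k + 1) i * R.A k i j = phi k j := fun k j =>
    congrFun (hphiA k) j
  have hphi_succ : ∀ k i, 0 < phi (k + 1) i := by
    intro k i
    have h1 := pos_of_sqrt_one_sub_lt_one (hC.c_ge k) hC.c_lt_one
    have h2 : (⨅ i, phi (k + 1) i) ≠ 0 := fun h0 => by simp [h0] at h1
    have h3 : 0 ≤ ⨅ i, phi (k + 1) i := Real.iInf_nonneg (hphi (k + 1)).1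
    exact (lt_of_le_of_ne h3 h2.symm).trans_le (ciInf_le (Set.finite_range _).bddBelow i)
  have hphi_pos : ∀ k i, 0 < phi k i := by
    intro k i
    have h1 : phi (k + 1) i * R.A k i i ≤ phi k i := by
      rw [← hphiA' k i]
      exact Finset.single_le_sum (f := fun l => phi (k + 1) l * R.A k l i)
        (fun l _ => mul_nonneg (hphi_succ k l).le (hA0 k l i)) (Finset.mem_univ i)
    exact (mul_pos (hphi_succ k i) (((hA k).2 i i).1 (Or.inr rfl))).trans_le h1
  have hpi0 := fun k i => piSeq_nonneg hB0 k i
  have hpi1 := fun k => piSeq_sum hn0 hB1 k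
  have hpi_pos : ∀ k i, 0 < piSeq R.B k i := by
    intro k i
    have h1 := pos_of_sqrt_one_sub_lt_one (hC.tau_ge k) hC.tau_lt_one
    have h2 : (⨅ i, piSeq R.B k i) ≠ 0 := fun h0 => by simp [h0] at h1
    have h3 : 0 ≤ ⨅ i, piSeq R.B k i := Real.iInf_nonneg (hpi0 k)
    exact (lt_of_le_of_ne h3 h2.symm).trans_le (ciInf_le (Set.finite_range _).bddBelow i)
  have hpi_kappa : ∀ k i, (piSeq R.B k i)⁻¹ ≤ C.kappa ^ 2 := fun k i =>
    (inv_le_sqrt_iInf_sq (hpi_pos k) i).trans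
      (pow_le_pow_left₀ (Real.sqrt_nonneg _) (hC.kappa_ge k) 2)
  have hphi_inv : ∀ k i, (phi k i)⁻¹ ≤ C.vphi ^ 2 := fun k i =>
    (inv_le_sqrt_iInf_sq (hphi_pos k) i).trans
      (pow_le_pow_left₀ (Real.sqrt_nonneg _) (hC.vphi_ge k) 2)
  have hkn : ∀ k, (n : ℝ) ≤ kappaSeq (piSeq R.B) k ^ 2 := fun k =>
    le_of_inv_le (hpi_pos k) (hpi1 k) (inv_le_sqrt_iInf_sq (hpi_pos k))
  -- `κ² ≤ n (κ² - 1)` as soon as `κ² ≥ n ≥ 2`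
  have hkpsi : ∀ k, kappaSeq (piSeq R.B) (k + 1) ^ 2 ≤ C.psi := fun k => by
    have h1 : n * (kappaSeq (piSeq R.B) (k + 1) ^ 2 - 1) ≤ C.psi := hC.psi_ge k
    have h2 := hkn (k + 1)
    nlinarith
  have htheta : ∀ k, ∑ i, phi (k + 1) i * piSeq R.B k i ≤ 1 := fun k => by
    rw [← hpi1 k]
    refine Finset.sum_le_sum fun i _ => mul_le_of_le_one_left (hpi0 k i) ?_
    rw [← (hphi (k + 1)).2]
    exact Finset.single_le_sum (fun j _ => (hphi_pos _ j).le) (Finset.mem_univ i)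
  have hAa' : ∀ k i j, (G k).Adj j i ∨ j = i → a ≤ R.A k i j := fun k i j hij =>
    hAa k i j (((hA k).2 i j).1 hij)
  have hBb' : ∀ k i j, (G k).Adj j i ∨ j = i → b ≤ R.B k i j := fun k i j hij =>
    hBb k i j (((hB k).2 i j).1 hij)
  exact
    { adm :=
        { two_le := hn2
          L_pos := hL
          mu_pos := hmu
          mu_le := mu_le_L hp hn0 hf hconv
          sigma_pos := hsigma
          eta_pos := hC.eta_pos
          eta_le_one := (hC.eta_le 0).trans (htheta 0)
          c_pos := hC.c_pos
          c_lt_one := hC.c_lt_one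
          tau_pos := hC.tau_pos
          tau_lt_one := hC.tau_lt_one
          kappa_pos := one_pos.trans hC.kappa_gt_one
          le_kappa_sq := le_of_inv_le (hpi_pos 0) (hpi1 0) (hpi_kappa 0)
          vphi_pos := one_pos.trans hC.vphi_gt_one
          le_vphi_sq := le_of_inv_le (hphi_pos 0) (hphi 0).2 (hphi_inv 0)
          le_psi := (hkn 1).trans (hkpsi 0)
          psi_le := hC.psi_le.trans (by nlinarith) }
      smooth := hf
      oracle := horacle
      α_pos := hα
      α_le := hα'
      sum_gradient := sum_gradient_eq_zero hn0 hf hxstar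
      mono := hconv.mul_norm_sq_le hn0 hf
      phi_pos := hphi_pos
      phi_sum := fun k => (hphi k).2
      phi_ge := fun k i => (inv_le_iff_one_le_mul₀ (hphi_pos k i)).1 (hphi_inv k i)
      phi_adjoint := hphiA'
      pi_pos := hpi_pos
      pi_sum := hpi1
      pi_inv_le_kappa := hpi_kappa
      pi_inv_le_psi := fun k i => (inv_le_sqrt_iInf_sq (hpi_pos (k + 1)) i).trans (hkpsi k)
      B_nonneg := hB0
      B_sum := hB1
      eta_le := hC.eta_le
      contract_A := fun k x => consensus_contraction (hG k) hphi_pos (hphi k).2 (hA0 k) (hA1 k)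
        (hphiA' k) ha (hAa' k) (hC.c_ge k) x
      contract_B := fun k y => tracking_contraction (hG k) hpi_pos (hpi1 k) (hB0 k) (hB1 k)
        rfl hb (hBb' k) (hC.tau_ge k) y }

/-! ### Comparison of the errors with the fixed point -/

/-- A damped linear recursion. Row `r` of the recursion may be executed only by the fraction
`s k r ≥ s₀` at time `k`; the fixed point is not affected, and the strict slack `ε` in the recursion
keeps the limit strictly below it. -/
theorem exists_le_sub_add_pow {ι : Type*} [Fintype ι] [Nonempty ι] {M : Matrix ι ι ℝ}
    (hM : ∀ i j, 0 ≤ M i j) {v : ι → ℝ} (hv : ∀ i, 0 < v i) (hMv : ∀ i, M.mulVec v i < v i)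
    {e b ε : ι → ℝ} (he : ∀ i, e i = M.mulVec e i + b i) (hε : ∀ i, 0 < ε i)
    {s : ℕ → ι → ℝ} {s₀ : ℝ} (hs₀ : 0 < s₀) (hs : ∀ k i, s₀ ≤ s k i) (hs1 : ∀ k i, s k i ≤ 1)
    {W : ℕ → ι → ℝ}
    (hW : ∀ k i, W (k + 1) i ≤ (1 - s k i) * W k i + s k i * (M.mulVec (W k) i + b i - ε i)) :
    ∃ δ K ρ : ℝ, 0 < δ ∧ 0 ≤ ρ ∧ ρ < 1 ∧ ∀ k i, W k i ≤ e i - δ * v i + K * ρ ^ k * v i := by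
  obtain ⟨ρ₀, hρ₀, hρ₀1, hρv⟩ := exists_contraction_factor hv hMv
  -- the slack that can be given to every component of the fixed point
  obtain ⟨i₀, -, hi₀⟩ := Finset.exists_min_image Finset.univ (fun i => ε i / v i)
    Finset.univ_nonempty
  set δ := ε i₀ / v i₀ with hδ
  have hδ0 : 0 < δ := div_pos (hε _) (hv _)
  have hδε : ∀ i, δ * v i ≤ ε i := fun i =>
    (le_div_iff₀ (hv i)).1 (hi₀ i (Finset.mem_univ i))
  obtain ⟨i₁, -, hi₁⟩ := Finset.exists_max_image Finset.univ
    (fun i => (W 0 i - (e i - δ * v i)) / v i) Finset.univ_nonempty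
  set K := max 0 ((W 0 i₁ - (e i₁ - δ * v i₁)) / v i₁) with hK
  have hK0 : 0 ≤ K := le_max_left _ _
  have hs₀1 : s₀ ≤ 1 := (hs 0 i₀).trans (hs1 0 i₀)
  refine ⟨δ, K, 1 - s₀ * (1 - ρ₀), hδ0, ?_, ?_, ?_⟩
  · have : s₀ * (1 - ρ₀) ≤ 1 := mul_le_one₀ hs₀1 (by linarith) (by linarith)
    linarith
  · have : 0 < s₀ * (1 - ρ₀) := mul_pos hs₀ (by linarith)
    linarith
  set ρ := 1 - s₀ * (1 - ρ₀) with hρ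
  intro k
  induction k with
  | zero =>
    intro i
    have h1 := (hi₁ i (Finset.mem_univ i)).trans (le_max_right 0 _)
    rw [← hK, div_le_iff₀ (hv i)] at h1
    rw [pow_zero, mul_one]
    linarith
  | succ k ih =>
    intro i
    set t := K * ρ ^ k with ht
    have hρ0 : 0 ≤ ρ := by
      have : s₀ * (1 - ρ₀) ≤ 1 := mul_le_one₀ hs₀1 (by linarith) (by linarith)
      linarith
    have ht0 : 0 ≤ t := mul_nonneg hK0 (pow_nonneg hρ0 k)
    have h1 : M.mulVec (W k) i ≤ M.mulVec e i + (t - δ) * M.mulVec v i := by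
      simp only [Matrix.mulVec, dotProduct, Finset.mul_sum, ← Finset.sum_add_distrib]
      refine Finset.sum_le_sum fun j _ => ?_
      have := mul_le_mul_of_nonneg_left (ih j) (hM i j)
      linarith
    have h2 : (t - δ) * M.mulVec v i ≤ t * (ρ₀ * v i) := by
      have h3 : 0 ≤ M.mulVec v i := Finset.sum_nonneg fun j _ => mul_nonneg (hM i j) (hv j).le
      have h4 := mul_le_mul_of_nonneg_left (hρv i) ht0
      have h5 := mul_nonneg hδ0.le h3
      linarith
    have h3 : M.mulVec (W k) i + b i - ε i ≤ e i - δ * v i + t * (ρ₀ * v i) := by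
      linarith [he i, hδε i]
    have hsk0 : 0 ≤ s k i := hs₀.le.trans (hs k i)
    have h4 := mul_le_mul_of_nonneg_left h3 hsk0
    have h5 := mul_le_mul_of_nonneg_left (ih i) (sub_nonneg.2 (hs1 k i))
    have h6 : s₀ * ((1 - ρ₀) * (t * v i)) ≤ s k i * ((1 - ρ₀) * (t * v i)) :=
      mul_le_mul_of_nonneg_right (hs k i)
        (mul_nonneg (by linarith) (mul_nonneg ht0 (hv i).le))
    have h7 : K * ρ ^ (k + 1) * v i = t * v i - s₀ * ((1 - ρ₀) * (t * v i)) := by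
      rw [ht, pow_succ, hρ]; ring
    rw [h7]
    linarith [hW k i]

/-- A sequence that is eventually at most `e` exceeds `e` by at most `K r ^ k`, for every
`r > 0`. -/
theorem exists_le_add_mul_pow {ι : Type*} [Fintype ι] {u : ℕ → ι → ℝ} {e : ι → ℝ} {r : ℝ}
    (hr : 0 < r) (hu : ∀ᶠ k in atTop, ∀ i, u k i ≤ e i) :
    ∃ K : ℝ, ∀ k i, u k i ≤ e i + K * r ^ k := by
  obtain ⟨N, hN⟩ := eventually_atTop.1 hu
  have hterm : ∀ k i, 0 ≤ |u k i - e i| / r ^ k := fun k i => by positivity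
  refine ⟨∑ k ∈ Finset.range N, ∑ i, |u k i - e i| / r ^ k, fun k i => ?_⟩
  rcases lt_or_ge k N with hk | hk
  · have h1 : |u k i - e i| / r ^ k ≤ ∑ k ∈ Finset.range N, ∑ i, |u k i - e i| / r ^ k :=
      (Finset.single_le_sum (fun i _ => hterm k i) (Finset.mem_univ i)).trans
        (Finset.single_le_sum (f := fun k => ∑ i, |u k i - e i| / r ^ k)
          (fun k _ => Finset.sum_nonneg fun i _ => hterm k i) (Finset.mem_range.2 hk))
    rw [div_le_iff₀ (by positivity)] at h1
    linarith [le_abs_self (u k i - e i)]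
  · have h1 : 0 ≤ ∑ k ∈ Finset.range N, ∑ i, |u k i - e i| / r ^ k :=
      Finset.sum_nonneg fun k _ => Finset.sum_nonneg fun i _ => hterm k i
    have h2 := mul_nonneg h1 (pow_nonneg hr.le k)
    linarith [hN k hk i]

namespace Run.Setting

variable {n p m : ℕ} {Ω : Type*} {R : Run n p m Ω} {phi : ℕ → Fin n → ℝ}
  {xstar : EuclideanSpace ℝ (Fin p)} [MeasurableSpace Ω] {P : Measure Ω} [IsProbabilityMeasure P]
  {C : Consts}

/-- The recursion for the expected errors, after the shift of the tracking error by the variance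
`n σ²` of the total direction. The shift supplies the noise that the second entry of `b(α)` and the
coefficient `b₅` do not account for; it is paid for by the constant `b₃`. -/
theorem shifted_recursion (h : R.Setting phi xstar P C) :
    ∃ ε : Fin 3 → ℝ, (∀ i, 0 < ε i) ∧ ∃ s : ℕ → Fin 3 → ℝ,
      (∀ k i, C.eta ≤ s k i) ∧ (∀ k i, s k i ≤ 1) ∧
      ∀ W : ℕ → Fin 3 → ℝ,
        (∀ k, W k = ![∫ ω, R.gap phi xstar k ω ∂P, ∫ ω, R.cons phi k ω ∂P,
          ∫ ω, R.track k ω ∂P + n * C.sigma ^ 2]) →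
        ∀ k i, W (k + 1) i ≤ (1 - s k i) * W k i
          + s k i * ((C.M n R.α).mulVec (W k) i + C.b n R.α i - ε i) := by
  have hn := h.adm.n_pos
  have hmu := h.adm.mu_pos
  have heta := h.adm.eta_pos
  have hα := h.α_pos
  have hσ := h.adm.sigma_pos
  have hL := h.adm.L_pos
  have hnu := h.adm.nu_pos
  have hψn := h.adm.le_psi
  have hψ0 : 0 < C.psi := hn.trans_le hψn
  have hψ : 2 ≤ C.psi := h.adm.two_le.trans hψn
  have hc : 0 < 1 - C.c ^ 2 := by linarith [h.adm.c_sq_lt_one]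
  have hm3 : 0 < C.m3 n := by unfold Consts.m3; positivity
  have hm5 : 0 < C.m5 := by unfold Consts.m5; positivity
  have hnσ : 0 < n * C.sigma ^ 2 := by positivity
  refine ⟨![C.m3 n * R.α * (n * C.sigma ^ 2), 2 * C.m5 * R.α ^ 2, n * C.sigma ^ 2], ?_,
    fun k => ![∑ i, phi (k + 1) i * piSeq R.B k i, 1, 1], ?_, ?_, ?_⟩
  · intro i
    fin_cases i
    · exact mul_pos (mul_pos hm3 hα) hnσ
    · exact mul_pos (mul_pos two_pos hm5) (pow_pos hα 2)
    · exact hnσ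
  · intro k i
    fin_cases i
    · exact h.eta_le k
    · exact h.adm.eta_le_one
    · exact h.adm.eta_le_one
  · intro k i
    fin_cases i
    · exact h.theta_le_one k
    · exact le_rfl
    · exact le_rfl
  intro W hW k i
  have hV1 : 0 ≤ ∫ ω, R.gap phi xstar k ω ∂P := integral_nonneg fun ω => sq_nonneg _
  have hV2 : 0 ≤ ∫ ω, R.cons phi k ω ∂P := integral_nonneg (h.cons_nonneg k)
  have h1 := h.integral_gap_succ_le k rfl
  have h2 := h.integral_cons_succ_le k
  have h3 := h.integral_track_succ_le k
  rw [hW, hW]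
  generalize (∫ ω, R.gap phi xstar k ω ∂P) = V₁ at *
  generalize (∫ ω, R.cons phi k ω ∂P) = V₂ at *
  generalize (∫ ω, R.track k ω ∂P) = V₃ at *
  fin_cases i <;>
    simp only [Consts.M, Consts.b, Matrix.mulVec, dotProduct, Fin.sum_univ_three, Matrix.of_apply,
      Matrix.cons_val', Matrix.cons_val_zero, Matrix.cons_val_one, Matrix.cons_val, Fin.zero_eta,
      Fin.mk_one, Fin.reduceFinMk, Matrix.cons_val_fin_one]
  · linarith
  · have hm4 : C.m4 n = 2 * (C.m5 * (n * C.L ^ 2 * C.vphi ^ 2)) := by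
      rw [Consts.m4, Consts.m5]; ring
    have hb2 : C.b2 = 2 * C.m5 := by rw [Consts.b2, Consts.m5]; ring
    have h4 : 0 ≤ C.m5 * R.α ^ 2 * (n * C.L ^ 2 * C.vphi ^ 2 * (V₁ + V₂)) := by positivity
    rw [hm4, hb2]
    linarith
  · have h4 : 0 ≤ C.nu * R.α ^ 2 * (n * C.L ^ 2 * C.vphi ^ 2 * (V₁ + V₂)) := by positivity
    have h5 : 0 ≤ (1 + C.tau ^ 2) / 2 * (n * C.sigma ^ 2) := by positivity
    have h6 : 0 ≤ (C.psi - 2) * (n * C.sigma ^ 2) := mul_nonneg (by linarith) hnσ.le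
    have h7 : 0 ≤ C.b5 * R.α ^ 2 := by unfold Consts.b5; positivity
    rw [Consts.m6, Consts.m7, Consts.m8, Consts.zeta, Consts.b3, Consts.b4]
    linarith

end Run.Setting

end SABTV

open SABTV in
theorem theorem1 {n p m : ℕ} (hn : 2 ≤ n) (hp : 1 ≤ p)
    {Ω : Type*} [MeasurableSpace Ω] (P : Measure Ω) [IsProbabilityMeasure P]
    -- the local costs, the minimizer of their average, the oracle
    (f : Fin n → EuclideanSpace ℝ (Fin p) → ℝ) (xstar : EuclideanSpace ℝ (Fin p))
    (hxstar : ∀ x, SABTV.avgCost f xstar ≤ SABTV.avgCost f x)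
    (g : Fin n → EuclideanSpace ℝ (Fin p) → EuclideanSpace ℝ (Fin m) → EuclideanSpace ℝ (Fin p))
    (ξ : ℕ → Fin n → Ω → EuclideanSpace ℝ (Fin m))
    -- the graphs and the weights
    (G : ℕ → Digraph (Fin n)) (A B : ℕ → Matrix (Fin n) (Fin n) ℝ) (a b : ℝ)
    -- the stochastic vectors `φ_k` with `φ_{k+1}ᵀ A_k = φ_kᵀ`
    (phi : ℕ → Fin n → ℝ)
    (hphi : ∀ k, phi k ∈ stdSimplex ℝ (Fin n))
    (hphiA : ∀ k, Matrix.vecMul (phi (k + 1)) (A k) = phi k)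
    -- the scalars
    (C : SABTV.Consts) (hL : 0 < C.L) (hmu : 0 < C.mu) (hsigma : 0 < C.sigma)
    (hC : SABTV.IsBounds G phi (SABTV.piSeq B) a b C)
    -- the assumptions
    (hf : SABTV.SmoothCosts f C.L)
    (hconv : SABTV.StronglyConvexAvg f C.mu)
    (hG : ∀ k, SABTV.StronglyConnected (G k) ∧ ∀ i, (G k).Adj i i)
    (horacle : SABTV.IsOracle P f g ξ C.sigma)
    (hA : ∀ k, A k ∈ Matrix.rowStochastic ℝ (Fin n) ∧ SABTV.Compatible (G k) (A k))
    (ha : 0 < a) (hAa : ∀ k, SABTV.PosEntriesGe (A k) a)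
    (hB : ∀ k, B k ∈ Matrix.colStochastic ℝ (Fin n) ∧ SABTV.Compatible (G k) (B k))
    (hb : 0 < b) (hBb : ∀ k, SABTV.PosEntriesGe (B k) b)
    -- the initial decisions and the step-size
    (x0 : Fin n → EuclideanSpace ℝ (Fin p))
    (α : ℝ) (hα : 0 < α) (hα' : α ≤ C.stepBound n) :
    -- the random squared errors at time `k`, and their expectations `V_k`
    let err : ℕ → Ω → Fin 3 → ℝ := fun k ω =>
      SABTV.sqErr (phi k) (SABTV.piSeq B k) xstar
        (SABTV.iterates A B g α x0 (fun t i => ξ t i ω) k)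
    let V : ℕ → Fin 3 → ℝ := fun k r => ∫ ω, err k ω r ∂P
    C.rho n α < 1 ∧
    (∀ r, 0 ≤ C.errBound n α r) ∧
    (∀ k r, Integrable (fun ω => err k ω r) P) ∧
    (∀ r, limsup (fun k => V k r) atTop ≤ C.errBound n α r) ∧
    ∃ K : ℝ, ∀ k r, V k r ≤ C.errBound n α r + K * (C.rho n α).toReal ^ k := by
  intro err V
  let R : Run n p m Ω := ⟨A, B, f, g, α, x0, ξ⟩
  have h : R.Setting phi xstar P C := R.setting hn hp hxstar hphi hphiA hL hmu hsigma hC hf hconv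
    (fun k => (hG k).1) horacle hA ha hAa hB hb hBb hα hα'
  have hM : ∀ i j, 0 < C.M n α i j := h.adm.M_pos hα hα'
  have hM0 : ∀ i j, 0 ≤ C.M n α i j := fun i j => (hM i j).le
  obtain ⟨v, hv, hMv⟩ := h.adm.exists_mulVec_lt hα hα'
  obtain ⟨ρ₀, hρ₀, hρ₀1, hρv⟩ := exists_contraction_factor hv hMv
  have hrho : C.rho n α < 1 := (spectralRadius_map_le hM0 hv hρv).trans_lt
    (ENNReal.ofReal_lt_one.2 hρ₀1)
  have hrho0 : 0 < (C.rho n α).toReal := by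
    refine ENNReal.toReal_pos (spectralRadius_map_pos ?_).ne' (hrho.trans ENNReal.one_lt_top).ne
    exact Finset.sum_pos (fun i _ => hM i i) Finset.univ_nonempty
  have hunit := isUnit_det_one_sub hM0 hv hρ₀1 hρv
  have he : ∀ i, C.errBound n α i = (C.M n α).mulVec (C.errBound n α) i + C.b n α i := by
    intro i
    have h1 : (1 - C.M n α).mulVec (C.errBound n α) = C.b n α := by
      rw [Consts.errBound, Matrix.mulVec_mulVec, Matrix.mul_nonsing_inv _ hunit, Matrix.one_mulVec]
    rw [Matrix.sub_mulVec, Matrix.one_mulVec] at h1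
    have := congrFun h1 i
    rw [Pi.sub_apply] at this
    linarith
  have hb0 : ∀ i, 0 ≤ C.b n α i := by
    have := h.adm.c_sq_lt_one
    have : 0 < 1 - C.c ^ 2 := by linarith
    have := h.adm.nu_pos
    have := hC.psi_pos
    intro i
    fin_cases i <;> simp only [Consts.b, Consts.b1, Consts.b2, Consts.b3, Consts.b4, Consts.b5,
      Matrix.cons_val_zero, Matrix.cons_val_one, Matrix.cons_val, Fin.zero_eta, Fin.mk_one,
      Fin.reduceFinMk] <;> positivity
  -- the three errors
  have herr2 : ∀ k ω, err k ω 2 = R.track k ω := fun k ω =>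
    Real.sq_sqrt (h.track_nonneg k ω)
  have hint : ∀ k r, Integrable (fun ω => err k ω r) P := by
    intro k r
    fin_cases r
    · exact h.integrable_gap k
    · exact h.integrable_cons k
    · exact (h.integrable_track k).congr (Eventually.of_forall fun ω => (herr2 k ω).symm)
  have hV0 : ∀ k r, 0 ≤ V k r := by
    intro k r
    refine integral_nonneg fun ω => ?_
    fin_cases r
    · exact sq_nonneg _
    · exact h.cons_nonneg k ω
    · exact sq_nonneg _
  obtain ⟨ε, hε, s, hs, hs1, hrec⟩ := h.shifted_recursion
  let W : ℕ → Fin 3 → ℝ := fun k => ![∫ ω, R.gap phi xstar k ω ∂P, ∫ ω, R.cons phi k ω ∂P,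
    ∫ ω, R.track k ω ∂P + n * C.sigma ^ 2]
  obtain ⟨δ, K, ρ, hδ, hρ, hρ1, hWle⟩ := exists_le_sub_add_pow hM0 hv hMv he hε h.adm.eta_pos hs hs1
    (hrec W fun k => rfl)
  have hVW : ∀ k r, V k r ≤ W k r := by
    intro k r
    fin_cases r
    · exact le_rfl
    · exact le_rfl
    · have h1 : V k 2 = ∫ ω, R.track k ω ∂P := integral_congr_ae
        (Eventually.of_forall fun ω => herr2 k ω)
      have h2 : 0 ≤ n * C.sigma ^ 2 := by positivity
      exact h1.le.trans (le_add_of_nonneg_right h2)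
  have hev : ∀ᶠ k in atTop, ∀ r, V k r ≤ C.errBound n α r := by
    have h1 : Tendsto (fun k => K * ρ ^ k) atTop (nhds (K * 0)) :=
      (tendsto_pow_atTop_nhds_zero_of_lt_one hρ hρ1).const_mul K
    rw [mul_zero] at h1
    filter_upwards [h1.eventually (gt_mem_nhds hδ)] with k hk r
    have h2 := mul_le_mul_of_nonneg_right hk.le (hv r).le
    linarith [hVW k r, hWle k r]
  refine ⟨hrho, nonneg_of_eq_mulVec_add hM0 hv hρ₀1 hρv hb0 he, hint, fun r => ?_,
    exists_le_add_mul_pow hrho0 hev⟩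
  exact limsup_le_of_le (isCoboundedUnder_le_of_le atTop (x := 0) fun k => hV0 k r)
    (hev.mono fun k hk => hk r)
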